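/- Let $n\ge 1$. A Calderón–Zygmund kernel is a function $K(x,y)$ on $\mathbb R^n\times\mathbb R^n$ with values in $\mathbb C$ for which there are constants $C<\infty$ and $0<\delta\le 1$ such that $|K(x,y)|\le C|x-y|^{-n}$ for $x\ne y$ and $|K(x,y)-K(x',y)|+|K(y,x)-K(y,x')|\le C|x-x'|^{\delta}/|x-y|^{n+\delta}$ whenever $|x-x'|<|x-y|/2$. A Calderón–Zygmund operator is a linear operator $T$, bounded on $L^2(\mathbb R^n)$, with $Tf(x)=\int K(x,y)f(y)\,dy$ for $x\notin\operatorname{supp} f$ for some such $K$ (here $Tf$ is a function with a definite value at each point, and linearity and the representation hold pointwise). For a family $\Phi=\{\phi_\alpha\}_{\alpha\in I}$ of real-valued measurable functions on $\mathbb R^n$, with $I$ an arbitrary index set, put $$T^\Phi f(x)=\sup_{\alpha\in I}\bigl|T(e^{2\pi i\phi_\alpha}f)(x)\bigr| ,\qquad f\in L^2(\mathbb R^n).$$ Assume that $T^\Phi$ satisfies the weak-type inequalities: for some $r_0>1$ and some function $\psi$ with finite values, $T^\Phi f$ is measurable and $\|T^\Phi f\|_{L^{r,\infty}}\le\psi(r)\|f\|_{L^r}$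 for all $1<r\le r_0$ and all $f\in L^2\cap L^r$. A Young function is a continuous, convex, increasing function $A:[0,\infty)\to[0,\infty)$ with $A(0)=0$ and $A(t)\to\infty$ as $t\to\infty$; it is doubling if $A(2t)\le CA(t)$ for all $t>0$ and some constant $C$. Write $\bar A(t)=\sup_{s>0}\{st-A(s)\}\in[0,\infty]$; write $\bar A\in B_q$ if $\int_c^\infty \frac{\bar A(t)}{t^q}\frac{dt}{t}<\infty$ for some $c>0$; and for a cube $Q$ (with sides parallel to the axes) write $\|f\|_{A,Q}=\inf\{\lambda>0:\frac1{|Q|}\int_Q A(|f|/\lambda)\le1\}$. **Theorem.** Let $1<p<\infty$ with $p'=p/(p-1)$, and let $A,B$ be doubling Young functions such that $\bar A\in B_{p'}$ and $\bar B\in B_{p/r}$ for some $1<r<\min\{r_0,p\}$. Let $u,v$ be positive locally integrable functions on $\mathbb R^n$ such that $$\sup_{Q}\|u^{1/p}\|_{A,Q}\,\|v^{-r/p}\|_{B,Q}^{1/r}<\infty ,$$ the supremum being over all cubes $Q\subset\mathbb R^n$. Then $T^\Phi:L^p(v)\to L^p(u)$; that is, there is a constant $C<\infty$, independent of $f$,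 such that $$\int_{\mathbb R^n}|T^\Phi f(x)|^p\,u(x)\,dx\le C\int_{\mathbb R^n}|f(x)|^p\,v(x)\,dx$$ for all $f\in L^2(\mathbb R^n)$, and $T^\Phi$ extends from $L^2\cap L^p(v)$ to a map $S:L^p(v)\to L^p(u)$ with nonnegative values that satisfies the same inequality for all $f\in L^p(v)$, and $$\int_{\mathbb R^n}|Sf-Sg|^p\,u\le C\int_{\mathbb R^n}|f-g|^p\,v\qquad (f,g\in L^p(v)).$$ -/

import Mathlib

open MeasureTheory
open scoped NNReal ENNReal

noncomputable section

namespace MaxModCZ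

/-- Euclidean space `ℝⁿ`, with its Euclidean norm and Lebesgue measure. -/
abbrev Eu (n : ℕ) : Type := EuclideanSpace ℝ (Fin n)

/-! ### Young functions, Luxemburg norms, the `B_q` condition -/

/-- `A : [0,∞) → [0,∞)` is a Young function. -/
structure IsYoung (A : ℝ≥0 → ℝ≥0) : Prop where
  continuous : Continuous A
  convex : ConvexOn ℝ≥0 Set.univ A
  monotone : Monotone A
  map_zero : A 0 = 0
  tendsto_atTop : Filter.Tendsto A Filter.atTop Filter.atTop

/-- The doubling condition `A(2t) ≤ C A(t)` for `t > 0`. -/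
def IsDoubling (A : ℝ≥0 → ℝ≥0) : Prop :=
  ∃ C : ℝ≥0, 0 < C ∧ ∀ t : ℝ≥0, 0 < t → A (2 * t) ≤ C * A t

/-- The complementary function `Ā(t) = sup_{s > 0} (s t - A(s))`, with values in `[0,∞]`.
For `A 0 = 0` and `A` continuous the supremum is nonnegative, so that cutting the
differences off at `0` does not change it. -/
def complementary (A : ℝ≥0 → ℝ≥0) (t : ℝ≥0) : ℝ≥0∞ :=
  ⨆ (s : ℝ≥0) (_ : 0 < s), ENNReal.ofReal ((s : ℝ) * (t : ℝ) - (A s : ℝ))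

/-- The condition `D ∈ B_q`: `∫_c^∞ D(t) / t^q dt/t < ∞` for some `c > 0`.
A monotone `D` that takes the value `∞` does not satisfy it. -/
def SatisfiesB (q : ℝ) (D : ℝ≥0 → ℝ≥0∞) : Prop :=
  ∃ c : ℝ, 0 < c ∧
    ∫⁻ t in Set.Ioi c, D t.toNNReal / ENNReal.ofReal (t ^ q) / ENNReal.ofReal t < ∞

/-- The cube `∏ᵢ [aᵢ, aᵢ + ℓ)`. -/
def cube {n : ℕ} (a : Eu n) (ℓ : ℝ) : Set (Eu n) :=
  {x | ∀ i, x i ∈ Set.Ico (a i) (a i + ℓ)}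

/-- The Luxemburg norm `‖f‖_{A,Q} = inf {l > 0 : |Q|⁻¹ ∫_Q A(|f|/l) ≤ 1}`
(equal to `∞` when no such `l` exists). -/
def luxemburg {n : ℕ} (A : ℝ≥0 → ℝ≥0) (Q : Set (Eu n)) (f : Eu n → ℝ) : ℝ≥0∞ :=
  ⨅ (l : ℝ≥0) (_ : 0 < l)
    (_ : (volume Q)⁻¹ * ∫⁻ y in Q, (A (‖f y‖₊ / l) : ℝ≥0∞) ≤ 1), (l : ℝ≥0∞)

/-- A positive weight: a locally integrable function that is positive (almost everywhere). -/
structure IsPosWeight {n : ℕ} (w : Eu n → ℝ) : Prop where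
  locallyIntegrable : LocallyIntegrable w volume
  pos : ∀ᵐ x, 0 < w x

/-- The two-weight bump quantity
`[u,v]_{A,B} = sup_Q ‖u^{1/p}‖_{A,Q} ‖v^{-r/p}‖_{B,Q}^{1/r}`, over all cubes `Q`. -/
def bump {n : ℕ} (p r : ℝ) (A B : ℝ≥0 → ℝ≥0) (u v : Eu n → ℝ) : ℝ≥0∞ :=
  ⨆ (a : Eu n) (ℓ : ℝ) (_ : 0 < ℓ),
    luxemburg A (cube a ℓ) (fun x => u x ^ (1 / p)) *
      luxemburg B (cube a ℓ) (fun x => v x ^ (-r / p)) ^ (1 / r)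

/-! ### Calderón–Zygmund operators and their maximal modulations -/

/-- The size and regularity conditions on a Calderón–Zygmund kernel. -/
def IsCZKernel {n : ℕ} (K : Eu n → Eu n → ℂ) : Prop :=
  ∃ C δ : ℝ, 0 < δ ∧ δ ≤ 1 ∧
    (∀ x y, x ≠ y → ‖K x y‖ ≤ C / ‖x - y‖ ^ n) ∧
    (∀ x x' y, ‖x - x'‖ < ‖x - y‖ / 2 →
      ‖K x y - K x' y‖ + ‖K y x - K y x'‖ ≤
        C * ‖x - x'‖ ^ δ / ‖x - y‖ ^ ((n : ℝ) + δ))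

/-- `T` is a Calderón–Zygmund operator: linear and bounded on `L²(ℝⁿ)` and represented by a
Calderón–Zygmund kernel off the support of the function. The operator sends functions to
functions with a definite value at each point, and linearity and the representation hold
pointwise, so that suprema over uncountable families of modulations make sense.
What `T` does outside `L²` is irrelevant. -/
structure IsCZOperator {n : ℕ} (T : (Eu n → ℂ) → Eu n → ℂ) : Prop where
  map_add : ∀ f g, MemLp f 2 volume → MemLp g 2 volume → T (f + g) = T f + T g
  map_smul : ∀ (c : ℂ) (f), MemLp f 2 volume → T (c • f) = c • T f
  bounded : ∃ C : ℝ≥0, ∀ f, MemLp f 2 volume →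
    MemLp (T f) 2 volume ∧ eLpNorm (T f) 2 volume ≤ C * eLpNorm f 2 volume
  kernel : ∃ K : Eu n → Eu n → ℂ, IsCZKernel K ∧
    ∀ f, MemLp f 2 volume → ∀ x, x ∉ tsupport f → T f x = ∫ y, K x y * f y

/-- The modulation `(M^φ f)(x) = e^{2πi φ(x)} f(x)`. -/
def modulate {n : ℕ} (φ : Eu n → ℝ) (f : Eu n → ℂ) : Eu n → ℂ :=
  fun x => Complex.exp (2 * Real.pi * Complex.I * (φ x : ℂ)) * f x

/-- The maximally modulated operator `T^Φ f(x) = sup_α |T(M^{φ_α} f)(x)|`. -/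
def maxMod {n : ℕ} {ι : Type*} (T : (Eu n → ℂ) → Eu n → ℂ) (φ : ι → Eu n → ℝ)
    (f : Eu n → ℂ) (x : Eu n) : ℝ≥0∞ :=
  ⨆ α, ‖T (modulate (φ α) f) x‖ₑ

/-- The quasinorm `‖g‖_{L^{r,∞}} = sup_{t > 0} t |{g > t}|^{1/r}` of `g ≥ 0`. -/
def weakNorm {n : ℕ} (r : ℝ) (g : Eu n → ℝ≥0∞) : ℝ≥0∞ :=
  ⨆ t : ℝ≥0, (t : ℝ≥0∞) * volume {x | (t : ℝ≥0∞) < g x} ^ (1 / r)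

/-- The a priori weak-type inequalities `‖T^Φ f‖_{L^{r,∞}} ≤ ψ(r) ‖f‖_r` for `1 < r ≤ r₀`,
for `f` in `L² ∩ L^r` (where `T^Φ f` is defined). -/
def WeakTypeBounds {n : ℕ} {ι : Type*} (T : (Eu n → ℂ) → Eu n → ℂ) (φ : ι → Eu n → ℝ)
    (r₀ : ℝ) (ψ : ℝ → ℝ≥0) : Prop :=
  ∀ r : ℝ, 1 < r → r ≤ r₀ → ∀ f : Eu n → ℂ,
    MemLp f 2 volume → MemLp f (ENNReal.ofReal r) volume →
      AEMeasurable (maxMod T φ f) volume ∧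
        weakNorm r (maxMod T φ f) ≤ ψ r * eLpNorm f (ENNReal.ofReal r) volume

/-- `f ∈ L^p(v)`. -/
def MemWeightedLp {n : ℕ} (p : ℝ) (v : Eu n → ℝ) (f : Eu n → ℂ) : Prop :=
  AEStronglyMeasurable f volume ∧ ∫⁻ x, ‖f x‖ₑ ^ p * ENNReal.ofReal (v x) < ∞

end MaxModCZ

end

noncomputable section

namespace MaxModCZ

/-! ### Dyadic cubes -/

section Grid

variable {n : ℕ}

/-! The proof bounds `T^Φ` by sparse sums. Fix a cube with its dyadic grid and let ⟨f⟩_Q be the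
`L^r` average of `f` over the triple 3Q. The core is `exists_sparse_step`: on Q, `T^Φ(f 1_{3Q})` is
at most C⟨f⟩_Q outside disjoint subcubes P of total measure at most |Q|/2, and on each such P it is
at most `T^Φ(f 1_{3P})` + C⟨f⟩_Q + C⟨f⟩_P. The weak-type inequality makes the set where `T^Φ(f
1_{3Q})` is large small, a covering argument does the same for the subcubes with a large average,
and the P are stopping cubes of an open set containing both. On P, the value of `T^Φ(f 1_{3Q∖3P})`
at x is compared with its value at a good point x' of P. Modulation does not change |f|, so the
difference is controlled by one integral of the kernel oscillation, uniformly in α. That integral is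
a geometric series of averages over ancestors of P, none of which lies inside the bad set
(`IsCZKernel.exists_lintegral_osc_le`). Under iteration the uncontrolled set halves in measure at
each generation, so `T^Φ(f 1_{3Q})` is almost everywhere at most a multiple of Σ ⟨f⟩_P 1_P
(`ae_le_iSup_sparseSum`).

By duality the sparse sum is tested against u^{1/p} g with g in `L^{p'}`. Hölder's inequality in
Luxemburg norms is applied to u^{1/p} · g with the pair (A, Ā) and to |f|^r = v^{-r/p} · (|f|
v^{1/p})^r with the pair (B, B̄). The bump condition absorbs the norms of the weights. The part of
each cube not covered by its children has at least half its measure, and these parts are disjoint,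
so the sum is dominated by the integral of M_{B̄}((|f| v^{1/p})^r)^{1/r} · M_Ā g
(`lintegral_sparseSum_mul_le`). Pérez's theorem, `lintegral_orliczMax_rpow_le`, bounds the two
Orlicz maximal functions on `L^{p/r}` and `L^{p'}`; this is where the `B_q` conditions enter.

Since the constants do not depend on the cube, an exhaustion of the space and Fatou's lemma give the
inequality on `L²`. Sublinearity, |T^Φ f − T^Φ g| ≤ T^Φ(f − g), makes `T^Φ` Lipschitz on a dense
subspace of `L^p(v)`, so it extends by completeness. -/

lemma measurableSet_cube (a : Eu n) (ℓ : ℝ) : MeasurableSet (cube a ℓ) := by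
  have : cube a ℓ = ⋂ i, (fun x : Eu n => x i) ⁻¹' Set.Ico (a i) (a i + ℓ) := by
    ext x; simp [cube]
  rw [this]
  exact MeasurableSet.iInter fun i => measurableSet_Ico.preimage (by fun_prop)

lemma volume_cube (a : Eu n) (ℓ : ℝ) : volume (cube a ℓ) = ENNReal.ofReal ℓ ^ n := by
  have h : cube a ℓ = (MeasurableEquiv.toLp 2 (Fin n → ℝ)).symm ⁻¹'
      (Set.univ.pi fun i => Set.Ico (a i) (a i + ℓ)) := by
    ext x; simp [cube]
  rw [h, (EuclideanSpace.volume_preserving_symm_measurableEquiv_toLp (Fin n)).measure_preimage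
    (MeasurableSet.univ_pi fun i => measurableSet_Ico).nullMeasurableSet, Real.volume_pi_Ico]
  simp

lemma volume_cube_pos (a : Eu n) {ℓ : ℝ} (hℓ : 0 < ℓ) : 0 < volume (cube a ℓ) := by
  rw [volume_cube]; exact ENNReal.pow_pos (ENNReal.ofReal_pos.2 hℓ) n

lemma volume_cube_ne_zero (a : Eu n) {ℓ : ℝ} (hℓ : 0 < ℓ) : volume (cube a ℓ) ≠ 0 :=
  (volume_cube_pos a hℓ).ne'

lemma volume_cube_ne_top (a : Eu n) (ℓ : ℝ) : volume (cube a ℓ) ≠ ∞ := by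
  rw [volume_cube]; exact ENNReal.pow_ne_top ENNReal.ofReal_ne_top

/-- Indices of dyadic cubes: the generation and the integer position. -/
abbrev Idx (n : ℕ) : Type := ℕ × (Fin n → ℤ)

/-- Side length of the dyadic cubes of index `Q`. -/
def dside (ℓ : ℝ) (Q : Idx n) : ℝ := ℓ / 2 ^ Q.1

/-- Lower corner of a dyadic cube. -/
def dcorner (a : Eu n) (ℓ : ℝ) (Q : Idx n) : Eu n :=
  WithLp.toLp 2 fun i => a i + Q.2 i * dside ℓ Q

/-- The dyadic cube of index `Q` in the grid generated by `cube a ℓ`. -/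
def dcube (a : Eu n) (ℓ : ℝ) (Q : Idx n) : Set (Eu n) := cube (dcorner a ℓ Q) (dside ℓ Q)

/-- The concentric cube with three times the side. -/
def tripleCube (a : Eu n) (ℓ : ℝ) : Set (Eu n) := cube (WithLp.toLp 2 fun i => a i - ℓ) (3 * ℓ)

/-- The triple of a dyadic cube. -/
def dtriple (a : Eu n) (ℓ : ℝ) (Q : Idx n) : Set (Eu n) :=
  tripleCube (dcorner a ℓ Q) (dside ℓ Q)

/-- The position of the cube of generation `k` that contains `x`. -/
def dpos (a : Eu n) (ℓ : ℝ) (k : ℕ) (x : Eu n) : Fin n → ℤ := fun i => ⌊(x i - a i) / (ℓ / 2 ^ k)⌋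

variable {a : Eu n} {ℓ : ℝ}

lemma dside_pos (hℓ : 0 < ℓ) (Q : Idx n) : 0 < dside ℓ Q := by unfold dside; positivity

lemma dside_le (hℓ : 0 < ℓ) (Q : Idx n) : dside ℓ Q ≤ ℓ :=
  div_le_self hℓ.le (one_le_pow₀ (by norm_num))

lemma mem_tripleCube {x : Eu n} :
    x ∈ tripleCube a ℓ ↔ ∀ i, a i - ℓ ≤ x i ∧ x i < a i + 2 * ℓ := by
  simp only [tripleCube, cube, Set.mem_ofPred_eq, Set.mem_Ico]
  refine forall_congr' fun i => ?_
  constructor <;> rintro ⟨h1, h2⟩ <;> constructor <;> linarith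

lemma cube_subset_tripleCube (hℓ : 0 < ℓ) : cube a ℓ ⊆ tripleCube a ℓ := by
  intro x hx
  rw [mem_tripleCube]
  intro i
  have := hx i
  constructor <;> linarith [this.1, this.2]

lemma mem_dcube (hℓ : 0 < ℓ) {Q : Idx n} {x : Eu n} :
    x ∈ dcube a ℓ Q ↔ dpos a ℓ Q.1 x = Q.2 := by
  have hs : 0 < ℓ / 2 ^ Q.1 := by positivity
  simp only [dcube, cube, Set.mem_ofPred_eq, Set.mem_Ico, funext_iff, dpos, Int.floor_eq_iff]
  refine forall_congr' fun i => ?_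
  rw [le_div_iff₀ hs, div_lt_iff₀ hs]
  simp only [dcorner, dside]
  constructor <;> rintro ⟨h1, h2⟩ <;> constructor <;> linarith

lemma self_mem_dcube (hℓ : 0 < ℓ) (k : ℕ) (x : Eu n) : x ∈ dcube a ℓ (k, dpos a ℓ k x) :=
  (mem_dcube hℓ).2 rfl

lemma measurableSet_dcube (a : Eu n) (ℓ : ℝ) (Q : Idx n) : MeasurableSet (dcube a ℓ Q) :=
  measurableSet_cube _ _

lemma measurableSet_dtriple (a : Eu n) (ℓ : ℝ) (Q : Idx n) : MeasurableSet (dtriple a ℓ Q) :=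
  measurableSet_cube _ _

lemma volume_dcube_ne_zero (hℓ : 0 < ℓ) (Q : Idx n) : volume (dcube a ℓ Q) ≠ 0 :=
  volume_cube_ne_zero _ (dside_pos hℓ Q)

lemma volume_dcube_ne_top (Q : Idx n) : volume (dcube a ℓ Q) ≠ ∞ := volume_cube_ne_top _ _

lemma volume_dtriple_ne_zero (hℓ : 0 < ℓ) (Q : Idx n) : volume (dtriple a ℓ Q) ≠ 0 :=
  volume_cube_ne_zero _ (by have := dside_pos hℓ Q; positivity)

lemma volume_dtriple_ne_top (Q : Idx n) : volume (dtriple a ℓ Q) ≠ ∞ := volume_cube_ne_top _ _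

lemma volume_dtriple (Q : Idx n) : volume (dtriple a ℓ Q) = 3 ^ n * volume (dcube a ℓ Q) := by
  rw [dtriple, tripleCube, dcube, volume_cube, volume_cube, ENNReal.ofReal_mul (by norm_num),
    mul_pow]
  norm_num

lemma dcube_subset_dtriple (hℓ : 0 < ℓ) (Q : Idx n) : dcube a ℓ Q ⊆ dtriple a ℓ Q :=
  cube_subset_tripleCube (dside_pos hℓ Q)

/-- The nesting of the grid: ⌊s⌋ · 2^d is an integer below s · 2^d, hence below ⌊s · 2^d⌋, so a fine
floor determines every coarser one. -/
lemma dpos_eq_of_le (hℓ : 0 < ℓ) {j k : ℕ} (hjk : j ≤ k) {x y : Eu n}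
    (h : dpos a ℓ k x = dpos a ℓ k y) : dpos a ℓ j x = dpos a ℓ j y := by
  obtain ⟨d, rfl⟩ := Nat.exists_eq_add_of_le hjk
  ext i
  have h' := congrFun h i
  simp only [dpos] at h' ⊢
  have key : ∀ t : ℝ, t / (ℓ / 2 ^ (j + d)) = t / (ℓ / 2 ^ j) * 2 ^ d := by
    intro t; rw [pow_add]; field_simp
  rw [key, key] at h'
  have aux : ∀ s t : ℝ, ⌊s * 2 ^ d⌋ = ⌊t * 2 ^ d⌋ → ⌊s⌋ ≤ ⌊t⌋ := by
    intro s t hst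
    rw [Int.le_floor]
    have h1 : ((⌊s⌋ * 2 ^ d : ℤ) : ℝ) ≤ s * 2 ^ d := by
      push_cast
      exact mul_le_mul_of_nonneg_right (Int.floor_le s) (by positivity)
    have h2 := Int.le_floor.2 h1
    rw [hst, Int.le_floor] at h2
    push_cast at h2
    exact le_of_mul_le_mul_right h2 (by positivity)
  exact le_antisymm (aux _ _ h') (aux _ _ h'.symm)

lemma dcube_subset_of_mem (hℓ : 0 < ℓ) {Q R : Idx n} (hQR : Q.1 ≤ R.1) {x : Eu n}
    (hQ : x ∈ dcube a ℓ Q) (hR : x ∈ dcube a ℓ R) : dcube a ℓ R ⊆ dcube a ℓ Q := by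
  intro y hy
  rw [mem_dcube hℓ] at *
  rw [← hQ]
  exact dpos_eq_of_le hℓ hQR (hy.trans hR.symm)

lemma eq_of_mem_dcube (hℓ : 0 < ℓ) {Q R : Idx n} (hQR : Q.1 = R.1) {x : Eu n}
    (hQ : x ∈ dcube a ℓ Q) (hR : x ∈ dcube a ℓ R) : Q = R := by
  rw [mem_dcube hℓ] at *
  exact Prod.ext hQR (by rw [← hQ, ← hR, hQR])

lemma dcorner_mem (hℓ : 0 < ℓ) (Q : Idx n) : dcorner a ℓ Q ∈ dcube a ℓ Q := by
  have := dside_pos hℓ Q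
  intro i
  constructor <;> linarith

/-- Tested on the diagonal through the lower corner. The upper face is not attained, so its
inequality comes from all smaller values. -/
lemma le_of_cube_subset {a b : Eu n} {ℓ m : ℝ} (hℓ : 0 < ℓ) (h : cube a ℓ ⊆ cube b m) (i : Fin n) :
    b i ≤ a i ∧ a i + ℓ ≤ b i + m := by
  have key : ∀ t, 0 ≤ t → t < ℓ → b i ≤ a i + t ∧ a i + t < b i + m := by
    intro t h0 ht
    have : (WithLp.toLp 2 fun i => a i + t : Eu n) ∈ cube b m := h fun i => by
      constructor <;> simp <;> linarith
    simpa using this i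
  refine ⟨by simpa using (key 0 le_rfl hℓ).1, le_of_forall_lt fun c hc => ?_⟩
  by_cases h0 : 0 ≤ c - a i
  · have := (key (c - a i) h0 (by linarith)).2; linarith
  · have := (key 0 le_rfl hℓ).2; linarith

lemma dside_le_of_le (hℓ : 0 < ℓ) {Q R : Idx n} (h : Q.1 ≤ R.1) : dside ℓ R ≤ dside ℓ Q :=
  div_le_div_of_nonneg_left hℓ.le (by positivity) (pow_le_pow_right₀ (by norm_num) h)

lemma dtriple_subset (hℓ : 0 < ℓ) {Q R : Idx n} (hQR : Q.1 ≤ R.1)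
    (h : dcube a ℓ R ⊆ dcube a ℓ Q) : dtriple a ℓ R ⊆ dtriple a ℓ Q := by
  intro x hx
  rw [dtriple, mem_tripleCube] at *
  intro i
  have h1 := le_of_cube_subset (dside_pos hℓ R) h i
  have h2 := dside_le_of_le hℓ hQR
  have h3 := hx i
  constructor <;> linarith [h1.1, h1.2, h3.1, h3.2]

/-- A cube one generation further down has measure smaller by `2ⁿ`. -/
lemma volume_dcube_pred {Q R : Idx n} (h : R.1 = Q.1 + 1) :
    volume (dcube a ℓ Q) = 2 ^ n * volume (dcube a ℓ R) := by
  have : dside ℓ Q = 2 * dside ℓ R := by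
    simp only [dside, h, pow_succ]; field_simp
  rw [dcube, dcube, volume_cube, volume_cube, this, ENNReal.ofReal_mul (by norm_num), mul_pow]
  norm_num

/-- A weak-type covering inequality for the triples of dyadic cubes. -/
lemma mul_volume_biUnion_dcube_le (hℓ : 0 < ℓ) (t : Set (Idx n)) (h : Eu n → ℝ≥0∞) (lam : ℝ≥0∞)
    (ht : ∀ Q ∈ t, lam * volume (dtriple a ℓ Q) ≤ ∫⁻ y in dtriple a ℓ Q, h y) :
    lam * volume (⋃ Q ∈ t, dcube a ℓ Q) ≤ 5 ^ n * ∫⁻ y, h y := by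
  obtain ⟨s, hst, hdisj, hs⟩ := Vitali.exists_disjoint_subfamily_covering_enlargement
    (dtriple a ℓ) t (dside ℓ) 2 (by norm_num) (fun Q _ => (dside_pos hℓ Q).le) ℓ
    (fun Q _ => dside_le hℓ Q)
    (fun Q _ => ⟨_, dcube_subset_dtriple hℓ Q (dcorner_mem hℓ Q)⟩)
  -- If 3Q meets 3R and the side of Q is at most twice that of R, then 3Q reaches at most 6 sides of
  -- R beyond 3R. With 3R spanning −1 to 2, this gives −7 to 8, a side of 15 = 5 · 3 and the factor
  -- 5^n.
  set big : Idx n → Set (Eu n) := fun R =>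
    cube (WithLp.toLp 2 fun i => dcorner a ℓ R i - 7 * dside ℓ R) (15 * dside ℓ R) with hbig
  have hvol : ∀ R, volume (big R) = 5 ^ n * volume (dtriple a ℓ R) := by
    intro R
    rw [hbig, volume_cube, dtriple, tripleCube, volume_cube,
      show 15 * dside ℓ R = 5 * (3 * dside ℓ R) by ring,
      ENNReal.ofReal_mul (by norm_num), mul_pow]
    norm_num
  have hsub : (⋃ Q ∈ t, dcube a ℓ Q) ⊆ ⋃ R ∈ s, big R := by
    refine Set.iUnion₂_subset fun Q hQ => ?_
    obtain ⟨R, hR, ⟨z, hzQ, hzR⟩, hle⟩ := hs Q hQ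
    refine Set.Subset.trans (fun x hx => ?_) (Set.subset_biUnion_of_mem (u := big) hR)
    intro i
    have h1 := (mem_tripleCube.1 hzQ) i
    have h2 := (mem_tripleCube.1 hzR) i
    have h3 := (mem_tripleCube.1 (dcube_subset_dtriple hℓ Q hx)) i
    constructor
    · simp only; linarith [h1.1, h1.2, h2.1, h2.2, h3.1, h3.2]
    · simp only; linarith [h1.1, h1.2, h2.1, h2.2, h3.1, h3.2]
  calc lam * volume (⋃ Q ∈ t, dcube a ℓ Q)
      ≤ lam * ∑' R : s, volume (big R) := by
        gcongr
        exact (measure_mono hsub).trans (measure_biUnion_le _ s.to_countable _)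
    _ = 5 ^ n * ∑' R : s, lam * volume (dtriple a ℓ R) := by
        simp_rw [hvol, ENNReal.tsum_mul_left]; ring
    _ ≤ 5 ^ n * ∑' R : s, ∫⁻ y in dtriple a ℓ R, h y := by
        gcongr with R
        exact ht R (hst R.2)
    _ = 5 ^ n * ∫⁻ y in ⋃ R ∈ s, dtriple a ℓ R, h y := by
        rw [lintegral_biUnion s.to_countable (fun R _ => measurableSet_dtriple a ℓ R) hdisj]
    _ ≤ 5 ^ n * ∫⁻ y, h y := by
        gcongr
        exact Measure.restrict_le_self

end Grid

/-! ### Powers of monotone limits and duality -/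

lemma lintegral_rpow_eq_iSup {α : Type*} [MeasurableSpace α] {μ : Measure α} {X : α → ℝ≥0∞}
    {Y : ℕ → α → ℝ≥0∞} (hY : ∀ N, Measurable (Y N)) (hmono : Monotone Y)
    (hX : ∀ x, X x = ⨆ N, Y N x) {q : ℝ} (hq : 0 < q) :
    ∫⁻ x, X x ^ q ∂μ = ⨆ N, ∫⁻ x, Y N x ^ q ∂μ := by
  rw [← lintegral_iSup (fun N => (hY N).pow_const q)
    (fun N M h x => ENNReal.rpow_le_rpow (hmono h x) hq.le)]
  refine lintegral_congr fun x => ?_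
  rw [hX]
  exact (ENNReal.monotone_rpow_of_nonneg hq.le).map_iSup_of_continuousAt
    ENNReal.continuous_rpow_const.continuousAt (by simp [hq])

lemma iSup_min_natCast (y : ℝ≥0∞) : ⨆ N : ℕ, min y N = y := by
  have := inf_iSup_eq y (fun N : ℕ => (N : ℝ≥0∞))
  rw [ENNReal.iSup_natCast] at this
  simpa using this.symm

/-- Division by `I ^ (1 / p')`, legitimate only because `I` is finite. -/
lemma le_rpow_of_le_mul_rpow {I K : ℝ≥0∞} {p p' : ℝ} (hpp : p.HolderConjugate p') (hI : I ≠ ∞)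
    (h : I ≤ K * I ^ (1 / p')) : I ≤ K ^ p := by
  rcases eq_or_ne I 0 with h0 | h0
  · simp [h0]
  have hne0 : I ^ (1 / p') ≠ 0 := by simp [h0, hI]
  have hnet : I ^ (1 / p') ≠ ∞ := by simp [h0, hI]
  have h1 : I ^ (1 / p) * I ^ (1 / p') = I := by
    rw [← ENNReal.rpow_add _ _ h0 hI, one_div, one_div, hpp.inv_add_inv_eq_one, ENNReal.rpow_one]
  have h2 : I ^ (1 / p) ≤ K := by
    refine (ENNReal.mul_le_mul_iff_left hne0 hnet).1 ?_
    rwa [h1]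
  calc I = (I ^ (1 / p)) ^ p := by
        rw [← ENNReal.rpow_mul, one_div_mul_cancel hpp.ne_zero, ENNReal.rpow_one]
    _ ≤ K ^ p := ENNReal.rpow_le_rpow h2 hpp.nonneg

/-- The converse of Hölder's inequality. -/
lemma lintegral_rpow_le_of_forall_mul {α : Type*} [MeasurableSpace α] {μ : Measure α}
    [SigmaFinite μ] {X : α → ℝ≥0∞} (hX : Measurable X) {p p' : ℝ} (hpp : p.HolderConjugate p')
    {K : ℝ≥0∞}
    (h : ∀ g : α → ℝ≥0, Measurable g →
      ∫⁻ x, X x * g x ∂μ ≤ K * (∫⁻ x, (g x : ℝ≥0∞) ^ p' ∂μ) ^ (1 / p')) :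
    ∫⁻ x, X x ^ p ∂μ ≤ K ^ p := by
  -- Truncation in height and in support makes the integral of Y^p finite, so that it can be divided
  -- out.
  set Y : ℕ → α → ℝ≥0∞ := fun N => (spanningSets μ N).indicator (fun x => min (X x) N) with hY
  have hYm : ∀ N, Measurable (Y N) := fun N =>
    (hX.min measurable_const).indicator (measurableSet_spanningSets μ N)
  have hYX : ∀ N x, Y N x ≤ X x := fun N x =>
    (Set.indicator_le_self' (fun _ _ => zero_le) x).trans (min_le_left _ _)
  have hYN : ∀ N x, Y N x ≤ N := fun N x =>
    (Set.indicator_le_self' (fun _ _ => zero_le) x).trans (min_le_right _ _)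
  have hmono : Monotone Y := by
    intro N M hNM x
    refine (Set.indicator_le_indicator_of_subset (monotone_spanningSets μ hNM)
      (fun _ => zero_le) x).trans (Set.indicator_le_indicator ?_)
    exact min_le_min le_rfl (by exact_mod_cast hNM)
  have hsup : ∀ x, X x = ⨆ N, Y N x := by
    intro x
    refine le_antisymm ?_ (iSup_le fun N => hYX N x)
    conv_lhs => rw [← iSup_min_natCast (X x)]
    refine iSup_le fun N => ?_
    refine le_iSup_of_le (max N (spanningSetsIndex μ x)) ?_
    have hx : x ∈ spanningSets μ (max N (spanningSetsIndex μ x)) :=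
      monotone_spanningSets μ (le_max_right _ _) (mem_spanningSetsIndex μ x)
    simp only [hY, Set.indicator_of_mem hx]
    exact min_le_min le_rfl (by exact_mod_cast le_max_left _ _)
  rw [lintegral_rpow_eq_iSup hYm hmono hsup hpp.pos]
  refine iSup_le fun N => ?_
  have hfin : ∀ x, Y N x ≠ ∞ := fun x => ((hYN N x).trans_lt (ENNReal.natCast_lt_top N)).ne
  refine le_rpow_of_le_mul_rpow hpp ?_ ?_
  · refine ne_top_of_le_ne_top ?_ (lintegral_mono (g := (spanningSets μ N).indicator
      (fun _ => (N : ℝ≥0∞) ^ p)) fun x => ?_)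
    · rw [lintegral_indicator (measurableSet_spanningSets μ N), setLIntegral_const]
      exact ENNReal.mul_ne_top (ENNReal.rpow_ne_top_of_nonneg hpp.nonneg (by simp))
        (measure_spanningSets_lt_top μ N).ne
    · by_cases hx : x ∈ spanningSets μ N
      · simp only [hY, Set.indicator_of_mem hx]
        exact ENNReal.rpow_le_rpow (min_le_right _ _) hpp.nonneg
      · simp [hY, Set.indicator_of_notMem hx, hpp.pos]
  -- The extremal function of Hölder's inequality: g = Y^{p−1} satisfies g^{p'} = Y^p.
  · set g : α → ℝ≥0 := fun x => (Y N x ^ (p - 1)).toNNReal with hg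
    have hgc : ∀ x, (g x : ℝ≥0∞) = Y N x ^ (p - 1) := fun x =>
      ENNReal.coe_toNNReal (ENNReal.rpow_ne_top_of_nonneg hpp.sub_one_pos.le (hfin x))
    have hgm : Measurable g := ((hYm N).pow_const _).ennreal_toNNReal
    have h1 := h g hgm
    simp only [hgc, ← ENNReal.rpow_mul, hpp.sub_one_mul_conj] at h1
    refine le_trans (lintegral_mono fun x => ?_) h1
    calc Y N x ^ p = Y N x ^ (1 + (p - 1)) := by rw [add_sub_cancel]
      _ = Y N x * Y N x ^ (p - 1) := by
          rw [ENNReal.rpow_add_of_nonneg _ _ zero_le_one hpp.sub_one_pos.le, ENNReal.rpow_one]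
      _ ≤ _ := by gcongr; exact hYX N x

/-! ### Luxemburg norms and complementary functions -/

section Orlicz

variable {n : ℕ}

/-- The Luxemburg norm of a nonnegative function, for a gauge with values in `[0,∞]`. -/
def luxE (D : ℝ≥0 → ℝ≥0∞) (Q : Set (Eu n)) (g : Eu n → ℝ≥0) : ℝ≥0∞ :=
  ⨅ (l : ℝ≥0) (_ : 0 < l) (_ : (volume Q)⁻¹ * ∫⁻ y in Q, D (g y / l) ≤ 1), (l : ℝ≥0∞)

lemma luxE_congr {D : ℝ≥0 → ℝ≥0∞} {Q : Set (Eu n)} {g h : Eu n → ℝ≥0} (H : g =ᵐ[volume] h) :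
    luxE D Q g = luxE D Q h := by
  have : ∀ l : ℝ≥0, ∫⁻ y in Q, D (g y / l) = ∫⁻ y in Q, D (h y / l) := fun l =>
    lintegral_congr_ae ((ae_restrict_of_ae H).mono fun y hy => by simp only [hy])
  simp only [luxE, this]

/-- Young's inequality. The case `s = 0` is separate because the supremum runs over positive `s`. -/
lemma coe_mul_le_add_complementary (A : ℝ≥0 → ℝ≥0) (s t : ℝ≥0) :
    (s * t : ℝ≥0∞) ≤ A s + complementary A t := by
  rcases eq_zero_or_pos s with rfl | hs
  · simp
  refine le_trans ?_ (add_le_add_right (le_iSup₂_of_le (f := fun (s : ℝ≥0) (_ : 0 < s) =>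
    ENNReal.ofReal ((s : ℝ) * (t : ℝ) - (A s : ℝ))) s hs le_rfl) _)
  have h := ENNReal.ofReal_add_le (p := (A s : ℝ)) (q := (s : ℝ) * t - A s)
  rw [add_sub_cancel, ENNReal.ofReal_coe_nnreal, ← NNReal.coe_mul, ENNReal.ofReal_coe_nnreal] at h
  exact_mod_cast h

lemma complementary_mono (A : ℝ≥0 → ℝ≥0) : Monotone (complementary A) := by
  intro t t' h
  refine iSup₂_mono fun s _ => ENNReal.ofReal_le_ofReal ?_
  have : (t : ℝ) ≤ t' := h
  gcongr

/-- Since A(s) ≥ 0 and ε ≤ 1, ε s t − A(s) ≤ ε (s t − A(s)). This is the only trace of convexity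
that the maximal theorem needs. -/
lemma complementary_mul_le (A : ℝ≥0 → ℝ≥0) {ε : ℝ≥0} (hε : ε ≤ 1) (t : ℝ≥0) :
    complementary A (ε * t) ≤ ε * complementary A t := by
  refine iSup₂_le fun s hs => ?_
  refine le_trans ?_ (mul_le_mul_right (le_iSup₂_of_le (f := fun (s : ℝ≥0) (_ : 0 < s) =>
    ENNReal.ofReal ((s : ℝ) * (t : ℝ) - (A s : ℝ))) s hs le_rfl) _)
  rw [← ENNReal.ofReal_coe_nnreal (p := ε), ← ENNReal.ofReal_mul (NNReal.coe_nonneg ε)]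
  refine ENNReal.ofReal_le_ofReal ?_
  have h1 : (ε : ℝ) ≤ 1 := hε
  have h2 : (0 : ℝ) ≤ A s := (A s).2
  push_cast
  nlinarith

/-- Young's inequality for h/l and g/m; each of the two averages contributes at most 1, whence the
factor 2. -/
lemma lintegral_mul_le_of_admissible {A : ℝ≥0 → ℝ≥0} (hA : Measurable A) {Q : Set (Eu n)}
    (hQ0 : volume Q ≠ 0) (hQt : volume Q ≠ ∞) {g h : Eu n → ℝ≥0} (hh : AEMeasurable h)
    {l m : ℝ≥0} (hl : 0 < l) (hm : 0 < m)
    (hAl : (volume Q)⁻¹ * ∫⁻ y in Q, (A (h y / l) : ℝ≥0∞) ≤ 1)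
    (hDm : (volume Q)⁻¹ * ∫⁻ y in Q, complementary A (g y / m) ≤ 1) :
    ∫⁻ y in Q, (h y : ℝ≥0∞) * g y ≤ 2 * volume Q * l * m := by
  rw [ENNReal.inv_mul_le_iff hQ0 hQt, mul_one] at hAl hDm
  calc ∫⁻ y in Q, (h y : ℝ≥0∞) * g y
      ≤ ∫⁻ y in Q, ((l * m : ℝ≥0) : ℝ≥0∞) * (A (h y / l) + complementary A (g y / m)) := by
        refine lintegral_mono fun y => ?_
        refine le_trans (le_of_eq ?_) (mul_le_mul_right
          (coe_mul_le_add_complementary A (h y / l) (g y / m)) _)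
        norm_cast
        field_simp
    _ = (l * m : ℝ≥0) * ((∫⁻ y in Q, (A (h y / l) : ℝ≥0∞)) +
          ∫⁻ y in Q, complementary A (g y / m)) := by
        rw [lintegral_const_mul' _ _ ENNReal.coe_ne_top, lintegral_add_left']
        exact (hA.comp_aemeasurable (hh.restrict.div_const l)).coe_nnreal_ennreal
    _ ≤ (l * m : ℝ≥0) * (volume Q + volume Q) := by gcongr
    _ = 2 * volume Q * l * m := by push_cast; ring

/-- Hölder's inequality for Luxemburg norms. -/
lemma lintegral_mul_le_luxE {A : ℝ≥0 → ℝ≥0} (hA : Measurable A) {Q : Set (Eu n)}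
    (hQ0 : volume Q ≠ 0) (hQt : volume Q ≠ ∞) {g h : Eu n → ℝ≥0} (hh : AEMeasurable h)
    (h0 : luxE (fun t => A t) Q h ≠ 0) (ht : luxE (fun t => A t) Q h ≠ ∞) :
    ∫⁻ y in Q, (h y : ℝ≥0∞) * g y ≤
      2 * volume Q * luxE (fun t => A t) Q h * luxE (complementary A) Q g := by
  set N := luxE (complementary A) Q g with hN
  have step : ∀ l : ℝ≥0, 0 < l → (volume Q)⁻¹ * ∫⁻ y in Q, (A (h y / l) : ℝ≥0∞) ≤ 1 →
      ∫⁻ y in Q, (h y : ℝ≥0∞) * g y ≤ 2 * volume Q * l * N := by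
    intro l hl hAl
    have hc0 : 2 * volume Q * (l : ℝ≥0∞) ≠ 0 := by simp [hQ0, hl.ne']
    have hct : 2 * volume Q * (l : ℝ≥0∞) ≠ ∞ := by finiteness
    rw [hN, luxE, ENNReal.mul_iInf_of_ne hc0 hct]
    refine le_iInf fun m => ?_
    rw [ENNReal.mul_iInf_of_ne hc0 hct]
    refine le_iInf fun hm => ?_
    rw [ENNReal.mul_iInf_of_ne hc0 hct]
    exact le_iInf fun hDm => lintegral_mul_le_of_admissible hA hQ0 hQt hh hl hm hAl hDm
  -- An infimum passes through multiplication only by a nonzero finite constant, so N = ∞ and N = 0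
  -- are treated apart. The first makes the right side infinite, and in the second a single
  -- admissible `l` suffices.
  rcases eq_or_ne N ∞ with hNt | hNt
  · rw [hNt, ENNReal.mul_top (by simp [hQ0, h0])]; exact le_top
  have hc : 2 * volume Q * N ≠ ∞ := by finiteness
  rcases eq_or_ne N 0 with hN0 | hN0
  · have : ∃ l : ℝ≥0, 0 < l ∧ (volume Q)⁻¹ * ∫⁻ y in Q, (A (h y / l) : ℝ≥0∞) ≤ 1 := by
      by_contra! hcon
      refine ht ?_
      simp only [luxE, iInf_eq_top]
      intro l hl hl'
      exact absurd hl' (not_le.2 (hcon l hl))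
    obtain ⟨l, hl, hl'⟩ := this
    simpa [hN0] using step l hl hl'
  rw [mul_right_comm]
  have hc0 : 2 * volume Q * N ≠ 0 := by simp [hQ0, hN0]
  rw [luxE, ENNReal.mul_iInf_of_ne hc0 hc]
  refine le_iInf fun l => ?_
  rw [ENNReal.mul_iInf_of_ne hc0 hc]
  refine le_iInf fun hl => ?_
  rw [ENNReal.mul_iInf_of_ne hc0 hc]
  refine le_iInf fun hAl => ?_
  rw [mul_right_comm]
  exact step l hl hAl

/-- A positive h exceeds some ε on a subset E of Q of positive measure. An admissible l then
satisfies A(ε/l) ≤ |Q|/|E|, and since A tends to infinity l cannot be arbitrarily small. -/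
lemma luxE_ne_zero {A : ℝ≥0 → ℝ≥0} (hA : Monotone A)
    (hAt : Filter.Tendsto A Filter.atTop Filter.atTop) {Q : Set (Eu n)}
    (hQ0 : volume Q ≠ 0) (hQt : volume Q ≠ ∞) {h : Eu n → ℝ≥0} (hh : AEMeasurable h)
    (hpos : ∀ᵐ y, 0 < h y) : luxE (fun t => A t) Q h ≠ 0 := by
  set μ := (volume : Measure (Eu n)).restrict Q with hμ
  obtain ⟨ε, hε, hE⟩ : ∃ ε : ℝ≥0, 0 < ε ∧ μ {y | ε < h y} ≠ 0 := by
    by_contra! hcon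
    have h1 : μ {y | 0 < h y} = 0 := by
      have : {y | 0 < h y} ⊆ ⋃ k : ℕ, {y | 1 / ((k : ℝ≥0) + 1) < h y} := by
        intro y hy
        obtain ⟨k, hk⟩ := exists_nat_one_div_lt (K := ℝ≥0) hy
        exact Set.mem_iUnion.2 ⟨k, hk⟩
      refine measure_mono_null this (measure_iUnion_null fun k => hcon _ (by positivity))
    have h2 : μ {y | 0 < h y}ᶜ = 0 := ae_restrict_of_ae hpos
    refine hQ0 ?_
    have h3 := measure_union_null h1 h2
    rwa [Set.union_compl_self, hμ, Measure.restrict_apply_univ] at h3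
  set M := (volume Q / μ {y | ε < h y}).toNNReal with hM
  have hMt : volume Q / μ {y | ε < h y} ≠ ∞ := ENNReal.div_ne_top hQt hE
  obtain ⟨t, ht⟩ := Filter.eventually_atTop.1 (hAt.eventually_gt_atTop M)
  intro hzero
  have hlt : luxE (fun t => A t) Q h < ((ε / (t + 1) : ℝ≥0) : ℝ≥0∞) := by
    rw [hzero]; exact_mod_cast (by positivity : 0 < ε / (t + 1))
  simp only [luxE, iInf_lt_iff] at hlt
  obtain ⟨l, hl, hAl, hlt⟩ := hlt
  have hlt' : l < ε / (t + 1) := by exact_mod_cast hlt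
  have h4 : t ≤ ε / l := by
    rw [lt_div_iff₀ (by positivity)] at hlt'
    rw [le_div_iff₀ hl]
    calc t * l ≤ l * (t + 1) := by rw [mul_comm]; gcongr; exact le_self_add
      _ ≤ ε := hlt'.le
  rw [ENNReal.inv_mul_le_iff hQ0 hQt, mul_one] at hAl
  have h5 : (A (ε / l) : ℝ≥0∞) * μ {y | ε < h y} ≤ volume Q := by
    refine le_trans ?_ hAl
    refine le_trans ?_ (mul_meas_ge_le_lintegral₀
      (hA.measurable.comp_aemeasurable (hh.restrict.div_const l)).coe_nnreal_ennreal (A (ε / l)))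
    gcongr
    intro hy
    have hy' : ε ≤ h y := le_of_lt hy
    change (A (ε / l) : ℝ≥0∞) ≤ A (h _ / l)
    exact_mod_cast hA (by gcongr)
  have h6 : (A (ε / l) : ℝ≥0∞) ≤ volume Q / μ {y | ε < h y} :=
    (ENNReal.le_div_iff_mul_le (Or.inl hE)
      (Or.inl ((measure_mono (Set.subset_univ _)).trans_lt
        (by rw [hμ, Measure.restrict_apply_univ]; exact hQt.lt_top)).ne)).2 h5
  rw [← ENNReal.coe_toNNReal hMt] at h6
  exact absurd (ht _ h4) (not_lt.2 (by exact_mod_cast h6))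

end Orlicz

/-! ### Orlicz maximal functions and Pérez's theorem. -/

section OrliczMaximal

variable {n : ℕ}

/-- The Orlicz maximal function along the triples of the cubes of a dyadic grid. -/
def orliczMax (D : ℝ≥0 → ℝ≥0∞) (a : Eu n) (ℓ : ℝ) (g : Eu n → ℝ≥0) (x : Eu n) : ℝ≥0∞ :=
  ⨆ Q : Idx n, (dcube a ℓ Q).indicator (fun _ => luxE D (dtriple a ℓ Q) g) x

lemma measurable_orliczMax (D : ℝ≥0 → ℝ≥0∞) (a : Eu n) (ℓ : ℝ) (g : Eu n → ℝ≥0) :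
    Measurable (orliczMax D a ℓ g) :=
  Measurable.iSup fun Q => measurable_const.indicator (measurableSet_dcube a ℓ Q)

lemma luxE_le_orliczMax (D : ℝ≥0 → ℝ≥0∞) {a : Eu n} {ℓ : ℝ} (g : Eu n → ℝ≥0) {Q : Idx n}
    {x : Eu n} (hx : x ∈ dcube a ℓ Q) : luxE D (dtriple a ℓ Q) g ≤ orliczMax D a ℓ g x :=
  le_iSup_of_le Q (by rw [Set.indicator_of_mem hx])

/-- The weak-type estimate behind the boundedness of the Orlicz maximal function. -/
lemma volume_lt_orliczMax_le {D : ℝ≥0 → ℝ≥0∞} (hD : Monotone D) {ε c : ℝ≥0} (hε : 0 < ε)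
    (hε1 : ε ≤ 1) (hεc : D (ε * c) ≤ 1 / 2) {a : Eu n} {ℓ : ℝ} (hℓ : 0 < ℓ) {g : Eu n → ℝ≥0}
    {lam : ℝ≥0} (hlam : 0 < lam) :
    volume {x | (lam : ℝ≥0∞) < orliczMax D a ℓ g x} ≤
      2 * 5 ^ n * ∫⁻ y, (Set.Ioi c).indicator D (g y / ε / lam) := by
  set h : Eu n → ℝ≥0∞ := fun y => (Set.Ioi c).indicator D (g y / ε / lam) with hh
  set t : Set (Idx n) := {Q | (lam : ℝ≥0∞) < luxE D (dtriple a ℓ Q) g} with ht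
  have hset : {x | (lam : ℝ≥0∞) < orliczMax D a ℓ g x} ⊆ ⋃ Q ∈ t, dcube a ℓ Q := by
    intro x hx
    obtain ⟨Q, hQ⟩ := lt_iSup_iff.1 (show (lam : ℝ≥0∞) < ⨆ Q : Idx n,
      (dcube a ℓ Q).indicator (fun _ => luxE D (dtriple a ℓ Q) g) x from hx)
    by_cases hxQ : x ∈ dcube a ℓ Q
    · rw [Set.indicator_of_mem hxQ] at hQ
      exact Set.mem_biUnion (x := Q) hQ hxQ
    · simp [Set.indicator_of_notMem hxQ] at hQ
  have hptw : ∀ y, D (g y / lam) ≤ 1 / 2 + h y := by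
    intro y
    by_cases hy : c < g y / ε / lam
    · rw [hh]
      simp only [Set.indicator_of_mem (show g y / ε / lam ∈ Set.Ioi c from hy)]
      refine le_add_left (hD ?_)
      gcongr
      exact le_div_self (zero_le) hε hε1
    · refine le_add_right (le_trans (hD ?_) hεc)
      rw [not_lt] at hy
      calc g y / lam = ε * (g y / ε / lam) := by field_simp
        _ ≤ ε * c := by gcongr
  have hQ : ∀ Q ∈ t, (1 / 2 : ℝ≥0∞) * volume (dtriple a ℓ Q) ≤ ∫⁻ y in dtriple a ℓ Q, h y := by
    intro Q hQt
    have hv0 := volume_dtriple_ne_zero (a := a) hℓ Q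
    have hvt := volume_dtriple_ne_top (a := a) (ℓ := ℓ) Q
    have h1 : volume (dtriple a ℓ Q) ≤ ∫⁻ y in dtriple a ℓ Q, D (g y / lam) := by
      by_contra! hcon
      refine absurd (show (lam : ℝ≥0∞) < _ from hQt) (not_lt.2 ?_)
      refine iInf_le_of_le lam (iInf₂_le_of_le hlam ?_ le_rfl)
      rw [ENNReal.inv_mul_le_iff hv0 hvt, mul_one]
      exact hcon.le
    have h2 : volume (dtriple a ℓ Q) ≤
        1 / 2 * volume (dtriple a ℓ Q) + ∫⁻ y in dtriple a ℓ Q, h y := by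
      calc volume (dtriple a ℓ Q) ≤ ∫⁻ y in dtriple a ℓ Q, (1 / 2 + h y) :=
            h1.trans (lintegral_mono fun y => hptw y)
        _ = _ := by rw [lintegral_add_left measurable_const, setLIntegral_const]
    have h3 : volume (dtriple a ℓ Q) =
        1 / 2 * volume (dtriple a ℓ Q) + 1 / 2 * volume (dtriple a ℓ Q) := by
      rw [← add_mul, ENNReal.add_halves, one_mul]
    conv_lhs at h2 => rw [h3]
    exact (ENNReal.add_le_add_iff_left (by finiteness)).1 h2
  have h4 := mul_volume_biUnion_dcube_le hℓ t h (1 / 2) hQ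
  calc volume {x | (lam : ℝ≥0∞) < orliczMax D a ℓ g x}
      ≤ 2 * (1 / 2 * volume (⋃ Q ∈ t, dcube a ℓ Q)) := by
        rw [← mul_assoc, one_div, ENNReal.mul_inv_cancel (by norm_num) (by norm_num), one_mul]
        exact measure_mono hset
    _ ≤ 2 * (5 ^ n * ∫⁻ y, h y) := by gcongr
    _ = _ := by rw [mul_assoc]

/-- The substitution t ↦ G/t turns the integral over levels in the layer-cake formula into the `B_q`
integral, and its homogeneity releases the factor G^q. -/
lemma lintegral_Ioi_comp_div_mul_rpow {Φ : ℝ≥0 → ℝ≥0∞} {q : ℝ} {G : ℝ≥0} (hG : 0 < G) :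
    ∫⁻ t in Set.Ioi (0 : ℝ), Φ (G / t.toNNReal) * ENNReal.ofReal (t ^ (q - 1)) =
      (G : ℝ≥0∞) ^ q * ∫⁻ t in Set.Ioi (0 : ℝ),
        Φ t.toNNReal / ENNReal.ofReal (t ^ q) / ENNReal.ofReal t := by
  have hG' : (0 : ℝ) < G := hG
  have himg : (fun t : ℝ => (G : ℝ) / t) '' Set.Ioi 0 = Set.Ioi 0 := by
    ext t
    constructor
    · rintro ⟨s, hs, rfl⟩; exact div_pos hG' hs
    · intro ht
      exact ⟨G / t, div_pos hG' ht, by have : t ≠ 0 := ne_of_gt ht; field_simp⟩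
  rw [← himg, lintegral_image_eq_lintegral_abs_deriv_mul measurableSet_Ioi
    (f' := fun t => -(G : ℝ) / t ^ 2), himg, ← lintegral_const_mul']
  · refine setLIntegral_congr_fun measurableSet_Ioi fun t (ht : 0 < t) => ?_
    have h1 : G / ((G : ℝ) / t).toNNReal = t.toNNReal := by
      rw [Real.toNNReal_div hG'.le, Real.toNNReal_coe, div_div_cancel₀ hG.ne']
    simp only [h1]
    rw [ENNReal.div_eq_inv_mul, ENNReal.div_eq_inv_mul, ← ENNReal.ofReal_inv_of_pos ht,
      ← ENNReal.ofReal_inv_of_pos (by positivity), ← ENNReal.ofReal_coe_nnreal (p := G),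
      ENNReal.ofReal_rpow_of_pos hG', mul_left_comm, ← ENNReal.ofReal_mul (by positivity),
      ← mul_assoc, ← mul_assoc, ← ENNReal.ofReal_mul (by positivity),
      ← ENNReal.ofReal_mul (by positivity), mul_comm]
    congr 2
    rw [abs_div, abs_neg, abs_of_pos hG', abs_of_pos (by positivity : (0 : ℝ) < t ^ 2),
      Real.div_rpow hG'.le ht.le, Real.rpow_sub_one hG'.ne', Real.rpow_sub_one ht.ne']
    field_simp
  · exact ENNReal.rpow_ne_top_of_ne_zero (by exact_mod_cast hG.ne') ENNReal.coe_ne_top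
  · intro t ht
    have : t ≠ 0 := ne_of_gt ht
    refine HasDerivAt.hasDerivWithinAt ?_
    have := (hasDerivAt_inv this).const_mul (G : ℝ)
    simpa [div_eq_mul_inv] using this
  · intro s hs t ht hst
    have hs' : s ≠ 0 := ne_of_gt hs
    have ht' : t ≠ 0 := ne_of_gt ht
    simp only at hst
    field_simp at hst
    exact hst.symm

/-- Pérez's theorem: the Orlicz maximal function of a gauge in `B_q` is bounded on `L^q`. -/
theorem lintegral_orliczMax_rpow_le (n : ℕ) {D : ℝ≥0 → ℝ≥0∞} (hD : Monotone D)
    (hconv : ∀ ε : ℝ≥0, ε ≤ 1 → ∀ t, D (ε * t) ≤ ε * D t) {q : ℝ} (hq : 0 < q)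
    (hB : SatisfiesB q D) :
    ∃ C : ℝ≥0, ∀ (a : Eu n) (ℓ : ℝ), 0 < ℓ → ∀ g : Eu n → ℝ≥0, Measurable g →
      ∫⁻ x, orliczMax D a ℓ g x ^ q ≤ C * ∫⁻ x, (g x : ℝ≥0∞) ^ q := by
  obtain ⟨c, hc, hI⟩ := hB
  set I := ∫⁻ t in Set.Ioi c, D t.toNNReal / ENNReal.ofReal (t ^ q) / ENNReal.ofReal t with hIdef
  have hDm : Measurable D := hD.measurable
  -- The `B_q` integral would be infinite if the gauge were infinite on all of (c, ∞).
  obtain ⟨d, hd, hdt⟩ : ∃ d : ℝ, c < d ∧ D d.toNNReal ≠ ∞ := by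
    by_contra! hcon
    refine hI.ne ?_
    have : I = ∫⁻ t in Set.Ioi c, ∞ := by
      refine setLIntegral_congr_fun measurableSet_Ioi fun t ht => ?_
      simp only [hcon t ht]
      rw [ENNReal.top_div_of_ne_top ENNReal.ofReal_ne_top,
        ENNReal.top_div_of_ne_top ENNReal.ofReal_ne_top]
    rw [this]
    simp
  set c1 : ℝ≥0 := d.toNNReal with hc1
  set m : ℝ≥0 := (D c1).toNNReal with hm
  -- Chosen so that ε · D(c1) ≤ m/(2m + 1) ≤ 1/2, the smallness required by the weak-type estimate.
  set ε : ℝ≥0 := 1 / (2 * m + 1) with hεdef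
  have hε : 0 < ε := by positivity
  have hε1 : ε ≤ 1 := by
    rw [hεdef, div_le_iff₀ (by positivity)]; simp
  have hεc : D (ε * c1) ≤ 1 / 2 := by
    refine (hconv ε hε1 c1).trans ?_
    rw [← ENNReal.coe_toNNReal hdt]
    have : ε * m ≤ 1 / 2 := by
      rw [hεdef, one_div_mul_eq_div, div_le_div_iff₀ (by positivity) (by norm_num)]
      rw [one_mul, mul_comm]; exact le_self_add
    calc (ε : ℝ≥0∞) * ((D c1).toNNReal : ℝ≥0∞) = ((ε * m : ℝ≥0) : ℝ≥0∞) := by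
          rw [ENNReal.coe_mul]
      _ ≤ ((1 / 2 : ℝ≥0) : ℝ≥0∞) := by exact_mod_cast this
      _ = 1 / 2 := by rw [ENNReal.coe_div (by norm_num)]; simp
  set Φ := (Set.Ioi c1).indicator D with hΦ
  have hΦm : Measurable Φ := hDm.indicator measurableSet_Ioi
  set K : ℝ≥0∞ := ENNReal.ofReal q * (2 * 5 ^ n * ((ε : ℝ≥0∞)⁻¹ ^ q * I)) with hK
  have hKt : K ≠ ∞ := by
    have : (ε : ℝ≥0∞)⁻¹ ^ q ≠ ∞ := ENNReal.rpow_ne_top_of_nonneg hq.le (by simp [hε.ne'])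
    have := hI.ne
    finiteness
  refine ⟨K.toNNReal, fun a ℓ hℓ g hg => ?_⟩
  rw [ENNReal.coe_toNNReal hKt]
  set M := orliczMax D a ℓ g with hM
  have hMm : Measurable M := measurable_orliczMax D a ℓ g
  have hinner : ∀ y, ∫⁻ t in Set.Ioi (0 : ℝ),
      Φ (g y / ε / t.toNNReal) * ENNReal.ofReal (t ^ (q - 1)) ≤
        (ε : ℝ≥0∞)⁻¹ ^ q * I * (g y : ℝ≥0∞) ^ q := by
    intro y
    rcases eq_zero_or_pos (g y) with h0 | h0
    · have : ∀ t : ℝ, Φ (g y / ε / t.toNNReal) = 0 := fun t => by simp [h0, hΦ]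
      simp [this]
    · rw [lintegral_Ioi_comp_div_mul_rpow (div_pos h0 hε), ENNReal.coe_div hε.ne', div_eq_mul_inv,
        ENNReal.mul_rpow_of_nonneg _ _ hq.le, mul_comm ((g y : ℝ≥0∞) ^ q), mul_assoc, mul_assoc,
        mul_comm I]
      gcongr
      rw [hIdef, ← lintegral_indicator measurableSet_Ioi, ← lintegral_indicator measurableSet_Ioi]
      refine lintegral_mono fun t => ?_
      simp only [hΦ]
      -- The cutoff at c1 = d > c leaves only the tail on which the `B_q` integral is finite.
      by_cases ht : c1 < t.toNNReal
      · have hdt' : d < t := by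
          by_contra! hcon
          exact absurd ht (not_lt.2 (Real.toNNReal_le_toNNReal hcon))
        rw [Set.indicator_of_mem (show t ∈ Set.Ioi (0 : ℝ) from hc.trans (hd.trans hdt')),
          Set.indicator_of_mem (show t ∈ Set.Ioi c from hd.trans hdt'),
          Set.indicator_of_mem (show t.toNNReal ∈ Set.Ioi c1 from ht)]
      · have h0 : (Set.Ioi c1).indicator D t.toNNReal = 0 :=
          Set.indicator_of_notMem (show t.toNNReal ∉ Set.Ioi c1 from ht) _
        have h1 : (Set.Ioi (0 : ℝ)).indicator (fun t => (Set.Ioi c1).indicator D t.toNNReal /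
            ENNReal.ofReal (t ^ q) / ENNReal.ofReal t) t = 0 := by
          by_cases h2 : t ∈ Set.Ioi (0 : ℝ)
          · rw [Set.indicator_of_mem h2, h0, ENNReal.zero_div, ENNReal.zero_div]
          · rw [Set.indicator_of_notMem h2]
        rw [h1]
        exact zero_le
  have hswap : ∫⁻ t in Set.Ioi (0 : ℝ), (∫⁻ y, Φ (g y / ε / t.toNNReal)) *
      ENNReal.ofReal (t ^ (q - 1)) ≤ (ε : ℝ≥0∞)⁻¹ ^ q * I * ∫⁻ y, (g y : ℝ≥0∞) ^ q := by
    have hmeas : Measurable fun z : ℝ × Eu n => Φ (g z.2 / ε / z.1.toNNReal) := by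
      refine hΦm.comp ?_
      fun_prop
    calc ∫⁻ t in Set.Ioi (0 : ℝ), (∫⁻ y, Φ (g y / ε / t.toNNReal)) * ENNReal.ofReal (t ^ (q - 1))
        = ∫⁻ t in Set.Ioi (0 : ℝ), ∫⁻ y,
            Φ (g y / ε / t.toNNReal) * ENNReal.ofReal (t ^ (q - 1)) := by
          refine lintegral_congr fun t => ?_
          rw [lintegral_mul_const' _ _ ENNReal.ofReal_ne_top]
      _ = ∫⁻ y, ∫⁻ t in Set.Ioi (0 : ℝ),
            Φ (g y / ε / t.toNNReal) * ENNReal.ofReal (t ^ (q - 1)) := by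
          refine lintegral_lintegral_swap (Measurable.aemeasurable ?_)
          exact hmeas.mul (by fun_prop)
      _ ≤ ∫⁻ y, (ε : ℝ≥0∞)⁻¹ ^ q * I * (g y : ℝ≥0∞) ^ q := lintegral_mono hinner
      _ = _ := lintegral_const_mul _ (by fun_prop)
  -- The layer-cake formula concerns real-valued functions, so the maximal function is capped at N
  -- first.
  rw [lintegral_rpow_eq_iSup (Y := fun (N : ℕ) x => min (M x) N)
    (fun N => hMm.min measurable_const)
    (fun N N' h x => min_le_min le_rfl (by exact_mod_cast h))
    (fun x => (iSup_min_natCast (M x)).symm) hq]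
  refine iSup_le fun N => ?_
  have hfin : ∀ x, min (M x) (N : ℝ≥0∞) ≠ ∞ := fun x =>
    ((min_le_right _ _).trans_lt (ENNReal.natCast_lt_top N)).ne
  calc ∫⁻ x, min (M x) (N : ℝ≥0∞) ^ q
      = ∫⁻ x, ENNReal.ofReal ((min (M x) (N : ℝ≥0∞)).toReal ^ q) := by
        refine lintegral_congr fun x => ?_
        rw [← ENNReal.ofReal_rpow_of_nonneg ENNReal.toReal_nonneg hq.le,
          ENNReal.ofReal_toReal (hfin x)]
    _ = ENNReal.ofReal q * ∫⁻ t in Set.Ioi (0 : ℝ),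
          volume {x | t < (min (M x) (N : ℝ≥0∞)).toReal} * ENNReal.ofReal (t ^ (q - 1)) :=
        lintegral_rpow_eq_lintegral_meas_lt_mul _ (ae_of_all _ fun x => ENNReal.toReal_nonneg)
          (hMm.min measurable_const).ennreal_toReal.aemeasurable hq
    _ ≤ ENNReal.ofReal q * ∫⁻ t in Set.Ioi (0 : ℝ),
          2 * 5 ^ n * ((∫⁻ y, Φ (g y / ε / t.toNNReal)) * ENNReal.ofReal (t ^ (q - 1))) := by
        refine mul_le_mul_right (setLIntegral_mono' measurableSet_Ioi fun t ht => ?_) _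
        rw [← mul_assoc]
        refine mul_le_mul_left ?_ _
        refine le_trans (measure_mono fun x hx => ?_)
          (volume_lt_orliczMax_le (a := a) hD hε hε1 hεc hℓ (Real.toNNReal_pos.2 ht))
        have hx' : ENNReal.ofReal t < min (M x) (N : ℝ≥0∞) :=
          (ENNReal.ofReal_lt_iff_lt_toReal (le_of_lt ht) (hfin x)).2 hx
        exact hx'.trans_le (min_le_left _ _)
    _ = ENNReal.ofReal q * (2 * 5 ^ n * ∫⁻ t in Set.Ioi (0 : ℝ),
          (∫⁻ y, Φ (g y / ε / t.toNNReal)) * ENNReal.ofReal (t ^ (q - 1))) := by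
        rw [lintegral_const_mul' _ _ (by finiteness)]
    _ ≤ ENNReal.ofReal q * (2 * 5 ^ n * ((ε : ℝ≥0∞)⁻¹ ^ q * I * ∫⁻ y, (g y : ℝ≥0∞) ^ q)) := by
        gcongr
    _ = K * ∫⁻ y, (g y : ℝ≥0∞) ^ q := by rw [hK]; ring

end OrliczMaximal

/-! ### Kernel estimates -/

section Kernel

variable {n : ℕ} {K : Eu n → Eu n → ℂ}

lemma norm_sub_le_of_mem_cube {a : Eu n} {ℓ : ℝ} (hℓ : 0 ≤ ℓ) {x y : Eu n} (hx : x ∈ cube a ℓ)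
    (hy : y ∈ cube a ℓ) : ‖x - y‖ ≤ √n * ℓ := by
  rw [EuclideanSpace.norm_eq]
  calc √(∑ i, ‖(x - y) i‖ ^ 2) ≤ √(∑ _i : Fin n, ℓ ^ 2) := by
        refine Real.sqrt_le_sqrt (Finset.sum_le_sum fun i _ => ?_)
        have h1 := hx i
        have h2 := hy i
        refine pow_le_pow_left₀ (norm_nonneg _) ?_ 2
        rw [PiLp.sub_apply, Real.norm_eq_abs, abs_le]
        constructor <;> linarith [h1.1, h1.2, h2.1, h2.2]
    _ = √n * ℓ := by
        rw [Finset.sum_const, Finset.card_univ, Fintype.card_fin, nsmul_eq_mul,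
          Real.sqrt_mul (by positivity), Real.sqrt_sq hℓ]

lemma le_norm_sub_of_notMem_tripleCube {a : Eu n} {ℓ : ℝ} {x y : Eu n} (hx : x ∈ cube a ℓ)
    (hy : y ∉ tripleCube a ℓ) : ℓ ≤ ‖x - y‖ := by
  rw [mem_tripleCube] at hy
  push Not at hy
  obtain ⟨i, hi⟩ := hy
  have h1 := hx i
  refine le_trans ?_ (PiLp.norm_apply_le (x - y) i)
  rw [PiLp.sub_apply, Real.norm_eq_abs]
  by_cases h : a i - ℓ ≤ y i
  · rw [abs_sub_comm]
    exact le_trans (by linarith [hi h, h1.2]) (le_abs_self _)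
  · exact le_trans (by linarith [h1.1]) (le_abs_self _)

/-- Measurability of the kernel is not assumed; regularity in the second variable supplies it away
from the diagonal. -/
lemma IsCZKernel.continuousOn (hK : IsCZKernel K) (x : Eu n) : ContinuousOn (K x) {x}ᶜ := by
  obtain ⟨C, δ, hδ, -, -, hreg⟩ := hK
  intro y hy
  refine ContinuousAt.continuousWithinAt ?_
  have hyx : 0 < ‖y - x‖ := norm_pos_iff.2 (sub_ne_zero.2 hy)
  rw [ContinuousAt, tendsto_iff_norm_sub_tendsto_zero]
  have hlim : Filter.Tendsto (fun z => C * ‖y - z‖ ^ δ / ‖y - x‖ ^ ((n : ℝ) + δ)) (nhds y)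
      (nhds 0) := by
    have : ContinuousAt (fun z => C * ‖y - z‖ ^ δ / ‖y - x‖ ^ ((n : ℝ) + δ)) y :=
      ((continuousAt_const.mul (((continuous_const.sub continuous_id).norm.continuousAt).rpow_const
        (Or.inr hδ.le))).div_const _)
    have h2 := this.tendsto
    simpa [Real.zero_rpow hδ.ne'] using h2
  refine squeeze_zero' (Filter.Eventually.of_forall fun z => norm_nonneg _) ?_ hlim
  have hev : ∀ᶠ z in nhds y, ‖y - z‖ < ‖y - x‖ / 2 := by
    filter_upwards [Metric.ball_mem_nhds y (half_pos hyx)] with z hz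
    rwa [mem_ball_iff_norm'] at hz
  filter_upwards [hev] with z hz
  have := hreg y z x hz
  rw [norm_sub_rev]
  linarith [norm_nonneg (K y x - K z x)]

/-- The value of the kernel at y = x is uncontrolled; the condition `h x = 0` removes it from the
product. -/
lemma IsCZKernel.aestronglyMeasurable_mul (hK : IsCZKernel K) {x : Eu n} {h : Eu n → ℂ}
    (hh : AEStronglyMeasurable h volume) (hx : h x = 0) :
    AEStronglyMeasurable (fun y => K x y * h y) volume := by
  have h1 : AEStronglyMeasurable (({x}ᶜ : Set (Eu n)).indicator (K x)) volume :=
    (aestronglyMeasurable_indicator_iff (measurableSet_singleton x).compl).2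
      ((hK.continuousOn x).aestronglyMeasurable (measurableSet_singleton x).compl)
  refine (h1.mul hh).congr (ae_of_all _ fun y => ?_)
  by_cases hy : y = x
  · simp [hy, hx]
  · simp [Set.indicator_of_mem (show y ∈ ({x}ᶜ : Set (Eu n)) from hy)]

/-- A kernel bound with nonnegative constant. -/
lemma IsCZKernel.exists_size (hK : IsCZKernel K) :
    ∃ C : ℝ, 0 ≤ C ∧ ∀ x y s, 0 < s → s ≤ ‖x - y‖ → ‖K x y‖ ≤ C / s ^ n := by
  obtain ⟨C, δ, hδ, -, hsize, -⟩ := hK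
  refine ⟨|C|, abs_nonneg C, fun x y s hs hxy => ?_⟩
  have hne : x ≠ y := by
    rintro rfl
    simp only [sub_self, norm_zero] at hxy
    linarith
  calc ‖K x y‖ ≤ C / ‖x - y‖ ^ n := hsize x y hne
    _ ≤ |C| / ‖x - y‖ ^ n := by gcongr; exact le_abs_self C
    _ ≤ |C| / s ^ n := by gcongr

lemma IsCZKernel.integrable_mul (hK : IsCZKernel K) {x : Eu n} {h : Eu n → ℂ} {s : ℝ}
    (hs : 0 < s) (hint : Integrable h volume) (hx : ∀ y, h y ≠ 0 → s ≤ ‖x - y‖) :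
    Integrable (fun y => K x y * h y) volume := by
  obtain ⟨C, hC, hsize⟩ := hK.exists_size
  have hx0 : h x = 0 := by
    by_contra hne
    have := hx x hne
    simp only [sub_self, norm_zero] at this
    linarith
  refine (hint.norm.const_mul (C / s ^ n)).mono' (hK.aestronglyMeasurable_mul hint.1 hx0)
    (ae_of_all _ fun y => ?_)
  rw [norm_mul]
  by_cases hy : h y = 0
  · simp [hy]
  · gcongr
    exact hsize x y s hs (hx y hy)

/-- Oscillation of the kernel at points whose distance may exceed the range of the regularity
condition by a dimensional factor. -/
lemma IsCZKernel.exists_osc (hK : IsCZKernel K) :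
    ∃ C δ : ℝ, 0 ≤ C ∧ 0 < δ ∧ ∀ (x x' y : Eu n) (ℓ s : ℝ), 0 < ℓ → 0 < s → ‖x - x'‖ ≤ √n * ℓ →
      s ≤ ‖x - y‖ → s ≤ ‖x' - y‖ → ‖K x y - K x' y‖ ≤ C * (ℓ / s) ^ δ / s ^ n := by
  obtain ⟨C₁, hC₁, hsize⟩ := hK.exists_size
  obtain ⟨C₂, δ, hδ, -, -, hreg⟩ := hK
  refine ⟨|C₂| * (√n) ^ δ + 2 * C₁ * (2 * √n) ^ δ, δ, by positivity, hδ, ?_⟩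
  intro x x' y ℓ s hℓ hs hxx hxy hxy'
  have hn : 0 ≤ √(n : ℝ) := Real.sqrt_nonneg _
  have key : ∀ A : ℝ,
      (A ≤ |C₂| * (√n * ℓ) ^ δ / s ^ ((n : ℝ) + δ) ∨ A ≤ 2 * C₁ * (2 * √n * ℓ / s) ^ δ / s ^ n) →
      A ≤ (|C₂| * (√n) ^ δ + 2 * C₁ * (2 * √n) ^ δ) * (ℓ / s) ^ δ / s ^ n := by
    intro A hAB
    have e1 : |C₂| * (√n * ℓ) ^ δ / s ^ ((n : ℝ) + δ) = |C₂| * (√n) ^ δ * (ℓ / s) ^ δ / s ^ n := by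
      rw [Real.mul_rpow hn hℓ.le, Real.rpow_add hs, Real.rpow_natCast, Real.div_rpow hℓ.le hs.le]
      field_simp
    have e2 : 2 * C₁ * (2 * √n * ℓ / s) ^ δ / s ^ n =
        2 * C₁ * (2 * √n) ^ δ * (ℓ / s) ^ δ / s ^ n := by
      rw [mul_div_assoc (2 * √(n : ℝ)), Real.mul_rpow (by positivity) (by positivity)]
      ring
    have p1 : 0 ≤ |C₂| * (√n) ^ δ * (ℓ / s) ^ δ / s ^ n := by positivity
    have p2 : 0 ≤ 2 * C₁ * (2 * √n) ^ δ * (ℓ / s) ^ δ / s ^ n := by positivity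
    rw [e1, e2] at hAB
    have e3 : (|C₂| * (√n) ^ δ + 2 * C₁ * (2 * √n) ^ δ) * (ℓ / s) ^ δ / s ^ n =
      |C₂| * (√n) ^ δ * (ℓ / s) ^ δ / s ^ n + 2 * C₁ * (2 * √n) ^ δ * (ℓ / s) ^ δ / s ^ n := by
      ring
    rw [e3]
    rcases hAB with h | h <;> linarith
  refine key _ ?_
  by_cases hcase : ‖x - x'‖ < ‖x - y‖ / 2
  · left
    have h1 := hreg x x' y hcase
    calc ‖K x y - K x' y‖ ≤ C₂ * ‖x - x'‖ ^ δ / ‖x - y‖ ^ ((n : ℝ) + δ) := by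
          linarith [norm_nonneg (K y x - K y x')]
      _ ≤ |C₂| * ‖x - x'‖ ^ δ / ‖x - y‖ ^ ((n : ℝ) + δ) := by gcongr; exact le_abs_self _
      _ ≤ |C₂| * (√n * ℓ) ^ δ / s ^ ((n : ℝ) + δ) := by gcongr
  -- Outside the range of regularity s ≤ ‖x − y‖ ≤ 2‖x − x'‖ ≤ 2√n ℓ. The factor (2√n ℓ/s)^δ is then
  -- at least 1 and can be attached to the plain size bound.
  · right
    have h1 : s ≤ 2 * √n * ℓ := by linarith [not_lt.1 hcase]
    have h2 : 1 ≤ (2 * √n * ℓ / s) ^ δ :=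
      Real.one_le_rpow ((one_le_div hs).2 h1) hδ.le
    calc ‖K x y - K x' y‖ ≤ ‖K x y‖ + ‖K x' y‖ := norm_sub_le _ _
      _ ≤ C₁ / s ^ n + C₁ / s ^ n := add_le_add (hsize x y s hs hxy) (hsize x' y s hs hxy')
      _ = 2 * C₁ * 1 / s ^ n := by ring
      _ ≤ 2 * C₁ * (2 * √n * ℓ / s) ^ δ / s ^ n := by gcongr

lemma sum_Ico_pow_sub_le_tsum (t : ℝ≥0∞) (k m : ℕ) :
    ∑ j ∈ Finset.Ico k m, t ^ (m - (j + 1)) ≤ ∑' i : ℕ, t ^ i := by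
  rw [← Finset.sum_image (s := Finset.Ico k m) (g := fun j => m - (j + 1)) (f := fun i => t ^ i)]
  · exact ENNReal.sum_le_tsum _
  · intro i hi j hj hij
    simp only [Finset.coe_Ico, Set.mem_Ico] at hi hj
    simp only at hij
    omega

/-- The part of an integral over `3Q ∖ 3P` that sees the oscillation of the kernel on `P` is
controlled by averages over triples of the strict ancestors of `P` inside `Q`. -/
lemma IsCZKernel.exists_lintegral_osc_le (hK : IsCZKernel K) :
    ∃ C : ℝ≥0, ∀ (a : Eu n) (ℓ : ℝ), 0 < ℓ → ∀ (P Q : Idx n), Q.1 ≤ P.1 →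
      dcube a ℓ P ⊆ dcube a ℓ Q → ∀ (F : Eu n → ℝ≥0∞), AEMeasurable F → ∀ B : ℝ≥0∞,
      (∀ R : Idx n, Q.1 ≤ R.1 → R.1 < P.1 → dcube a ℓ P ⊆ dcube a ℓ R →
        (volume (dtriple a ℓ R))⁻¹ * ∫⁻ y in dtriple a ℓ R, F y ≤ B) →
      ∀ x ∈ dcube a ℓ P, ∀ x' ∈ dcube a ℓ P,
        ∫⁻ y in dtriple a ℓ Q \ dtriple a ℓ P, ‖K x y - K x' y‖ₑ * F y ≤ C * B := by
  obtain ⟨C, δ, hC, hδ, hosc⟩ := hK.exists_osc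
  set t : ℝ≥0∞ := ENNReal.ofReal ((2⁻¹ : ℝ) ^ δ) with ht
  have ht1 : t < 1 := by
    rw [ht, ENNReal.ofReal_lt_one]
    exact Real.rpow_lt_one (by norm_num) (by norm_num) hδ
  set c : ℝ≥0∞ := ENNReal.ofReal (C * 6 ^ n) * ∑' i : ℕ, t ^ i with hc
  have hct : c ≠ ∞ := by
    rw [hc, ENNReal.tsum_geometric]
    have : (1 - t)⁻¹ ≠ ∞ := ENNReal.inv_ne_top.2 (tsub_pos_of_lt ht1).ne'
    finiteness
  refine ⟨c.toNNReal, ?_⟩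
  rw [ENNReal.coe_toNNReal hct]
  intro a ℓ hℓ P Q hQP hPQ F hF B hB x hx x' hx'
  -- The chain of dyadic cubes containing x; between the generations of Q and P it consists of the
  -- ancestors of P inside Q.
  set R : ℕ → Idx n := fun j => (j, dpos a ℓ j x) with hR
  have hxR : ∀ j, x ∈ dcube a ℓ (R j) := fun j => self_mem_dcube hℓ j x
  have hRQ : R Q.1 = Q := eq_of_mem_dcube hℓ rfl (hxR _) (hPQ hx)
  have hRP : R P.1 = P := eq_of_mem_dcube hℓ rfl (hxR _) hx
  set s : ℕ → ℝ := fun j => dside ℓ (R (j + 1)) with hs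
  have hspos : ∀ j, 0 < s j := fun j => dside_pos hℓ _
  set w : ℕ → ℝ≥0∞ := fun j => ENNReal.ofReal (C * (dside ℓ P / s j) ^ δ / s j ^ n) with hw
  have hPR : ∀ j, j ≤ P.1 → dcube a ℓ P ⊆ dcube a ℓ (R j) := fun j hj =>
    dcube_subset_of_mem hℓ hj (hxR j) hx
  have hptw : ∀ y ∈ dtriple a ℓ Q \ dtriple a ℓ P, ‖K x y - K x' y‖ₑ * F y ≤
      ∑ j ∈ Finset.Ico Q.1 P.1, (dtriple a ℓ (R j)).indicator (fun y => w j * F y) y := by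
    rintro y ⟨hyQ, hyP⟩
    -- The shells 3R_j ∖ 3R_{j+1} exhaust 3Q ∖ 3P: the shell of y is found from the first generation
    -- at which y leaves the triple. There y is at distance at least the side s_j of R_{j+1} from
    -- both x and x'.
    have hex : ∃ j, Q.1 ≤ j ∧ y ∉ dtriple a ℓ (R j) := ⟨P.1, hQP, by rwa [hRP]⟩
    classical
    obtain ⟨h1, h2⟩ := Nat.find_spec hex
    have hle : Nat.find hex ≤ P.1 := Nat.find_min' hex ⟨hQP, by rwa [hRP]⟩
    have hne : Nat.find hex ≠ Q.1 := by
      intro h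
      rw [h, hRQ] at h2
      exact h2 hyQ
    obtain ⟨j, hj⟩ : ∃ j, Nat.find hex = j + 1 := Nat.exists_eq_succ_of_ne_zero (by omega)
    have hjQ : Q.1 ≤ j := by omega
    have hjP : j < P.1 := by omega
    have hyj : y ∈ dtriple a ℓ (R j) := by
      by_contra hcon
      exact Nat.find_min hex (m := j) (by omega) ⟨hjQ, hcon⟩
    rw [hj] at h2
    refine le_trans ?_ (Finset.single_le_sum (f := fun j =>
      (dtriple a ℓ (R j)).indicator (fun y => w j * F y) y) (fun _ _ => zero_le)
      (Finset.mem_Ico.2 ⟨hjQ, hjP⟩))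
    simp only [Set.indicator_of_mem hyj]
    gcongr
    rw [← ofReal_norm]
    refine ENNReal.ofReal_le_ofReal (hosc x x' y _ _ (dside_pos hℓ P) (hspos j) ?_ ?_ ?_)
    · exact norm_sub_le_of_mem_cube (dside_pos hℓ P).le hx hx'
    · exact le_norm_sub_of_notMem_tripleCube (hxR (j + 1)) h2
    · exact le_norm_sub_of_notMem_tripleCube (hPR (j + 1) (by omega) hx') h2
  have hterm : ∀ j ∈ Finset.Ico Q.1 P.1, ∫⁻ y in dtriple a ℓ (R j), w j * F y ≤
      ENNReal.ofReal (C * 6 ^ n) * t ^ (P.1 - (j + 1)) * B := by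
    intro j hj
    rw [Finset.mem_Ico] at hj
    have h1 := hB (R j) hj.1 hj.2 (hPR j hj.2.le)
    rw [ENNReal.inv_mul_le_iff (volume_dtriple_ne_zero hℓ _) (volume_dtriple_ne_top _)] at h1
    rw [lintegral_const_mul' _ _ ENNReal.ofReal_ne_top]
    -- 3R_j has side 3 · 2 s_j, which gives the constant 6^n and cancels the s_j^n of the kernel
    -- bound. Only the decay (side of P / s_j)^δ = t^{P.1−(j+1)} remains.
    have hv : volume (dtriple a ℓ (R j)) = ENNReal.ofReal ((6 * s j) ^ n) := by
      rw [dtriple, tripleCube, volume_cube, ENNReal.ofReal_pow (by have := hspos j; positivity)]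
      congr 2
      simp only [hs, hR, dside, pow_succ]
      field_simp
      norm_num
    have hq : dside ℓ P / s j = (2⁻¹ : ℝ) ^ (P.1 - (j + 1)) := by
      simp only [hs, hR, dside]
      rw [inv_pow, div_div_div_cancel_left' _ _ hℓ.ne', ← one_div, div_eq_div_iff (by positivity)
        (by positivity), one_mul, ← pow_add]
      congr 1; omega
    calc w j * ∫⁻ y in dtriple a ℓ (R j), F y
        ≤ w j * (volume (dtriple a ℓ (R j)) * B) := by gcongr
      _ = ENNReal.ofReal (C * 6 ^ n) * t ^ (P.1 - (j + 1)) * B := by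
        rw [hv, ← mul_assoc, hw, ht, ← ENNReal.ofReal_mul
          (by have := hspos j; have := dside_pos hℓ P; positivity),
          ← ENNReal.ofReal_pow (by positivity), ← ENNReal.ofReal_mul (by positivity), hq,
          ← Real.rpow_natCast (2⁻¹ : ℝ), ← Real.rpow_mul (by norm_num), mul_comm (_ : ℝ) δ,
          Real.rpow_mul (by norm_num), Real.rpow_natCast]
        congr 2
        have := (hspos j).ne'
        rw [mul_pow]
        field_simp
  calc ∫⁻ y in dtriple a ℓ Q \ dtriple a ℓ P, ‖K x y - K x' y‖ₑ * F y
      ≤ ∫⁻ y in dtriple a ℓ Q \ dtriple a ℓ P,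
          ∑ j ∈ Finset.Ico Q.1 P.1, (dtriple a ℓ (R j)).indicator (fun y => w j * F y) y :=
        setLIntegral_mono' ((measurableSet_dtriple _ _ _).diff (measurableSet_dtriple _ _ _)) hptw
    _ ≤ ∫⁻ y, ∑ j ∈ Finset.Ico Q.1 P.1, (dtriple a ℓ (R j)).indicator (fun y => w j * F y) y :=
        setLIntegral_le_lintegral _ _
    _ = ∑ j ∈ Finset.Ico Q.1 P.1, ∫⁻ y in dtriple a ℓ (R j), w j * F y := by
        rw [lintegral_finsetSum' _ fun j _ =>
          (hF.const_mul _).indicator (measurableSet_dtriple _ _ _)]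
        exact Finset.sum_congr rfl fun j _ => lintegral_indicator (measurableSet_dtriple _ _ _) _
    _ ≤ ∑ j ∈ Finset.Ico Q.1 P.1, ENNReal.ofReal (C * 6 ^ n) * t ^ (P.1 - (j + 1)) * B :=
        Finset.sum_le_sum hterm
    _ = ENNReal.ofReal (C * 6 ^ n) * (∑ j ∈ Finset.Ico Q.1 P.1, t ^ (P.1 - (j + 1))) * B := by
        rw [Finset.mul_sum, Finset.sum_mul]
    _ ≤ c * B := by
        rw [hc]
        gcongr
        exact sum_Ico_pow_sub_le_tsum t Q.1 P.1

end Kernel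

/-! ### Stopping cubes -/

section Stopping

variable {n : ℕ} {a : Eu n} {ℓ : ℝ}

/-- Openness of U lets the stopping cubes cover every point of U in Q, with no exceptional null set
and no differentiation theorem. -/
lemma exists_dcube_subset_of_isOpen (hℓ : 0 < ℓ) {U : Set (Eu n)} (hU : IsOpen U) {x : Eu n}
    (hx : x ∈ U) (k₀ : ℕ) : ∃ k, k₀ < k ∧ dcube a ℓ (k, dpos a ℓ k x) ⊆ U := by
  obtain ⟨ε, hε, hball⟩ := Metric.isOpen_iff.1 hU x hx
  have hlim : Filter.Tendsto (fun k : ℕ => √(n : ℝ) * (ℓ / 2 ^ k)) Filter.atTop (nhds 0) := by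
    have := (tendsto_pow_atTop_nhds_zero_of_lt_one (r := (1 / 2 : ℝ)) (by norm_num)
      (by norm_num)).const_mul (√(n : ℝ) * ℓ)
    rw [mul_zero] at this
    refine this.congr fun k => ?_
    rw [one_div, inv_pow]; ring
  obtain ⟨k, hk, hk₀⟩ := ((hlim.eventually_lt_const hε).and
    (Filter.eventually_gt_atTop k₀)).exists
  refine ⟨k, hk₀, fun y hy => hball ?_⟩
  rw [mem_ball_iff_norm]
  exact (norm_sub_le_of_mem_cube (dside_pos hℓ _).le hy (self_mem_dcube hℓ k x)).trans_lt hk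

/-- The maximal dyadic subcubes of `Q` that meet the open set `U` in a large proportion. -/
lemma exists_stopping_cubes (hℓ : 0 < ℓ) (Q : Idx n) {U : Set (Eu n)} (hU : IsOpen U)
    (hUQ : volume U ≤ (2 ^ (n + 2))⁻¹ * volume (dcube a ℓ Q)) :
    ∃ S : Set (Idx n), (∀ P ∈ S, Q.1 < P.1 ∧ dcube a ℓ P ⊆ dcube a ℓ Q) ∧
      S.PairwiseDisjoint (dcube a ℓ) ∧
      ∑' P : S, volume (dcube a ℓ P.1) ≤ 1 / 2 * volume (dcube a ℓ Q) ∧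
      (∀ P ∈ S, volume (dcube a ℓ P ∩ U) ≤ 1 / 2 * volume (dcube a ℓ P)) ∧
      (∀ x ∈ dcube a ℓ Q, x ∈ U → ∃ P ∈ S, x ∈ dcube a ℓ P) ∧
      ∀ P ∈ S, ∀ R : Idx n, Q.1 ≤ R.1 → R.1 < P.1 → dcube a ℓ P ⊆ dcube a ℓ R →
        ¬ dcube a ℓ R ⊆ U := by
  -- The threshold 2^{−(n+1)} serves two ends. A selected cube has a parent of density at most
  -- 2^{−(n+1)}, so its own density is at most 2^n · 2^{−(n+1)} = 1/2. The selected cubes have total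
  -- measure at most 2^{n+1}|U| ≤ |Q|/2.
  set dens : Idx n → Prop := fun P =>
    (2 ^ (n + 1))⁻¹ * volume (dcube a ℓ P) < volume (dcube a ℓ P ∩ U) with hdens
  set S : Set (Idx n) := {P | Q.1 < P.1 ∧ dcube a ℓ P ⊆ dcube a ℓ Q ∧ dens P ∧
    ∀ R : Idx n, Q.1 < R.1 → R.1 < P.1 → dcube a ℓ P ⊆ dcube a ℓ R → ¬ dens R} with hS
  have hQd : ¬ dens Q := by
    rw [hdens]
    refine not_lt.2 ((measure_mono Set.inter_subset_right).trans (hUQ.trans ?_))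
    gcongr
    · norm_num
    · omega
  have hdens_sub : ∀ P : Idx n, dcube a ℓ P ⊆ U → dens P := by
    intro P hP
    simp only [hdens]
    rw [Set.inter_eq_left.2 hP]
    conv_rhs => rw [← one_mul (volume (dcube a ℓ P))]
    refine ENNReal.mul_lt_mul_left (volume_dcube_ne_zero hℓ P) (volume_dcube_ne_top P) ?_
    rw [ENNReal.inv_lt_one]
    exact one_lt_pow₀ (by norm_num) (by omega)
  have hanc : ∀ P ∈ S, ∀ R : Idx n, Q.1 ≤ R.1 → R.1 < P.1 → dcube a ℓ P ⊆ dcube a ℓ R →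
      ¬ dens R := by
    rintro P ⟨h1, h2, h3, h4⟩ R hQR hRP hPR
    rcases hQR.lt_or_eq with h | h
    · exact h4 R h hRP hPR
    · have hc := dcorner_mem (a := a) hℓ P
      rw [← eq_of_mem_dcube hℓ h (h2 hc) (hPR hc)]
      exact hQd
  have hdisj : S.PairwiseDisjoint (dcube a ℓ) := by
    intro P hP R hR hne
    refine Set.disjoint_left.2 fun x hxP hxR => hne ?_
    rcases lt_trichotomy P.1 R.1 with h | h | h
    · exact absurd hP.2.2.1 (hR.2.2.2 P hP.1 h (dcube_subset_of_mem hℓ h.le hxP hxR))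
    · exact eq_of_mem_dcube hℓ h hxP hxR
    · exact absurd hR.2.2.1 (hP.2.2.2 R hR.1 h (dcube_subset_of_mem hℓ h.le hxR hxP))
  refine ⟨S, fun P hP => ⟨hP.1, hP.2.1⟩, hdisj, ?_, ?_, ?_, ?_⟩
  · have h2 : (2 : ℝ≥0∞) ^ (n + 1) ≠ 0 := by positivity
    have h2t : (2 : ℝ≥0∞) ^ (n + 1) ≠ ∞ := by finiteness
    calc ∑' P : S, volume (dcube a ℓ P.1)
        ≤ ∑' P : S, 2 ^ (n + 1) * volume (dcube a ℓ P.1 ∩ U) := by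
          refine ENNReal.tsum_le_tsum fun P => ?_
          have := P.2.2.2.1.le
          rwa [ENNReal.inv_mul_le_iff h2 h2t] at this
      _ = 2 ^ (n + 1) * volume (⋃ P ∈ S, dcube a ℓ P ∩ U) := by
          rw [ENNReal.tsum_mul_left, measure_biUnion S.to_countable
            (hdisj.mono fun P => Set.inter_subset_left)
            (fun P _ => (measurableSet_dcube a ℓ P).inter hU.measurableSet)]
      _ ≤ 2 ^ (n + 1) * ((2 ^ (n + 2))⁻¹ * volume (dcube a ℓ Q)) := by
          gcongr
          exact (measure_mono (Set.iUnion₂_subset fun P _ => Set.inter_subset_right)).trans hUQ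
      _ = 1 / 2 * volume (dcube a ℓ Q) := by
          rw [← mul_assoc, pow_succ 2 (n + 1), ENNReal.mul_inv (Or.inl h2) (Or.inl h2t),
            ← mul_assoc, ENNReal.mul_inv_cancel h2 h2t, one_mul, one_div]
  · intro P hP
    obtain ⟨k, hk⟩ : ∃ k, P.1 = k + 1 := Nat.exists_eq_succ_of_ne_zero (by have := hP.1; omega)
    -- The dyadic parent of P, which is not dense by maximality of P, or because it is Q.
    set R : Idx n := (k, dpos a ℓ k (dcorner a ℓ P)) with hR
    have hPR : dcube a ℓ P ⊆ dcube a ℓ R :=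
      dcube_subset_of_mem hℓ (by simp only [hR]; omega) (self_mem_dcube hℓ k _) (dcorner_mem hℓ P)
    have h1 : ¬ dens R := hanc P hP R (by have := hP.1; simp only [hR]; omega)
      (by simp only [hR]; omega) hPR
    calc volume (dcube a ℓ P ∩ U) ≤ volume (dcube a ℓ R ∩ U) :=
          measure_mono (Set.inter_subset_inter_left U hPR)
      _ ≤ (2 ^ (n + 1))⁻¹ * volume (dcube a ℓ R) := not_lt.1 h1
      _ = 1 / 2 * volume (dcube a ℓ P) := by
          have h2 : (2 : ℝ≥0∞) ^ n ≠ 0 := by positivity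
          have h2t : (2 : ℝ≥0∞) ^ n ≠ ∞ := by finiteness
          rw [volume_dcube_pred (a := a) (ℓ := ℓ) (Q := R) (R := P) hk, ← mul_assoc, pow_succ,
            mul_comm ((2 : ℝ≥0∞) ^ n) 2, ENNReal.mul_inv (Or.inl (by norm_num))
            (Or.inl (by norm_num)), mul_assoc (2⁻¹), ENNReal.inv_mul_cancel h2 h2t, mul_one,
            one_div]
  · intro x hxQ hxU
    classical
    have hex : ∃ k, Q.1 < k ∧ dens (k, dpos a ℓ k x) := by
      obtain ⟨k, hk, hsub⟩ := exists_dcube_subset_of_isOpen (a := a) hℓ hU hxU Q.1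
      exact ⟨k, hk, hdens_sub _ hsub⟩
    -- The least generation of a dense cube around x gives the maximal dense cube.
    obtain ⟨h1, h2⟩ := Nat.find_spec hex
    refine ⟨(Nat.find hex, dpos a ℓ (Nat.find hex) x), ⟨h1, ?_, h2, ?_⟩, self_mem_dcube hℓ _ x⟩
    · exact dcube_subset_of_mem hℓ h1.le hxQ (self_mem_dcube hℓ _ x)
    · intro R hQR hRk hsub hd
      refine Nat.find_min hex hRk ⟨hQR, ?_⟩
      rwa [← eq_of_mem_dcube hℓ (Q := R) (R := (R.1, dpos a ℓ R.1 x)) rfl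
        (hsub (self_mem_dcube hℓ _ x)) (self_mem_dcube hℓ _ x)]
  · exact fun P hP R h1 h2 h3 h4 => hanc P hP R h1 h2 h3 (hdens_sub R h4)

end Stopping

/-! ### Sublinearity and localization of the maximal modulation -/

section MaxMod

variable {n : ℕ} {ι : Type*} {T : (Eu n → ℂ) → Eu n → ℂ} {φ : ι → Eu n → ℝ}

lemma norm_modulate (ψ : Eu n → ℝ) (f : Eu n → ℂ) (x : Eu n) : ‖modulate ψ f x‖ = ‖f x‖ := by
  rw [modulate, norm_mul, show (2 * Real.pi * Complex.I * (ψ x : ℂ)) =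
    ((2 * Real.pi * ψ x : ℝ) : ℂ) * Complex.I by push_cast; ring, Complex.norm_exp_ofReal_mul_I,
    one_mul]

lemma enorm_modulate (ψ : Eu n → ℝ) (f : Eu n → ℂ) (x : Eu n) : ‖modulate ψ f x‖ₑ = ‖f x‖ₑ := by
  rw [← ofReal_norm, norm_modulate, ofReal_norm]

lemma modulate_eq_zero {ψ : Eu n → ℝ} {f : Eu n → ℂ} {x : Eu n} :
    modulate ψ f x = 0 ↔ f x = 0 := by
  rw [← norm_eq_zero, norm_modulate, norm_eq_zero]

lemma modulate_add (ψ : Eu n → ℝ) (f g : Eu n → ℂ) :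
    modulate ψ (f + g) = modulate ψ f + modulate ψ g := by
  ext x; simp [modulate, mul_add]

lemma modulate_neg (ψ : Eu n → ℝ) (f : Eu n → ℂ) :
    modulate ψ (-f) = (-1 : ℂ) • modulate ψ f := by
  ext x; simp [modulate]

lemma aestronglyMeasurable_modulate {ψ : Eu n → ℝ} (hψ : Measurable ψ) {f : Eu n → ℂ}
    (hf : AEStronglyMeasurable f volume) : AEStronglyMeasurable (modulate ψ f) volume := by
  have : Measurable fun x => Complex.exp (2 * Real.pi * Complex.I * (ψ x : ℂ)) := by fun_prop
  exact this.aestronglyMeasurable.mul hf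

lemma memLp_modulate {ψ : Eu n → ℝ} (hψ : Measurable ψ) {f : Eu n → ℂ} {q : ℝ≥0∞}
    (hf : MemLp f q volume) : MemLp (modulate ψ f) q volume :=
  hf.of_le (aestronglyMeasurable_modulate hψ hf.1) (ae_of_all _ fun x => (norm_modulate ψ f x).le)

/-- Additivity of `T` holds at every point, so the supremum over an arbitrary, possibly uncountable,
index set is subadditive at every point. -/
lemma maxMod_add_le (hT : IsCZOperator T) (hφ : ∀ α, Measurable (φ α)) {f g : Eu n → ℂ}
    (hf : MemLp f 2 volume) (hg : MemLp g 2 volume) (x : Eu n) :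
    maxMod T φ (f + g) x ≤ maxMod T φ f x + maxMod T φ g x := by
  refine iSup_le fun α => ?_
  rw [modulate_add, hT.map_add _ _ (memLp_modulate (hφ α) hf) (memLp_modulate (hφ α) hg)]
  exact (enorm_add_le _ _).trans (add_le_add (le_iSup (fun α => ‖T (modulate (φ α) f) x‖ₑ) α)
    (le_iSup (fun α => ‖T (modulate (φ α) g) x‖ₑ) α))

lemma maxMod_neg (hT : IsCZOperator T) (hφ : ∀ α, Measurable (φ α)) {f : Eu n → ℂ}
    (hf : MemLp f 2 volume) (x : Eu n) : maxMod T φ (-f) x = maxMod T φ f x := by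
  refine iSup_congr fun α => ?_
  rw [modulate_neg, hT.map_smul _ _ (memLp_modulate (hφ α) hf)]
  simp

lemma maxMod_sub_le (hT : IsCZOperator T) (hφ : ∀ α, Measurable (φ α)) {f g : Eu n → ℂ}
    (hf : MemLp f 2 volume) (hg : MemLp g 2 volume) (x : Eu n) :
    maxMod T φ (f - g) x ≤ maxMod T φ f x + maxMod T φ g x := by
  rw [sub_eq_add_neg, ← maxMod_neg hT hφ hg]
  exact maxMod_add_le hT hφ hf hg.neg x

lemma maxMod_le_add_sub (hT : IsCZOperator T) (hφ : ∀ α, Measurable (φ α)) {f g : Eu n → ℂ}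
    (hf : MemLp f 2 volume) (hg : MemLp g 2 volume) (x : Eu n) :
    maxMod T φ f x ≤ maxMod T φ g x + maxMod T φ (f - g) x := by
  have := maxMod_add_le hT hφ hg (hf.sub hg) x
  rwa [add_sub_cancel] at this

lemma notMem_tsupport_of_le {h : Eu n → ℂ} {x : Eu n} {s : ℝ} (hs : 0 < s)
    (hx : ∀ y, h y ≠ 0 → s ≤ ‖x - y‖) : x ∉ tsupport h := by
  rw [notMem_tsupport_iff_eventuallyEq]
  filter_upwards [Metric.ball_mem_nhds x hs] with y hy
  by_contra hne
  rw [mem_ball_iff_norm'] at hy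
  exact absurd (hx y hne) (not_le.2 hy)

/-- Off the support of `h` the maximal modulation is bounded through the kernel. -/
lemma maxMod_le_lintegral {K : Eu n → Eu n → ℂ} (hφ : ∀ α, Measurable (φ α))
    (hrep : ∀ f, MemLp f 2 volume → ∀ x, x ∉ tsupport f → T f x = ∫ y, K x y * f y)
    {h : Eu n → ℂ} (hh : MemLp h 2 volume) {x : Eu n} {s : ℝ} (hs : 0 < s)
    (hx : ∀ y, h y ≠ 0 → s ≤ ‖x - y‖) :
    maxMod T φ h x ≤ ∫⁻ y, ‖K x y‖ₑ * ‖h y‖ₑ := by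
  refine iSup_le fun α => ?_
  rw [hrep _ (memLp_modulate (hφ α) hh) x (notMem_tsupport_of_le hs fun y hy =>
    hx y (mt modulate_eq_zero.2 hy))]
  refine (enorm_integral_le_lintegral_enorm _).trans (le_of_eq ?_)
  simp_rw [enorm_mul, enorm_modulate]

/-- Off the support of `h` the oscillation of the maximal modulation is bounded by that of the
kernel. -/
lemma maxMod_le_add_lintegral {K : Eu n → Eu n → ℂ} (hK : IsCZKernel K)
    (hφ : ∀ α, Measurable (φ α))
    (hrep : ∀ f, MemLp f 2 volume → ∀ x, x ∉ tsupport f → T f x = ∫ y, K x y * f y)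
    {h : Eu n → ℂ} (hh : MemLp h 2 volume) (hint : Integrable h volume) {x x' : Eu n} {s : ℝ}
    (hs : 0 < s) (hx : ∀ y, h y ≠ 0 → s ≤ ‖x - y‖) (hx' : ∀ y, h y ≠ 0 → s ≤ ‖x' - y‖) :
    maxMod T φ h x ≤ maxMod T φ h x' + ∫⁻ y, ‖K x y - K x' y‖ₑ * ‖h y‖ₑ := by
  refine iSup_le fun α => ?_
  have hm := memLp_modulate (hφ α) hh
  have hmi : Integrable (modulate (φ α) h) volume :=
    hint.mono (aestronglyMeasurable_modulate (hφ α) hint.1)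
      (ae_of_all _ fun x => (norm_modulate _ _ x).le)
  have hmx : ∀ y, modulate (φ α) h y ≠ 0 → s ≤ ‖x - y‖ := fun y hy =>
    hx y (mt modulate_eq_zero.2 hy)
  have hmx' : ∀ y, modulate (φ α) h y ≠ 0 → s ≤ ‖x' - y‖ := fun y hy =>
    hx' y (mt modulate_eq_zero.2 hy)
  have hdiff : T (modulate (φ α) h) x =
      T (modulate (φ α) h) x' + ∫ y, (K x y - K x' y) * modulate (φ α) h y := by
    rw [hrep _ hm x (notMem_tsupport_of_le hs hmx), hrep _ hm x' (notMem_tsupport_of_le hs hmx')]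
    simp_rw [sub_mul]
    rw [integral_sub (hK.integrable_mul hs hmi hmx) (hK.integrable_mul hs hmi hmx')]
    ring
  rw [hdiff]
  refine (enorm_add_le _ _).trans (add_le_add
    (le_iSup (fun α => ‖T (modulate (φ α) h) x'‖ₑ) α) ?_)
  -- Modulation leaves |h| unchanged, so this bound is the same for all α and survives the supremum.
  refine (enorm_integral_le_lintegral_enorm _).trans (le_of_eq ?_)
  simp_rw [enorm_mul, enorm_modulate]

end MaxMod

/-! ### Local averages and the sparse step -/

section SparseStep

variable {n : ℕ} {ι : Type*} {T : (Eu n → ℂ) → Eu n → ℂ} {φ : ι → Eu n → ℝ}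

/-- The `L^r` average over the triple of a dyadic cube. -/
def avg (r : ℝ) (a : Eu n) (ℓ : ℝ) (f : Eu n → ℂ) (Q : Idx n) : ℝ≥0∞ :=
  ((volume (dtriple a ℓ Q))⁻¹ * ∫⁻ y in dtriple a ℓ Q, ‖f y‖ₑ ^ r) ^ (1 / r)

/-- The function cut off to the triple of a dyadic cube. -/
def loc (a : Eu n) (ℓ : ℝ) (f : Eu n → ℂ) (Q : Idx n) : Eu n → ℂ := (dtriple a ℓ Q).indicator f

variable {a : Eu n} {ℓ r : ℝ} {f : Eu n → ℂ}

lemma avg_rpow (hr : 0 < r) (Q : Idx n) : avg r a ℓ f Q ^ r =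
    (volume (dtriple a ℓ Q))⁻¹ * ∫⁻ y in dtriple a ℓ Q, ‖f y‖ₑ ^ r := by
  rw [avg, ← ENNReal.rpow_mul, one_div_mul_cancel hr.ne', ENNReal.rpow_one]

lemma lintegral_eq_avg_rpow (hℓ : 0 < ℓ) (hr : 0 < r) (Q : Idx n) :
    ∫⁻ y in dtriple a ℓ Q, ‖f y‖ₑ ^ r = volume (dtriple a ℓ Q) * avg r a ℓ f Q ^ r := by
  rw [avg_rpow hr, ← mul_assoc, ENNReal.mul_inv_cancel (volume_dtriple_ne_zero hℓ Q)
    (volume_dtriple_ne_top Q), one_mul]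

lemma memLp_loc {q : ℝ≥0∞} (hf : MemLp f q volume) (Q : Idx n) : MemLp (loc a ℓ f Q) q volume :=
  hf.indicator (measurableSet_dtriple a ℓ Q)

lemma eLpNorm_loc (hℓ : 0 < ℓ) (hr : 0 < r) (Q : Idx n) :
    eLpNorm (loc a ℓ f Q) (ENNReal.ofReal r) volume =
      avg r a ℓ f Q * volume (dtriple a ℓ Q) ^ (1 / r) := by
  rw [loc, eLpNorm_indicator_eq_eLpNorm_restrict (measurableSet_dtriple a ℓ Q),
    eLpNorm_eq_lintegral_rpow_enorm_toReal (by simpa using hr) ENNReal.ofReal_ne_top,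
    ENNReal.toReal_ofReal hr.le, lintegral_eq_avg_rpow hℓ hr,
    ENNReal.mul_rpow_of_nonneg _ _ (by positivity), ← ENNReal.rpow_mul, mul_one_div_cancel hr.ne',
    ENNReal.rpow_one, mul_comm]

lemma memLp_loc_rpow (hℓ : 0 < ℓ) (hr : 0 < r) (hf : AEStronglyMeasurable f volume) {Q : Idx n}
    (hQ : avg r a ℓ f Q ≠ ∞) : MemLp (loc a ℓ f Q) (ENNReal.ofReal r) volume := by
  refine ⟨hf.indicator (measurableSet_dtriple a ℓ Q), ?_⟩
  rw [eLpNorm_loc hℓ hr]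
  exact ENNReal.mul_lt_top hQ.lt_top
    (ENNReal.rpow_lt_top_of_nonneg (by positivity) (volume_dtriple_ne_top Q))

lemma average_le_avg (hℓ : 0 < ℓ) (hr : 1 < r) (hf : AEStronglyMeasurable f volume) (Q : Idx n) :
    (volume (dtriple a ℓ Q))⁻¹ * ∫⁻ y in dtriple a ℓ Q, ‖f y‖ₑ ≤ avg r a ℓ f Q := by
  have hr0 : 0 < r := by linarith
  rw [ENNReal.inv_mul_le_iff (volume_dtriple_ne_zero hℓ Q) (volume_dtriple_ne_top Q)]
  have h := ENNReal.lintegral_mul_le_Lp_mul_Lq (volume.restrict (dtriple a ℓ Q))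
    (Real.HolderConjugate.conjExponent hr) (f := fun y => ‖f y‖ₑ) (g := fun _ => 1)
    hf.restrict.enorm aemeasurable_const
  simp only [Pi.mul_apply, mul_one, ENNReal.one_rpow, lintegral_one,
    Measure.restrict_apply_univ] at h
  refine h.trans (le_of_eq ?_)
  rw [lintegral_eq_avg_rpow hℓ hr0, ENNReal.mul_rpow_of_nonneg _ _ (by positivity),
    ← ENNReal.rpow_mul, mul_one_div_cancel hr0.ne', ENNReal.rpow_one, mul_right_comm,
    ← ENNReal.rpow_add _ _ (volume_dtriple_ne_zero hℓ Q) (volume_dtriple_ne_top Q), one_div,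
    one_div, (Real.HolderConjugate.conjExponent hr).inv_add_inv_eq_one, ENNReal.rpow_one]

/-- Chebyshev form of the weak-type inequality: f 1_{3Q} has `L^r` norm equal to its average times
|3Q|^{1/r}, so the set above the level c · average has measure at most (ψ(r)/c)^r |3Q|. -/
lemma exists_volume_avg_lt_maxMod_le {r₀ : ℝ} {ψ : ℝ → ℝ≥0} (hwt : WeakTypeBounds T φ r₀ ψ)
    (hr : 1 < r) (hr₀ : r ≤ r₀) {η : ℝ≥0} (hη : 0 < η) :
    ∃ c : ℝ≥0, ∀ (a : Eu n) (ℓ : ℝ), 0 < ℓ → ∀ f : Eu n → ℂ, MemLp f 2 volume → ∀ Q : Idx n,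
      avg r a ℓ f Q ≠ ∞ →
      volume {x | c * avg r a ℓ f Q < maxMod T φ (loc a ℓ f Q) x} ≤
        η * volume (dtriple a ℓ Q) := by
  have hr0 : 0 < r := by linarith
  -- Makes ψ(r)^r ≤ η c^r; the summand 1 keeps c positive even if ψ(r) = 0.
  set c : ℝ≥0 := (η⁻¹) ^ (1 / r) * ψ r + 1 with hc
  refine ⟨c, fun a ℓ hℓ f hf Q hQ => ?_⟩
  have hw := (hwt r hr hr₀ (loc a ℓ f Q) (memLp_loc hf Q) (memLp_loc_rpow hℓ hr0 hf.1 hQ)).2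
  rw [eLpNorm_loc hℓ hr0] at hw
  set V := volume (dtriple a ℓ Q) with hV
  set A := avg r a ℓ f Q with hA
  have hw' : ∀ t : ℝ≥0, (t : ℝ≥0∞) ^ r * volume {x | (t : ℝ≥0∞) < maxMod T φ (loc a ℓ f Q) x} ≤
      (ψ r : ℝ≥0∞) ^ r * A ^ r * V := by
    intro t
    have h1 := (le_iSup (fun t : ℝ≥0 => (t : ℝ≥0∞) *
      volume {x | (t : ℝ≥0∞) < maxMod T φ (loc a ℓ f Q) x} ^ (1 / r)) t).trans hw
    have h2 := ENNReal.rpow_le_rpow h1 hr0.le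
    rwa [ENNReal.mul_rpow_of_nonneg _ _ hr0.le, ENNReal.mul_rpow_of_nonneg _ _ hr0.le,
      ENNReal.mul_rpow_of_nonneg _ _ hr0.le, ← ENNReal.rpow_mul, ← ENNReal.rpow_mul,
      one_div_mul_cancel hr0.ne', ENNReal.rpow_one, ENNReal.rpow_one, ← mul_assoc] at h2
  -- For a zero average the level c · A carries no information; the levels 1/(k+1) show that the
  -- operator vanishes almost everywhere.
  rcases eq_or_ne A 0 with h0 | h0
  · have hnull : ∀ k : ℕ, volume {x | (((1 / ((k : ℝ≥0) + 1) : ℝ≥0)) : ℝ≥0∞) <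
        maxMod T φ (loc a ℓ f Q) x} = 0 := by
      intro k
      have h3 := hw' (1 / ((k : ℝ≥0) + 1))
      rw [h0, ENNReal.zero_rpow_of_pos hr0, mul_zero, zero_mul, nonpos_iff_eq_zero,
        mul_eq_zero] at h3
      refine h3.resolve_left ?_
      simp [hr0]
    rw [measure_mono_null (fun x hx => ?_) (measure_iUnion_null hnull)]
    · exact zero_le
    · have hx' : 0 < maxMod T φ (loc a ℓ f Q) x := by
        have : (c : ℝ≥0∞) * A < maxMod T φ (loc a ℓ f Q) x := hx
        rwa [h0, mul_zero] at this
      obtain ⟨e, he0, he⟩ := ENNReal.lt_iff_exists_nnreal_btwn.1 hx'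
      obtain ⟨k, hk⟩ := exists_nat_one_div_lt (K := ℝ≥0) (show 0 < e by exact_mod_cast he0)
      exact Set.mem_iUnion.2 ⟨k, lt_trans (ENNReal.coe_lt_coe.2 hk) he⟩
  · have h4 := hw' (c * A.toNNReal)
    rw [ENNReal.coe_mul, ENNReal.coe_toNNReal hQ, ENNReal.mul_rpow_of_nonneg _ _ hr0.le] at h4
    set E := volume {x | (c : ℝ≥0∞) * A < maxMod T φ (loc a ℓ f Q) x} with hE
    have hAr0 : A ^ r ≠ 0 := by simp [h0, hr0.le]
    have hArt : A ^ r ≠ ∞ := ENNReal.rpow_ne_top_of_nonneg hr0.le hQ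
    have h5 : (c : ℝ≥0∞) ^ r * E ≤ (ψ r : ℝ≥0∞) ^ r * V := by
      refine (ENNReal.mul_le_mul_iff_right hAr0 hArt).1 ?_
      calc A ^ r * ((c : ℝ≥0∞) ^ r * E) = (c : ℝ≥0∞) ^ r * A ^ r * E := by ring
        _ ≤ _ := h4
        _ = A ^ r * ((ψ r : ℝ≥0∞) ^ r * V) := by ring
    have h6 : (ψ r : ℝ≥0∞) ^ r ≤ η * (c : ℝ≥0∞) ^ r := by
      have : (ψ r) ^ r ≤ η * c ^ r := by
        calc (ψ r) ^ r = η * ((η⁻¹) ^ (1 / r) * ψ r) ^ r := by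
              rw [NNReal.mul_rpow, ← NNReal.rpow_mul, one_div_mul_cancel hr0.ne', NNReal.rpow_one,
                ← mul_assoc, mul_inv_cancel₀ hη.ne', one_mul]
          _ ≤ η * c ^ r := by
              gcongr
              exact le_self_add
      rw [← ENNReal.coe_rpow_of_nonneg _ hr0.le, ← ENNReal.coe_rpow_of_nonneg _ hr0.le]
      exact_mod_cast this
    have hc0 : (c : ℝ≥0∞) ^ r ≠ 0 := by
      have : (c : ℝ≥0∞) ≠ 0 := by exact_mod_cast (by positivity : c ≠ 0)
      simp [this]
    have hct : (c : ℝ≥0∞) ^ r ≠ ∞ := ENNReal.rpow_ne_top_of_nonneg hr0.le ENNReal.coe_ne_top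
    refine (ENNReal.mul_le_mul_iff_right hc0 hct).1 ?_
    calc (c : ℝ≥0∞) ^ r * E ≤ (ψ r : ℝ≥0∞) ^ r * V := h5
      _ ≤ η * (c : ℝ≥0∞) ^ r * V := by gcongr
      _ = (c : ℝ≥0∞) ^ r * (η * V) := by ring

/-- The subcubes whose average is much larger than that of `Q` cover little of `Q`. -/
lemma volume_biUnion_avg_lt_le (n : ℕ) (hr : 0 < r) {η : ℝ≥0} (hη : 0 < η) :
    ∃ c : ℝ≥0, ∀ (a : Eu n) (ℓ : ℝ), 0 < ℓ → ∀ (f : Eu n → ℂ) (Q : Idx n),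
      avg r a ℓ f Q ≠ ∞ →
      volume (⋃ P ∈ {P : Idx n | Q.1 ≤ P.1 ∧ dcube a ℓ P ⊆ dcube a ℓ Q ∧
        c * avg r a ℓ f Q < avg r a ℓ f P}, dcube a ℓ P) ≤ η * volume (dtriple a ℓ Q) := by
  -- Chosen so that η c^r equals the constant 5^n of the covering inequality.
  set c : ℝ≥0 := (η⁻¹ * 5 ^ n) ^ (1 / r) with hc
  have hcr : η * c ^ r = 5 ^ n := by
    rw [hc, ← NNReal.rpow_mul, one_div_mul_cancel hr.ne', NNReal.rpow_one, ← mul_assoc,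
      mul_inv_cancel₀ hη.ne', one_mul]
  have hcr' : (η : ℝ≥0∞) * (c : ℝ≥0∞) ^ r = 5 ^ n := by
    rw [← ENNReal.coe_rpow_of_nonneg _ hr.le]
    exact_mod_cast hcr
  have hc0 : c ≠ 0 := by positivity
  refine ⟨c, fun a ℓ hℓ f Q hQ => ?_⟩
  set t := {P : Idx n | Q.1 ≤ P.1 ∧ dcube a ℓ P ⊆ dcube a ℓ Q ∧
        c * avg r a ℓ f Q < avg r a ℓ f P} with ht
  set A := avg r a ℓ f Q with hA
  set V := volume (dtriple a ℓ Q) with hV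
  set h : Eu n → ℝ≥0∞ := (dtriple a ℓ Q).indicator (fun y => ‖f y‖ₑ ^ r) with hh
  have hsub : ∀ P ∈ t, dtriple a ℓ P ⊆ dtriple a ℓ Q := fun P hP => dtriple_subset hℓ hP.1 hP.2.1
  have hloc : ∀ P ∈ t, ∫⁻ y in dtriple a ℓ P, h y = ∫⁻ y in dtriple a ℓ P, ‖f y‖ₑ ^ r :=
    fun P hP => setLIntegral_congr_fun (measurableSet_dtriple a ℓ P) fun y hy =>
      Set.indicator_of_mem (hsub P hP hy) _
  rcases eq_or_ne A 0 with h0 | h0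
  · have : t = ∅ := by
      refine Set.eq_empty_iff_forall_notMem.2 fun P hP => ?_
      have h1 : ∫⁻ y in dtriple a ℓ P, ‖f y‖ₑ ^ r = 0 := by
        refine le_antisymm ((lintegral_mono_set (hsub P hP)).trans ?_) zero_le
        rw [lintegral_eq_avg_rpow hℓ hr, ← hA, h0, ENNReal.zero_rpow_of_pos hr, mul_zero]
      have h2 := hP.2.2
      rw [← hA, h0, mul_zero, avg, h1, mul_zero, ENNReal.zero_rpow_of_pos (by positivity)] at h2
      exact absurd h2 (lt_irrefl _)
    simp [this]
  · have h1 := mul_volume_biUnion_dcube_le hℓ t h ((c * A) ^ r) fun P hP => by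
      rw [hloc P hP, lintegral_eq_avg_rpow hℓ hr, mul_comm]
      gcongr
      exact hP.2.2.le
    rw [hh, lintegral_indicator (measurableSet_dtriple a ℓ Q), lintegral_eq_avg_rpow hℓ hr, ← hA,
      ← hV, ENNReal.mul_rpow_of_nonneg _ _ hr.le] at h1
    have hcA0 : (c : ℝ≥0∞) ^ r * A ^ r ≠ 0 := by simp [h0, hr.le, hc0]
    have hcAt : (c : ℝ≥0∞) ^ r * A ^ r ≠ ∞ := ENNReal.mul_ne_top
      (ENNReal.rpow_ne_top_of_nonneg hr.le ENNReal.coe_ne_top)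
      (ENNReal.rpow_ne_top_of_nonneg hr.le hQ)
    refine (ENNReal.mul_le_mul_iff_right hcA0 hcAt).1 (h1.trans (le_of_eq ?_))
    rw [← hcr']
    ring

lemma two_pow_lt_two_pow {j k : ℕ} (h : j < k) : (2 : ℝ≥0∞) ^ j < 2 ^ k := by
  exact_mod_cast pow_lt_pow_right₀ (by norm_num : (1 : ℕ) < 2) h

/-- One step of the sparse domination: on `Q` the localized operator is bounded by the average
over `3Q`, up to the localized operators of disjoint subcubes that fill at most half of `Q`. -/
theorem exists_sparse_step (hT : IsCZOperator T) (hφ : ∀ α, Measurable (φ α)) {r₀ : ℝ}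
    {ψ : ℝ → ℝ≥0} (hwt : WeakTypeBounds T φ r₀ ψ) (hr : 1 < r) (hr₀ : r ≤ r₀) :
    ∃ C : ℝ≥0, ∀ (a : Eu n) (ℓ : ℝ), 0 < ℓ → ∀ f : Eu n → ℂ, MemLp f 2 volume →
      (∀ Q, avg r a ℓ f Q ≠ ∞) → ∀ Q : Idx n, ∃ S : Set (Idx n),
        (∀ P ∈ S, dcube a ℓ P ⊆ dcube a ℓ Q) ∧ S.PairwiseDisjoint (dcube a ℓ) ∧
        ∑' P : S, volume (dcube a ℓ P.1) ≤ 1 / 2 * volume (dcube a ℓ Q) ∧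
        ∀ x ∈ dcube a ℓ Q, maxMod T φ (loc a ℓ f Q) x ≤ C * avg r a ℓ f Q +
          ∑' P : S, (dcube a ℓ P.1).indicator
            (fun x => maxMod T φ (loc a ℓ f P) x + C * avg r a ℓ f P) x := by
  have hr0 : 0 < r := by linarith
  obtain ⟨K, hK, hrep⟩ := hT.kernel
  obtain ⟨C₁, hC₁⟩ := hK.exists_lintegral_osc_le
  -- With this η, η|3P| = 2^{−(n+4)}|P|. The two bad sets together then fill at most 2^{−(n+3)}|Q|,
  -- strictly less than the 2^{−(n+2)}|Q| allowed for stopping cubes, which leaves room for an open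
  -- superset.
  set η : ℝ≥0 := (3 ^ n * 2 ^ (n + 4))⁻¹ with hη
  have hηpos : 0 < η := by positivity
  obtain ⟨c₁, hc₁⟩ := exists_volume_avg_lt_maxMod_le hwt hr hr₀ hηpos
  obtain ⟨c₂, hc₂⟩ := volume_biUnion_avg_lt_le n hr0 hηpos
  refine ⟨2 * c₁ + C₁ * c₂, fun a ℓ hℓ f hf hfin Q => ?_⟩
  set A : Idx n → ℝ≥0∞ := avg r a ℓ f with hA
  set M : Idx n → Eu n → ℝ≥0∞ := fun Q => maxMod T φ (loc a ℓ f Q) with hM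
  have hηvol : ∀ P : Idx n, η * volume (dtriple a ℓ P) =
      (2 ^ (n + 4))⁻¹ * volume (dcube a ℓ P) := by
    intro P
    rw [volume_dtriple, ← mul_assoc]
    congr 1
    have h1 : η * 3 ^ n = (2 ^ (n + 4))⁻¹ := by
      have : (3 : ℝ≥0) ^ n ≠ 0 := by positivity
      rw [hη]
      field_simp
    have h2 := congrArg (fun t : ℝ≥0 => (t : ℝ≥0∞)) h1
    simp only [ENNReal.coe_mul, ENNReal.coe_inv
      (show (2 : ℝ≥0) ^ (n + 4) ≠ 0 by positivity)] at h2
    push_cast at h2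
    exact h2
  set E₁ : Set (Eu n) := {x | c₁ * A Q < M Q x} with hE₁
  set E₂ : Set (Eu n) := ⋃ P ∈ {P : Idx n | Q.1 ≤ P.1 ∧ dcube a ℓ P ⊆ dcube a ℓ Q ∧
        c₂ * A Q < A P}, dcube a ℓ P with hE₂
  have hE : volume (E₁ ∪ E₂) < (2 ^ (n + 2))⁻¹ * volume (dcube a ℓ Q) := by
    calc volume (E₁ ∪ E₂) ≤ volume E₁ + volume E₂ := measure_union_le _ _
      _ ≤ (2 ^ (n + 4))⁻¹ * volume (dcube a ℓ Q) + (2 ^ (n + 4))⁻¹ * volume (dcube a ℓ Q) := by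
          rw [← hηvol]
          exact add_le_add (hc₁ a ℓ hℓ f hf Q (hfin Q)) (hc₂ a ℓ hℓ f Q (hfin Q))
      _ = (2 ^ (n + 3))⁻¹ * volume (dcube a ℓ Q) := by
          rw [← add_mul, pow_succ 2 (n + 3), ENNReal.mul_inv (by simp) (by simp), ← mul_add,
            ENNReal.inv_two_add_inv_two, mul_one]
      _ < (2 ^ (n + 2))⁻¹ * volume (dcube a ℓ Q) := by
          refine ENNReal.mul_lt_mul_left (volume_dcube_ne_zero hℓ Q) (volume_dcube_ne_top Q) ?_
          rw [ENNReal.inv_lt_inv]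
          exact two_pow_lt_two_pow (by omega)
  obtain ⟨U, hEU, hUo, hUvol⟩ := Set.exists_isOpen_lt_of_lt _ _ hE
  obtain ⟨S, hS1, hS2, hS3, hS4, hS5, hS6⟩ := exists_stopping_cubes hℓ Q hUo hUvol.le
  refine ⟨S, fun P hP => (hS1 P hP).2, hS2, hS3, fun x hx => ?_⟩
  have hgood : ∀ y, y ∉ U → M Q y ≤ c₁ * A Q := fun y hy =>
    not_lt.1 fun hcon => hy (hEU (Or.inl hcon))
  by_cases hxU : x ∈ U
  swap
  · refine le_add_right ((hgood x hxU).trans ?_)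
    gcongr
    norm_cast
    rw [two_mul, add_assoc]
    exact le_self_add
  obtain ⟨P, hP, hxP⟩ := hS5 x hx hxU
  obtain ⟨hQP, hPQ⟩ := hS1 P hP
  have htri : dtriple a ℓ P ⊆ dtriple a ℓ Q := dtriple_subset hℓ hQP.le hPQ
  -- U takes at most half of P and the bad set of P at most 2^{−(n+4)}|P|, so some point of P avoids
  -- both.
  obtain ⟨x', hx'P, hx'U, hx'M⟩ : ∃ x' ∈ dcube a ℓ P, x' ∉ U ∧ M P x' ≤ c₁ * A P := by
    by_contra! hcon
    have hsub : dcube a ℓ P ⊆ (dcube a ℓ P ∩ U) ∪ {y | c₁ * A P < M P y} := fun y hy => by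
      by_cases hyU : y ∈ U
      · exact Or.inl ⟨hy, hyU⟩
      · exact Or.inr (hcon y hy hyU)
    have h1 : volume (dcube a ℓ P) ≤
        (1 / 2 + (2 ^ (n + 4))⁻¹) * volume (dcube a ℓ P) := by
      rw [add_mul, ← hηvol]
      exact (measure_mono hsub).trans ((measure_union_le _ _).trans
        (add_le_add (hS4 P hP) (hc₁ a ℓ hℓ f hf P (hfin P))))
    have h2 : (1 / 2 + (2 ^ (n + 4))⁻¹ : ℝ≥0∞) < 1 := by
      calc (1 / 2 + (2 ^ (n + 4))⁻¹ : ℝ≥0∞) < 1 / 2 + 1 / 2 := by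
            refine ENNReal.add_lt_add_left (by norm_num) ?_
            rw [one_div, ENNReal.inv_lt_inv]
            simpa using two_pow_lt_two_pow (show 1 < n + 4 by omega)
        _ = 1 := ENNReal.add_halves 1
    have h3 := ENNReal.mul_lt_mul_left (volume_dcube_ne_zero (a := a) hℓ P)
      (volume_dcube_ne_top P) h2
    rw [one_mul] at h3
    exact absurd h1 (not_le.2 h3)
  set h : Eu n → ℂ := loc a ℓ f Q - loc a ℓ f P with hh
  have hL2Q : MemLp (loc a ℓ f Q) 2 volume := memLp_loc hf Q
  have hL2P : MemLp (loc a ℓ f P) 2 volume := memLp_loc hf P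
  have hL2 : MemLp h 2 volume := hL2Q.sub hL2P
  have hval : h = (dtriple a ℓ Q \ dtriple a ℓ P).indicator f := by
    rw [hh, loc, loc, Set.indicator_sdiff htri]
  have hLint : ∀ R : Idx n, Integrable (loc a ℓ f R) volume := by
    intro R
    have hmem : MemLp f 2 (volume.restrict (dtriple a ℓ R)) := hf.restrict _
    have : IsFiniteMeasure ((volume : Measure (Eu n)).restrict (dtriple a ℓ R)) :=
      ⟨by rw [Measure.restrict_apply_univ]; exact (volume_dtriple_ne_top R).lt_top⟩
    exact (integrable_indicator_iff (measurableSet_dtriple a ℓ R)).2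
      (hmem.integrable (by norm_num))
  have hint : Integrable h volume := (hLint Q).sub (hLint P)
  have hsep : ∀ z ∈ dcube a ℓ P, ∀ y, h y ≠ 0 → dside ℓ P ≤ ‖z - y‖ := by
    intro z hz y hy
    refine le_norm_sub_of_notMem_tripleCube hz fun hyP => hy ?_
    rw [hval, Set.indicator_of_notMem]
    exact fun hmem => hmem.2 hyP
  have hosc : ∫⁻ y, ‖K x y - K x' y‖ₑ * ‖h y‖ₑ ≤ C₁ * (c₂ * A Q) := by
    refine le_trans (le_of_eq ?_) (hC₁ a ℓ hℓ P Q hQP.le hPQ (fun y => ‖f y‖ₑ) hf.1.enorm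
      (c₂ * A Q) (fun R hQR hRP hPR => ?_) x hxP x' hx'P)
    · rw [← lintegral_indicator ((measurableSet_dtriple a ℓ Q).diff (measurableSet_dtriple a ℓ P))]
      refine lintegral_congr fun y => ?_
      rw [hval]
      by_cases hy : y ∈ dtriple a ℓ Q \ dtriple a ℓ P
      · rw [Set.indicator_of_mem hy, Set.indicator_of_mem hy]
      · rw [Set.indicator_of_notMem hy, Set.indicator_of_notMem hy]; simp
    -- An ancestor R whose average exceeded c₂ · A Q would lie inside E₂ ⊆ U, which the stopping
    -- construction excludes.
    · refine (average_le_avg hℓ hr hf.1 R).trans (not_lt.1 fun hcon => ?_)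
      refine hS6 P hP R hQR hRP hPR (Set.Subset.trans ?_ hEU)
      have hRQ : dcube a ℓ R ⊆ dcube a ℓ Q :=
        dcube_subset_of_mem hℓ hQR (hPQ hxP) (hPR hxP)
      exact (Set.subset_biUnion_of_mem (u := dcube a ℓ)
        (show R ∈ {P : Idx n | Q.1 ≤ P.1 ∧ dcube a ℓ P ⊆ dcube a ℓ Q ∧ c₂ * A Q < A P} from
          ⟨hQR, hRQ, hcon⟩)).trans Set.subset_union_right
  have hhx : maxMod T φ h x ≤ c₁ * A Q + c₁ * A P + C₁ * (c₂ * A Q) :=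
    (maxMod_le_add_lintegral hK hφ hrep hL2 hint (dside_pos hℓ P) (hsep x hxP)
      (hsep x' hx'P)).trans (add_le_add ((maxMod_sub_le hT hφ hL2Q hL2P x').trans
        (add_le_add (hgood x' hx'U) hx'M)) hosc)
  have hfinal : M Q x ≤ M P x + (c₁ * A Q + c₁ * A P + C₁ * (c₂ * A Q)) :=
    (maxMod_le_add_sub hT hφ hL2Q hL2P x).trans (add_le_add le_rfl hhx)
  have hterm : M P x + ((2 * c₁ + C₁ * c₂ : ℝ≥0) : ℝ≥0∞) * A P ≤
      ∑' P : S, (dcube a ℓ P.1).indicator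
        (fun x => M P x + ((2 * c₁ + C₁ * c₂ : ℝ≥0) : ℝ≥0∞) * A P) x := by
    refine le_trans (le_of_eq ?_) (ENNReal.le_tsum (⟨P, hP⟩ : S))
    rw [Set.indicator_of_mem hxP]
  refine hfinal.trans ?_
  calc M P x + (c₁ * A Q + c₁ * A P + C₁ * (c₂ * A Q))
      ≤ ((2 * c₁ + C₁ * c₂ : ℝ≥0) : ℝ≥0∞) * A Q +
        (M P x + ((2 * c₁ + C₁ * c₂ : ℝ≥0) : ℝ≥0∞) * A P) := by
        push_cast
        have e : (2 * (c₁ : ℝ≥0∞) + C₁ * c₂) * A Q + (M P x + (2 * (c₁ : ℝ≥0∞) + C₁ * c₂) * A P) =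
          M P x + (c₁ * A Q + c₁ * A P + C₁ * (c₂ * A Q)) +
            (c₁ * A Q + c₁ * A P + C₁ * c₂ * A P) := by ring
        rw [e]
        exact le_self_add
    _ ≤ _ := by gcongr

end SparseStep

/-! ### Iterated sparse sums -/

section SparseSum

variable {n : ℕ} {a : Eu n} {ℓ : ℝ}

/-- The first `N` generations of the sparse sum generated by `Q`. -/
def sparseSum (a : Eu n) (ℓ : ℝ) (child : Idx n → Set (Idx n)) (A : Idx n → ℝ≥0∞) :
    ℕ → Idx n → Eu n → ℝ≥0∞
  | 0, _, _ => 0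
  | N + 1, Q, x => (dcube a ℓ Q).indicator (fun _ => A Q) x +
      ∑' P : child Q, sparseSum a ℓ child A N P x

variable {child : Idx n → Set (Idx n)} {A : Idx n → ℝ≥0∞}

lemma measurable_sparseSum (N : ℕ) (Q : Idx n) : Measurable (sparseSum a ℓ child A N Q) := by
  induction N generalizing Q with
  | zero => exact measurable_const
  | succ N ih =>
    exact (measurable_const.indicator (measurableSet_dcube a ℓ Q)).add
      (Measurable.tsum fun P => ih P)

lemma sparseSum_le_succ (N : ℕ) (Q : Idx n) (x : Eu n) :
    sparseSum a ℓ child A N Q x ≤ sparseSum a ℓ child A (N + 1) Q x := by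
  induction N generalizing Q with
  | zero => exact zero_le
  | succ N ih => exact add_le_add le_rfl (ENNReal.tsum_le_tsum fun P => ih P)

/-- Iterating a one-step domination bounds `G` by the sparse sum almost everywhere. -/
lemma ae_le_iSup_sparseSum
    (hhalf : ∀ Q, ∑' P : child Q, volume (dcube a ℓ P.1) ≤ 1 / 2 * volume (dcube a ℓ Q))
    {G : Idx n → Eu n → ℝ≥0∞} (hG : ∀ Q, ∀ x ∉ dcube a ℓ Q, G Q x = 0) {C : ℝ≥0∞}
    (hstep : ∀ Q, ∀ x ∈ dcube a ℓ Q, G Q x ≤ C * A Q + ∑' P : child Q, G P x) (Q : Idx n) :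
    ∀ᵐ x, G Q x ≤ C * ⨆ N, sparseSum a ℓ child A N Q x := by
  set X : ℕ → Idx n → Set (Eu n) := fun N Q =>
    {x | x ∈ dcube a ℓ Q ∧ ¬ G Q x ≤ C * sparseSum a ℓ child A N Q x} with hX
  -- A point where the bound by N + 1 generations fails on Q lies in a child on which the bound by N
  -- generations fails, and the children fill at most half of Q.
  have hvol : ∀ N Q, volume (X N Q) ≤ (1 / 2) ^ N * volume (dcube a ℓ Q) := by
    intro N
    induction N with
    | zero => exact fun Q => by simpa using measure_mono fun x hx => hx.1
    | succ N ih =>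
      intro Q
      have hsub : X (N + 1) Q ⊆ ⋃ P ∈ child Q, X N P := by
        rintro x ⟨hxQ, hx⟩
        by_contra hcon
        simp only [Set.mem_iUnion, not_exists] at hcon
        refine hx ((hstep Q x hxQ).trans ?_)
        rw [sparseSum, Set.indicator_of_mem hxQ, mul_add, ← ENNReal.tsum_mul_left]
        refine add_le_add le_rfl (ENNReal.tsum_le_tsum fun P => ?_)
        by_cases hxP : x ∈ dcube a ℓ P.1
        · by_contra hP
          exact hcon P.1 P.2 ⟨hxP, hP⟩
        · rw [hG _ x hxP]; exact zero_le
      calc volume (X (N + 1) Q) ≤ ∑' P : child Q, volume (X N P) :=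
            (measure_mono hsub).trans (measure_biUnion_le _ (child Q).to_countable _)
        _ ≤ ∑' P : child Q, (1 / 2) ^ N * volume (dcube a ℓ P.1) :=
            ENNReal.tsum_le_tsum fun P => ih P
        _ ≤ (1 / 2) ^ N * (1 / 2 * volume (dcube a ℓ Q)) := by
            rw [ENNReal.tsum_mul_left]
            gcongr
            exact hhalf Q
        _ = (1 / 2) ^ (N + 1) * volume (dcube a ℓ Q) := by rw [pow_succ, mul_assoc]
  have hlim : Filter.Tendsto (fun N : ℕ => (1 / 2 : ℝ≥0∞) ^ N * volume (dcube a ℓ Q)) Filter.atTop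
      (nhds 0) := by
    have := ENNReal.Tendsto.mul_const (b := volume (dcube a ℓ Q))
      (ENNReal.tendsto_pow_atTop_nhds_zero_of_lt_one (r := (1 / 2 : ℝ≥0∞)) (by
        rw [one_div]; exact ENNReal.inv_lt_one.2 (by norm_num)))
      (Or.inr (volume_dcube_ne_top Q))
    simpa using this
  have hnull : volume {x | ¬ G Q x ≤ C * ⨆ N, sparseSum a ℓ child A N Q x} = 0 := by
    refine le_antisymm (ge_of_tendsto' hlim fun N => ?_) zero_le
    refine (measure_mono fun x hx => ?_).trans (hvol N Q)
    have hx' : ¬ G Q x ≤ C * ⨆ N, sparseSum a ℓ child A N Q x := hx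
    refine ⟨?_, fun hle => hx' (hle.trans (mul_le_mul_right (le_iSup (fun N =>
      sparseSum a ℓ child A N Q x) N) _))⟩
    by_contra hxQ
    exact hx' (by rw [hG _ x hxQ]; exact zero_le)
  exact hnull

/-- The bilinear estimate for sparse sums. -/
lemma lintegral_sparseSum_mul_le
    (hchild : ∀ Q, ∀ P ∈ child Q, dcube a ℓ P ⊆ dcube a ℓ Q)
    (hdisj : ∀ Q, (child Q).PairwiseDisjoint (dcube a ℓ))
    (hhalf : ∀ Q, ∑' P : child Q, volume (dcube a ℓ P.1) ≤ 1 / 2 * volume (dcube a ℓ Q))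
    {w M : Eu n → ℝ≥0∞} (hw : Measurable w) {κ : ℝ≥0∞} {Λ : Idx n → ℝ≥0∞}
    (hΛ : ∀ Q, A Q * ∫⁻ x in dcube a ℓ Q, w x ≤ κ * volume (dcube a ℓ Q) * Λ Q)
    (hM : ∀ Q, ∀ x ∈ dcube a ℓ Q, Λ Q ≤ M x) (N : ℕ) (Q : Idx n) :
    ∫⁻ x, sparseSum a ℓ child A N Q x * w x ≤ 2 * κ * ∫⁻ x in dcube a ℓ Q, M x := by
  induction N generalizing Q with
  | zero => simp [sparseSum]
  | succ N ih =>
    set D : Set (Eu n) := ⋃ P ∈ child Q, dcube a ℓ P with hD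
    have hDm : MeasurableSet D :=
      MeasurableSet.biUnion (child Q).to_countable fun P _ => measurableSet_dcube a ℓ P
    have hDQ : D ⊆ dcube a ℓ Q := Set.iUnion₂_subset (hchild Q)
    have hDvol : volume D ≤ 1 / 2 * volume (dcube a ℓ Q) :=
      (measure_biUnion_le _ (child Q).to_countable _).trans (hhalf Q)
    have hvol : volume (dcube a ℓ Q) ≤ 2 * volume (dcube a ℓ Q \ D) := by
      have h1 : volume (dcube a ℓ Q) ≤
          1 / 2 * volume (dcube a ℓ Q) + volume (dcube a ℓ Q \ D) := by
        conv_lhs => rw [← Set.union_sdiff_cancel hDQ]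
        exact (measure_union_le _ _).trans (add_le_add hDvol le_rfl)
      have h2 : volume (dcube a ℓ Q) =
          1 / 2 * volume (dcube a ℓ Q) + 1 / 2 * volume (dcube a ℓ Q) := by
        rw [← add_mul, ENNReal.add_halves, one_mul]
      conv_lhs at h1 => rw [h2]
      have hfin := volume_dcube_ne_top (a := a) (ℓ := ℓ) Q
      have h3 := (ENNReal.add_le_add_iff_left (by finiteness)).1 h1
      calc volume (dcube a ℓ Q) = 2 * (1 / 2 * volume (dcube a ℓ Q)) := by
            rw [← mul_assoc, one_div, ENNReal.mul_inv_cancel (by norm_num) (by norm_num), one_mul]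
        _ ≤ _ := by gcongr
    -- The term of Q is charged to Q ∖ D alone, at the price of a factor 2. The descendants are
    -- charged to D by induction, so no point is charged twice.
    have hfirst : A Q * ∫⁻ x in dcube a ℓ Q, w x ≤ 2 * κ * ∫⁻ x in dcube a ℓ Q \ D, M x := by
      calc A Q * ∫⁻ x in dcube a ℓ Q, w x ≤ κ * volume (dcube a ℓ Q) * Λ Q := hΛ Q
        _ ≤ κ * (2 * volume (dcube a ℓ Q \ D)) * Λ Q := by gcongr
        _ = 2 * κ * ∫⁻ x in dcube a ℓ Q \ D, Λ Q := by rw [setLIntegral_const]; ring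
        _ ≤ _ := by
          gcongr 2 * κ * ?_
          exact setLIntegral_mono' ((measurableSet_dcube a ℓ Q).diff hDm) fun x hx => hM Q x hx.1
    have hsplit : ∫⁻ x, sparseSum a ℓ child A (N + 1) Q x * w x =
        A Q * (∫⁻ x in dcube a ℓ Q, w x) +
          ∑' P : child Q, ∫⁻ x, sparseSum a ℓ child A N P x * w x := by
      simp only [sparseSum, add_mul]
      rw [lintegral_add_left (f := fun x => (dcube a ℓ Q).indicator (fun _ => A Q) x * w x)
        ((measurable_const.indicator (measurableSet_dcube a ℓ Q)).mul hw)]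
      congr 1
      · rw [← lintegral_const_mul _ hw, ← lintegral_indicator (measurableSet_dcube a ℓ Q)]
        refine lintegral_congr fun x => ?_
        by_cases hx : x ∈ dcube a ℓ Q
        · rw [Set.indicator_of_mem hx, Set.indicator_of_mem hx]
        · rw [Set.indicator_of_notMem hx, Set.indicator_of_notMem hx, zero_mul]
      · simp only [← ENNReal.tsum_mul_right]
        exact lintegral_tsum fun P => ((measurable_sparseSum N P.1).mul hw).aemeasurable
    calc ∫⁻ x, sparseSum a ℓ child A (N + 1) Q x * w x
        ≤ 2 * κ * (∫⁻ x in dcube a ℓ Q \ D, M x) +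
            ∑' P : child Q, 2 * κ * ∫⁻ x in dcube a ℓ P.1, M x := by
          rw [hsplit]
          exact add_le_add hfirst (ENNReal.tsum_le_tsum fun P => ih P)
      _ = 2 * κ * ((∫⁻ x in dcube a ℓ Q \ D, M x) + ∫⁻ x in D, M x) := by
          rw [ENNReal.tsum_mul_left, mul_add, hD, lintegral_biUnion (child Q).to_countable
            (fun P _ => measurableSet_dcube a ℓ P) (hdisj Q)]
      _ = 2 * κ * ∫⁻ x in dcube a ℓ Q, M x := by
          rw [add_comm, ← lintegral_union ((measurableSet_dcube a ℓ Q).diff hDm)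
            Set.disjoint_sdiff_right, Set.union_sdiff_cancel hDQ]

end SparseSum

/-! ### The weighted inequality on cubes -/

section Weighted

variable {n : ℕ}

lemma IsYoung.luxE_ne_zero {A : ℝ≥0 → ℝ≥0} (hA : IsYoung A) {a : Eu n} {ℓ : ℝ} (hℓ : 0 < ℓ)
    {h : Eu n → ℝ≥0} (hh : AEMeasurable h) (hpos : ∀ᵐ y, 0 < h y) :
    luxE (fun t => A t) (cube a ℓ) h ≠ 0 :=
  MaxModCZ.luxE_ne_zero hA.monotone hA.tendsto_atTop (volume_cube_ne_zero a hℓ)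
    (volume_cube_ne_top a ℓ) hh hpos

lemma dcube_zero (a : Eu n) (ℓ : ℝ) : dcube a ℓ (0, 0) = cube a ℓ := by
  have h : dcorner a ℓ (0, 0) = a := by ext i; simp [dcorner]
  rw [dcube, h]; simp [dside]

lemma dtriple_zero (a : Eu n) (ℓ : ℝ) : dtriple a ℓ (0, 0) = tripleCube a ℓ := by
  have h : dcorner a ℓ (0, 0) = a := by ext i; simp [dcorner]
  rw [dtriple, h]; simp [dside]

variable {p r : ℝ} {A B : ℝ≥0 → ℝ≥0} {u v : Eu n → ℝ}

/-- The density `|f| v^{1/p}`, whose `p`-th power has integral `‖f‖_{L^p(v)}^p`. -/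
def density (p : ℝ) (v : Eu n → ℝ) (f : Eu n → ℂ) (x : Eu n) : ℝ≥0 := ‖f x‖₊ * ‖v x ^ (1 / p)‖₊

lemma coe_nnnorm_rpow_rpow {w s q : ℝ} (hw : 0 < w) :
    ((‖w ^ s‖₊ : ℝ≥0) : ℝ≥0∞) ^ q = ENNReal.ofReal (w ^ (s * q)) := by
  have hws : 0 < w ^ s := Real.rpow_pos_of_pos hw s
  rw [← enorm_eq_nnnorm, Real.enorm_eq_ofReal hws.le, ENNReal.ofReal_rpow_of_pos hws,
    ← Real.rpow_mul hw.le]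

lemma density_rpow (hp : 0 < p) (hv : IsPosWeight v) (f : Eu n → ℂ) :
    ∀ᵐ x, (density p v f x : ℝ≥0∞) ^ p = ‖f x‖ₑ ^ p * ENNReal.ofReal (v x) := by
  filter_upwards [hv.pos] with x hx
  rw [density, ENNReal.coe_mul, ENNReal.mul_rpow_of_nonneg _ _ hp.le, coe_nnnorm_rpow_rpow hx,
    one_div_mul_cancel hp.ne', Real.rpow_one, enorm_eq_nnnorm]

/-- The factorization |f|^r = v^{-r/p} · (|f| v^{1/p})^r to which Hölder's inequality for B and B̄
applies. -/
lemma enorm_rpow_eq_mul_density (hr : 0 < r) (hv : IsPosWeight v) (f : Eu n → ℂ) :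
    ∀ᵐ x, ‖f x‖ₑ ^ r = ((‖v x ^ (-r / p)‖₊ : ℝ≥0) : ℝ≥0∞) * ((density p v f x ^ r : ℝ≥0) : ℝ≥0∞) := by
  filter_upwards [hv.pos] with x hx
  have h1 := coe_nnnorm_rpow_rpow (s := -r / p) (q := 1) hx
  rw [ENNReal.rpow_one, mul_one] at h1
  rw [h1, ENNReal.coe_rpow_of_nonneg _ hr.le, density, ENNReal.coe_mul,
    ENNReal.mul_rpow_of_nonneg _ _ hr.le, coe_nnnorm_rpow_rpow hx, mul_left_comm,
    ← ENNReal.ofReal_mul (by positivity), ← Real.rpow_add hx,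
    show -r / p + 1 / p * r = 0 by ring, Real.rpow_zero, ENNReal.ofReal_one, mul_one,
    enorm_eq_nnnorm]

lemma IsPosWeight.aemeasurable_nnnorm_rpow (hv : IsPosWeight v) (s : ℝ) :
    AEMeasurable (fun x => ‖v x ^ s‖₊) volume :=
  (hv.locallyIntegrable.aestronglyMeasurable.aemeasurable.pow_const s).nnnorm

lemma IsPosWeight.ae_nnnorm_rpow_pos (hv : IsPosWeight v) (s : ℝ) :
    ∀ᵐ x, 0 < ‖v x ^ s‖₊ := by
  filter_upwards [hv.pos] with x hx
  rw [nnnorm_pos]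
  exact (Real.rpow_pos_of_pos hx s).ne'

lemma aemeasurable_density (hv : IsPosWeight v) {f : Eu n → ℂ}
    (hf : AEStronglyMeasurable f volume) : AEMeasurable (density p v f) volume :=
  hf.aemeasurable.nnnorm.mul (hv.aemeasurable_nnnorm_rpow _)

/-- Consequences of the bump condition on a single cube. -/
lemma bump_cube (hr : 0 < r) (hA : IsYoung A) (hB : IsYoung B) (hu : IsPosWeight u)
    (hv : IsPosWeight v) (huv : bump p r A B u v < ∞) {a : Eu n} {ℓ : ℝ} (hℓ : 0 < ℓ) :
    luxE (fun t => A t) (cube a ℓ) (fun x => ‖u x ^ (1 / p)‖₊) ≠ 0 ∧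
    luxE (fun t => A t) (cube a ℓ) (fun x => ‖u x ^ (1 / p)‖₊) ≠ ∞ ∧
    luxE (fun t => B t) (cube a ℓ) (fun x => ‖v x ^ (-r / p)‖₊) ≠ 0 ∧
    luxE (fun t => B t) (cube a ℓ) (fun x => ‖v x ^ (-r / p)‖₊) ≠ ∞ ∧
    luxE (fun t => A t) (cube a ℓ) (fun x => ‖u x ^ (1 / p)‖₊) *
      luxE (fun t => B t) (cube a ℓ) (fun x => ‖v x ^ (-r / p)‖₊) ^ (1 / r) ≤
        bump p r A B u v := by
  have hA0 := hA.luxE_ne_zero hℓ (a := a) (hu.aemeasurable_nnnorm_rpow (1 / p))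
    (hu.ae_nnnorm_rpow_pos (1 / p))
  have hB0 := hB.luxE_ne_zero hℓ (a := a) (hv.aemeasurable_nnnorm_rpow (-r / p))
    (hv.ae_nnnorm_rpow_pos (-r / p))
  have hle : luxE (fun t => A t) (cube a ℓ) (fun x => ‖u x ^ (1 / p)‖₊) *
      luxE (fun t => B t) (cube a ℓ) (fun x => ‖v x ^ (-r / p)‖₊) ^ (1 / r) ≤
        bump p r A B u v :=
    -- `luxemburg` of a power of a weight is definitionally `luxE` of its norm, so the bump supremum
    -- applies directly.
    le_iSup₂_of_le (f := fun (a : Eu n) (ℓ : ℝ) => ⨆ _ : 0 < ℓ,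
      luxemburg A (cube a ℓ) (fun x => u x ^ (1 / p)) *
      luxemburg B (cube a ℓ) (fun x => v x ^ (-r / p)) ^ (1 / r)) a ℓ (le_iSup_of_le hℓ le_rfl)
  have hlt := hle.trans_lt huv
  -- The product is finite and neither factor vanishes, so both factors are finite.
  refine ⟨hA0, fun h => ?_, hB0, fun h => ?_, hle⟩
  · rw [h, ENNReal.top_mul] at hlt
    · exact lt_irrefl _ hlt
    · intro h0
      rw [ENNReal.rpow_eq_zero_iff] at h0
      rcases h0 with h0 | h0
      · exact hB0 h0.1
      · have : 0 < 1 / r := by positivity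
        linarith [h0.2]
  · rw [h, ENNReal.top_rpow_of_pos (by positivity), ENNReal.mul_top hA0] at hlt
    exact lt_irrefl _ hlt

variable {a : Eu n} {ℓ : ℝ}

lemma avg_le_luxE (hr : 0 < r) (hA : IsYoung A) (hB : IsYoung B)
    (hu : IsPosWeight u) (hv : IsPosWeight v) (huv : bump p r A B u v < ∞) (hℓ : 0 < ℓ)
    (f : Eu n → ℂ) (Q : Idx n) :
    avg r a ℓ f Q ≤
      (2 * luxE (fun t => B t) (dtriple a ℓ Q) (fun x => ‖v x ^ (-r / p)‖₊) *
        luxE (complementary B) (dtriple a ℓ Q) (fun x => density p v f x ^ r)) ^ (1 / r) := by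
  have hs : 0 < 3 * dside ℓ Q := by have := dside_pos hℓ Q; positivity
  obtain ⟨-, -, hB0, hBt, -⟩ := bump_cube hr hA hB hu hv huv
    (a := WithLp.toLp 2 fun i => dcorner a ℓ Q i - dside ℓ Q) hs
  refine ENNReal.rpow_le_rpow ?_ (by positivity)
  rw [ENNReal.inv_mul_le_iff (volume_dtriple_ne_zero hℓ Q) (volume_dtriple_ne_top Q)]
  rw [lintegral_congr_ae (ae_restrict_of_ae (enorm_rpow_eq_mul_density hr hv f))]
  refine (lintegral_mul_le_luxE hB.continuous.measurable (volume_dtriple_ne_zero hℓ Q)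
    (volume_dtriple_ne_top Q) (hv.aemeasurable_nnnorm_rpow _) hB0 hBt).trans (le_of_eq ?_)
  ring

/-- An infinite norm on one triple would make the maximal function infinite on a whole dyadic cube.
-/
lemma luxE_ne_top_of_lintegral_orliczMax {D : ℝ≥0 → ℝ≥0∞} {q : ℝ} (hq : 0 < q) (hℓ : 0 < ℓ)
    {g : Eu n → ℝ≥0} (h : ∫⁻ x, orliczMax D a ℓ g x ^ q ≠ ∞) (Q : Idx n) :
    luxE D (dtriple a ℓ Q) g ≠ ∞ := by
  intro htop
  refine h (top_unique ?_)
  calc (∞ : ℝ≥0∞) = ∫⁻ _x in dcube a ℓ Q, ∞ := by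
        rw [setLIntegral_const, ENNReal.top_mul (volume_dcube_ne_zero hℓ Q)]
    _ ≤ ∫⁻ x in dcube a ℓ Q, orliczMax D a ℓ g x ^ q := by
        refine setLIntegral_mono' (measurableSet_dcube a ℓ Q) fun x hx => ?_
        have := luxE_le_orliczMax D g hx
        rw [htop, top_le_iff] at this
        rw [this, ENNReal.top_rpow_of_pos hq]
    _ ≤ _ := setLIntegral_le_lintegral _ _

/-- Pérez's theorem for B̄ with exponent p/r, applied to (|f| v^{1/p})^r, whose p/r-th power is
|f|^p v. -/
lemma exists_lintegral_orliczMax_density_le (hp : 0 < p) (hr : 0 < r)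
    (hBp : SatisfiesB (p / r) (complementary B)) (hv : IsPosWeight v) :
    ∃ C : ℝ≥0, ∀ (a : Eu n) (ℓ : ℝ), 0 < ℓ → ∀ f : Eu n → ℂ, AEStronglyMeasurable f volume →
      ∫⁻ x, orliczMax (complementary B) a ℓ (fun x => density p v f x ^ r) x ^ (p / r) ≤
        C * ∫⁻ x, ‖f x‖ₑ ^ p * ENNReal.ofReal (v x) := by
  obtain ⟨C, hC⟩ := lintegral_orliczMax_rpow_le n (complementary_mono B)
    (fun ε hε t => complementary_mul_le B hε t) (show 0 < p / r by positivity) hBp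
  refine ⟨C, fun a ℓ hℓ f hf => ?_⟩
  have hF := aemeasurable_density (p := p) hv hf
  -- A measurable representative; the Luxemburg norms, hence the maximal function, do not see the
  -- change.
  set g : Eu n → ℝ≥0 := fun x => hF.mk _ x ^ r with hg
  have hae : (fun x => density p v f x ^ r) =ᵐ[volume] g :=
    hF.ae_eq_mk.mono fun x hx => by simp only [hg, hx]
  have h1 : orliczMax (complementary B) a ℓ (fun x => density p v f x ^ r) =
      orliczMax (complementary B) a ℓ g := by
    funext x
    simp only [orliczMax, luxE_congr hae]
  rw [h1]
  refine (hC a ℓ hℓ g (hF.measurable_mk.pow_const r)).trans (le_of_eq ?_)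
  congr 1
  refine lintegral_congr_ae ?_
  filter_upwards [hae, density_rpow hp hv f] with x hx hx'
  rw [← hx, ← hx', ENNReal.coe_rpow_of_nonneg _ hr.le, ← ENNReal.rpow_mul,
    mul_div_cancel₀ _ hr.ne']

/-- Functions in `L^p(v)` are locally in `L^r`. -/
lemma avg_ne_top (hp : 0 < p) (hr : 0 < r) (hA : IsYoung A) (hB : IsYoung B)
    (hBp : SatisfiesB (p / r) (complementary B))
    (hu : IsPosWeight u) (hv : IsPosWeight v) (huv : bump p r A B u v < ∞) (hℓ : 0 < ℓ)
    {f : Eu n → ℂ} (hf : MemWeightedLp p v f) (Q : Idx n) : avg r a ℓ f Q ≠ ∞ := by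
  obtain ⟨C, hC⟩ := exists_lintegral_orliczMax_density_le hp hr hBp hv
  have h1 : ∫⁻ x, orliczMax (complementary B) a ℓ (fun x => density p v f x ^ r) x ^ (p / r) ≠ ∞ :=
    ((hC a ℓ hℓ f hf.1).trans_lt (ENNReal.mul_lt_top ENNReal.coe_lt_top hf.2)).ne
  have h2 := luxE_ne_top_of_lintegral_orliczMax (by positivity) hℓ h1 Q
  have hs : 0 < 3 * dside ℓ Q := by have := dside_pos hℓ Q; positivity
  obtain ⟨-, -, hB0, hBt, -⟩ := bump_cube hr hA hB hu hv huv
    (a := WithLp.toLp 2 fun i => dcorner a ℓ Q i - dside ℓ Q) hs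
  refine ne_top_of_le_ne_top (ENNReal.rpow_ne_top_of_nonneg (by positivity) ?_)
    (avg_le_luxE hr hA hB hu hv huv hℓ f Q)
  exact ENNReal.mul_ne_top (ENNReal.mul_ne_top (by norm_num) hBt) h2

/-- Averages against the weight `u^{1/p}` are controlled by the two Orlicz norms. -/
lemma avg_mul_lintegral_le (hr : 0 < r) (hA : IsYoung A) (hB : IsYoung B)
    (hu : IsPosWeight u) (hv : IsPosWeight v) (huv : bump p r A B u v < ∞) (hℓ : 0 < ℓ)
    (f : Eu n → ℂ) (g : Eu n → ℝ≥0) (Q : Idx n) :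
    avg r a ℓ f Q * ∫⁻ x in dcube a ℓ Q, ((‖u x ^ (1 / p)‖₊ : ℝ≥0) : ℝ≥0∞) * g x ≤
      (2 ^ (1 / r) * (2 * 3 ^ n) * bump p r A B u v) * volume (dcube a ℓ Q) *
        (luxE (complementary B) (dtriple a ℓ Q) (fun x => density p v f x ^ r) ^ (1 / r) *
          luxE (complementary A) (dtriple a ℓ Q) g) := by
  have hs : 0 < 3 * dside ℓ Q := by have := dside_pos hℓ Q; positivity
  obtain ⟨hA0, hAt, -, -, hle⟩ := bump_cube hr hA hB hu hv huv
    (a := WithLp.toLp 2 fun i => dcorner a ℓ Q i - dside ℓ Q) hs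
  have h1 := avg_le_luxE hr hA hB hu hv huv hℓ f Q (a := a)
  -- The integral is enlarged to 3Q, where the norms of both weights are taken; |3Q| = 3^n|Q|
  -- accounts for the factor 3^n.
  have h2 : ∫⁻ x in dcube a ℓ Q, ((‖u x ^ (1 / p)‖₊ : ℝ≥0) : ℝ≥0∞) * g x ≤
      2 * volume (dtriple a ℓ Q) *
        luxE (fun t => A t) (dtriple a ℓ Q) (fun x => ‖u x ^ (1 / p)‖₊) *
        luxE (complementary A) (dtriple a ℓ Q) g :=
    (lintegral_mono_set (dcube_subset_dtriple hℓ Q)).trans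
      (lintegral_mul_le_luxE hA.continuous.measurable (volume_dtriple_ne_zero hℓ Q)
        (volume_dtriple_ne_top Q) (hu.aemeasurable_nnnorm_rpow _) hA0 hAt)
  have hr' : 0 ≤ 1 / r := by positivity
  rw [ENNReal.mul_rpow_of_nonneg _ _ hr', ENNReal.mul_rpow_of_nonneg _ _ hr'] at h1
  rw [volume_dtriple] at h2
  set LA := luxE (fun t => A t) (dtriple a ℓ Q) (fun x => ‖u x ^ (1 / p)‖₊) with hLA
  set LB := luxE (fun t => B t) (dtriple a ℓ Q) (fun x => ‖v x ^ (-r / p)‖₊) with hLB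
  set L₁ := luxE (complementary B) (dtriple a ℓ Q) (fun x => density p v f x ^ r) with hL₁
  set L₂ := luxE (complementary A) (dtriple a ℓ Q) g with hL₂
  have hle' : LA * LB ^ (1 / r) ≤ bump p r A B u v := hle
  calc _ ≤ (2 ^ (1 / r) * LB ^ (1 / r) * L₁ ^ (1 / r)) *
        (2 * (3 ^ n * volume (dcube a ℓ Q)) * LA * L₂) := mul_le_mul' h1 h2
    _ = 2 ^ (1 / r) * (2 * 3 ^ n) * (LA * LB ^ (1 / r)) * volume (dcube a ℓ Q) *
          (L₁ ^ (1 / r) * L₂) := by ring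
    _ ≤ _ := by gcongr

end Weighted

/-! ### The two-weight bounds for sparse sums and for the localized operator. -/

section WeightedBound

variable {n : ℕ} {ι : Type*} {T : (Eu n → ℂ) → Eu n → ℂ} {φ : ι → Eu n → ℝ}
  {p r : ℝ} {A B : ℝ≥0 → ℝ≥0} {u v : Eu n → ℝ}

/-- The two-weight inequality for sparse sums of averages. -/
theorem exists_lintegral_sparseSum_rpow_le (hr : 1 < r) (hrp : r < p) (hA : IsYoung A)
    (hB : IsYoung B) (hAp : SatisfiesB (p / (p - 1)) (complementary A))
    (hBp : SatisfiesB (p / r) (complementary B))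
    (hu : IsPosWeight u) (hv : IsPosWeight v) (huv : bump p r A B u v < ∞) :
    ∃ C : ℝ≥0, ∀ (a : Eu n) (ℓ : ℝ), 0 < ℓ → ∀ f : Eu n → ℂ, AEStronglyMeasurable f volume →
      ∀ child : Idx n → Set (Idx n),
      (∀ Q, ∀ P ∈ child Q, dcube a ℓ P ⊆ dcube a ℓ Q) →
      (∀ Q, (child Q).PairwiseDisjoint (dcube a ℓ)) →
      (∀ Q, ∑' P : child Q, volume (dcube a ℓ P.1) ≤ 1 / 2 * volume (dcube a ℓ Q)) → ∀ Q,
      ∫⁻ x, (⨆ N, sparseSum a ℓ child (avg r a ℓ f) N Q x) ^ p * ENNReal.ofReal (u x) ≤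
        C * ∫⁻ x, ‖f x‖ₑ ^ p * ENNReal.ofReal (v x) := by
  have hr0 : 0 < r := by linarith
  have hp1 : 1 < p := by linarith
  have hp0 : 0 < p := by linarith
  have hpp : p.HolderConjugate (p / (p - 1)) := Real.HolderConjugate.conjExponent hp1
  set p' := p / (p - 1) with hp'
  obtain ⟨C₁, hC₁⟩ := exists_lintegral_orliczMax_density_le hp0 hr0 hBp hv
  obtain ⟨C₂, hC₂⟩ := lintegral_orliczMax_rpow_le n (complementary_mono A)
    (fun ε hε t => complementary_mul_le A hε t) hpp.symm.pos hAp
  set κ : ℝ≥0∞ := 2 ^ (1 / r) * (2 * 3 ^ n) * bump p r A B u v with hκ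
  have hκt : κ ≠ ∞ := by
    have h1 : (2 : ℝ≥0∞) ^ (1 / r) ≠ ∞ := ENNReal.rpow_ne_top_of_nonneg (by positivity) (by simp)
    have h2 := huv.ne
    finiteness
  set C : ℝ≥0∞ := (2 * κ) ^ p * C₁ * ((C₂ : ℝ≥0∞) ^ (1 / p')) ^ p with hC
  have hCt : C ≠ ∞ := by
    have h1 : (2 * κ) ^ p ≠ ∞ := ENNReal.rpow_ne_top_of_nonneg hp0.le (by finiteness)
    have h2 : ((C₂ : ℝ≥0∞) ^ (1 / p')) ^ p ≠ ∞ := ENNReal.rpow_ne_top_of_nonneg hp0.le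
      (ENNReal.rpow_ne_top_of_nonneg hpp.symm.one_div_nonneg ENNReal.coe_ne_top)
    finiteness
  refine ⟨C.toNNReal, fun a ℓ hℓ f hf child hch hdj hhf Q => ?_⟩
  rw [ENNReal.coe_toNNReal hCt]
  set I := ∫⁻ x, ‖f x‖ₑ ^ p * ENNReal.ofReal (v x) with hI
  set g₁ : Eu n → ℝ≥0 := fun x => density p v f x ^ r with hg₁
  set M₁ := orliczMax (complementary B) a ℓ g₁ with hM₁
  have hW := hu.aemeasurable_nnnorm_rpow (1 / p)
  set W : Eu n → ℝ≥0 := hW.mk _ with hWdef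
  have hWm : Measurable W := hW.measurable_mk
  set H : ℕ → Eu n → ℝ≥0∞ := fun N => sparseSum a ℓ child (avg r a ℓ f) N Q with hH
  have hHm : ∀ N, Measurable (H N) := fun N => measurable_sparseSum N Q
  set Kc : ℝ≥0∞ := 2 * κ * ((C₁ * I) ^ (1 / p) * (C₂ : ℝ≥0∞) ^ (1 / p')) with hKc
  have hKcp : Kc ^ p = C * I := by
    rw [hKc, hC, ENNReal.mul_rpow_of_nonneg (2 * κ) _ hp0.le,
      ENNReal.mul_rpow_of_nonneg ((C₁ * I) ^ (1 / p)) _ hp0.le, ← ENNReal.rpow_mul (C₁ * I), one_div_mul_cancel hp0.ne', ENNReal.rpow_one]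
    ring
  -- Duality for finitely many generations, with a bound independent of N; monotone convergence then
  -- gives the full sum.
  have hdual : ∀ N, ∫⁻ x, (H N x * W x) ^ p ≤ C * I := by
    intro N
    rw [← hKcp]
    refine lintegral_rpow_le_of_forall_mul ((hHm N).mul hWm.coe_nnreal_ennreal) hpp fun g hg => ?_
    set M₂ := orliczMax (complementary A) a ℓ g with hM₂
    have hM₁m : Measurable M₁ := measurable_orliczMax _ _ _ _
    have hM₂m : Measurable M₂ := measurable_orliczMax _ _ _ _
    have hbil := lintegral_sparseSum_mul_le hch hdj hhf (A := avg r a ℓ f)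
      (w := fun x => (W x : ℝ≥0∞) * g x) (M := fun x => M₁ x ^ (1 / r) * M₂ x) (κ := κ)
      (Λ := fun Q => luxE (complementary B) (dtriple a ℓ Q) g₁ ^ (1 / r) *
        luxE (complementary A) (dtriple a ℓ Q) g)
      (hWm.coe_nnreal_ennreal.mul hg.coe_nnreal_ennreal)
      (fun Q => by
        refine le_trans (le_of_eq ?_) (avg_mul_lintegral_le hr0 hA hB hu hv huv hℓ f g Q)
        congr 1
        refine lintegral_congr_ae (ae_restrict_of_ae ?_)
        filter_upwards [hW.ae_eq_mk] with x hx
        rw [hx])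
      (fun Q x hx => mul_le_mul'
        (ENNReal.rpow_le_rpow (luxE_le_orliczMax _ g₁ hx) (by positivity))
        (luxE_le_orliczMax _ g hx)) N Q
    calc ∫⁻ x, H N x * W x * g x = ∫⁻ x, H N x * (W x * g x) := by simp_rw [mul_assoc]
      _ ≤ 2 * κ * ∫⁻ x in dcube a ℓ Q, M₁ x ^ (1 / r) * M₂ x := hbil
      _ ≤ 2 * κ * ∫⁻ x, M₁ x ^ (1 / r) * M₂ x := by
          gcongr
          exact Measure.restrict_le_self
      _ ≤ 2 * κ * ((∫⁻ x, (M₁ x ^ (1 / r)) ^ p) ^ (1 / p) * (∫⁻ x, M₂ x ^ p') ^ (1 / p')) := by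
          gcongr
          exact ENNReal.lintegral_mul_le_Lp_mul_Lq volume hpp
            (hM₁m.pow_const _).aemeasurable hM₂m.aemeasurable
      _ ≤ 2 * κ * ((C₁ * I) ^ (1 / p) *
            (C₂ * ∫⁻ x, (g x : ℝ≥0∞) ^ p') ^ (1 / p')) := by
          have e : ∀ x, (M₁ x ^ (1 / r)) ^ p = M₁ x ^ (p / r) := fun x => by
            rw [← ENNReal.rpow_mul]; congr 1; ring
          simp_rw [e]
          have i1 := hpp.one_div_nonneg
          have i2 := hpp.symm.one_div_nonneg
          gcongr
          · exact hC₁ a ℓ hℓ f hf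
          · exact hC₂ a ℓ hℓ g hg
      _ = Kc * (∫⁻ x, (g x : ℝ≥0∞) ^ p') ^ (1 / p') := by
          rw [hKc, ENNReal.mul_rpow_of_nonneg _ _ hpp.symm.one_div_nonneg]
          ring
  have hmono : Monotone fun (N : ℕ) x => H N x * (W x : ℝ≥0∞) :=
    monotone_nat_of_le_succ fun N x => mul_le_mul_left (sparseSum_le_succ N Q x) _
  calc ∫⁻ x, (⨆ N, sparseSum a ℓ child (avg r a ℓ f) N Q x) ^ p * ENNReal.ofReal (u x)
      = ∫⁻ x, ((⨆ N, H N x) * W x) ^ p := by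
        refine lintegral_congr_ae ?_
        filter_upwards [hW.ae_eq_mk, hu.pos] with x hx hx'
        rw [ENNReal.mul_rpow_of_nonneg _ _ hp0.le, hWdef, ← hx, coe_nnnorm_rpow_rpow hx',
          one_div_mul_cancel hp0.ne', Real.rpow_one]
    _ = ⨆ N, ∫⁻ x, (H N x * W x) ^ p :=
        lintegral_rpow_eq_iSup (fun N => (hHm N).mul hWm.coe_nnreal_ennreal) hmono
          (fun x => ENNReal.iSup_mul _ _) hp0
    _ ≤ C * I := iSup_le hdual

/-- The two-weight inequality on a cube, for functions cut off to its triple. -/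
theorem exists_setLIntegral_maxMod_rpow_le (hT : IsCZOperator T) (hφ : ∀ α, Measurable (φ α))
    {r₀ : ℝ} {ψ : ℝ → ℝ≥0} (hwt : WeakTypeBounds T φ r₀ ψ) (hr : 1 < r) (hr₀ : r ≤ r₀)
    (hrp : r < p) (hA : IsYoung A) (hB : IsYoung B)
    (hAp : SatisfiesB (p / (p - 1)) (complementary A))
    (hBp : SatisfiesB (p / r) (complementary B))
    (hu : IsPosWeight u) (hv : IsPosWeight v) (huv : bump p r A B u v < ∞) :
    ∃ C : ℝ≥0, ∀ (a : Eu n) (ℓ : ℝ), 0 < ℓ → ∀ f : Eu n → ℂ, MemLp f 2 volume →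
      MemWeightedLp p v f →
      ∫⁻ x in cube a ℓ, maxMod T φ ((tripleCube a ℓ).indicator f) x ^ p * ENNReal.ofReal (u x) ≤
        C * ∫⁻ x, ‖f x‖ₑ ^ p * ENNReal.ofReal (v x) := by
  have hr0 : 0 < r := by linarith
  have hp0 : 0 < p := by linarith
  obtain ⟨C₁, hC₁⟩ := exists_sparse_step hT hφ hwt hr hr₀
  obtain ⟨C₂, hC₂⟩ := exists_lintegral_sparseSum_rpow_le hr hrp hA hB hAp hBp hu hv huv
  refine ⟨(2 * C₁) ^ p * C₂, fun a ℓ hℓ f hf hfw => ?_⟩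
  choose child h1 h2 h3 h4 using hC₁ a ℓ hℓ f hf
    (avg_ne_top hp0 hr0 hA hB hBp hu hv huv hℓ hfw)
  -- Adding C₁ · average to the operator closes the recursion: the terms of the children in the
  -- sparse step are exactly G P, and the term of Q becomes 2 C₁ · average.
  set G : Idx n → Eu n → ℝ≥0∞ := fun Q => (dcube a ℓ Q).indicator
    (fun x => maxMod T φ (loc a ℓ f Q) x + C₁ * avg r a ℓ f Q) with hG
  have hdom := ae_le_iSup_sparseSum (A := avg r a ℓ f) h3 (G := G) (C := 2 * C₁)
    (fun Q x hx => Set.indicator_of_notMem hx _)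
    (fun Q x hx => by
      simp only [hG, Set.indicator_of_mem hx]
      refine (add_le_add (h4 Q x hx) le_rfl).trans (le_of_eq ?_)
      ring) (0, 0)
  set H : Eu n → ℝ≥0∞ := fun x => ⨆ N, sparseSum a ℓ child (avg r a ℓ f) N (0, 0) x with hH
  calc ∫⁻ x in cube a ℓ, maxMod T φ ((tripleCube a ℓ).indicator f) x ^ p * ENNReal.ofReal (u x)
      ≤ ∫⁻ x in cube a ℓ, (2 * C₁ : ℝ≥0∞) ^ p * (H x ^ p * ENNReal.ofReal (u x)) := by
        refine lintegral_mono_ae ?_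
        filter_upwards [ae_restrict_of_ae hdom, ae_restrict_mem (measurableSet_cube a ℓ)]
          with x hx hxc
        rw [← mul_assoc, ← ENNReal.mul_rpow_of_nonneg _ _ hp0.le]
        gcongr
        refine le_trans ?_ hx
        simp only [hG]
        rw [Set.indicator_of_mem (by rwa [dcube_zero]), loc, dtriple_zero]
        exact le_self_add
    _ ≤ ∫⁻ x, (2 * C₁ : ℝ≥0∞) ^ p * (H x ^ p * ENNReal.ofReal (u x)) :=
        setLIntegral_le_lintegral _ _
    _ = (2 * C₁ : ℝ≥0∞) ^ p * ∫⁻ x, H x ^ p * ENNReal.ofReal (u x) :=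
        lintegral_const_mul' _ _ (ENNReal.rpow_ne_top_of_nonneg hp0.le (by finiteness))
    _ ≤ (2 * C₁ : ℝ≥0∞) ^ p * (C₂ * ∫⁻ x, ‖f x‖ₑ ^ p * ENNReal.ofReal (v x)) := by
        gcongr
        exact hC₂ a ℓ hℓ f hf.1 child h1 h2 h3 (0, 0)
    _ = _ := by
        rw [ENNReal.coe_mul, ENNReal.coe_rpow_of_nonneg _ hp0.le]
        push_cast
        ring

end WeightedBound

/-! ### Removing the truncation -/

section Truncation

variable {n : ℕ} {ι : Type*} {T : (Eu n → ℂ) → Eu n → ℂ} {φ : ι → Eu n → ℝ}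

/-- Lower corner of the `k`-th cube of an exhaustion of the space. -/
def boxCorner (n k : ℕ) : Eu n := WithLp.toLp 2 fun _ => -((k : ℝ) + 1)

/-- Side of the `k`-th cube of an exhaustion of the space. -/
def boxSide (k : ℕ) : ℝ := 2 * ((k : ℝ) + 1)

lemma boxSide_pos (k : ℕ) : 0 < boxSide k := by unfold boxSide; positivity

/-- The function cut off to the triple of the `k`-th cube of the exhaustion. -/
def trunc (f : Eu n → ℂ) (k : ℕ) : Eu n → ℂ :=
  (tripleCube (boxCorner n k) (boxSide k)).indicator f

lemma mem_box_of_norm_lt {x : Eu n} {k : ℕ} (h : ‖x‖ < k) : x ∈ cube (boxCorner n k) (boxSide k) := by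
  intro i
  have h1 := (PiLp.norm_apply_le x i).trans_lt h
  rw [Real.norm_eq_abs, abs_lt] at h1
  simp only [boxCorner, boxSide]
  constructor <;> linarith [h1.1, h1.2]

lemma eventually_mem_box (x : Eu n) :
    ∀ᶠ k : ℕ in Filter.atTop, x ∈ cube (boxCorner n k) (boxSide k) := by
  filter_upwards [(tendsto_natCast_atTop_atTop (R := ℝ)).eventually_gt_atTop ‖x‖] with k hk
  exact mem_box_of_norm_lt hk

lemma trunc_eq_of_mem {f : Eu n → ℂ} {k : ℕ} {x : Eu n}
    (hx : x ∈ cube (boxCorner n k) (boxSide k)) : trunc f k x = f x :=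
  Set.indicator_of_mem (cube_subset_tripleCube (boxSide_pos k) hx) f

lemma measurableSet_tripleCube (a : Eu n) (ℓ : ℝ) : MeasurableSet (tripleCube a ℓ) :=
  measurableSet_cube _ _

lemma memLp_trunc {f : Eu n → ℂ} {q : ℝ≥0∞} (hf : MemLp f q volume) (k : ℕ) :
    MemLp (trunc f k) q volume := hf.indicator (measurableSet_tripleCube _ _)

/-- Cauchy–Schwarz: (1 + |x − y|)^{−n} is square integrable in y, since 2n > n when n is positive.
-/
lemma lintegral_one_add_norm_rpow_mul_lt_top (hn : 0 < n) {f : Eu n → ℂ} (hf : MemLp f 2 volume)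
    (x : Eu n) :
    ∫⁻ y, ENNReal.ofReal ((1 + ‖x - y‖) ^ (-(n : ℝ))) * ‖f y‖ₑ < ∞ := by
  have h2 : (2 : ℝ).HolderConjugate 2 := Real.HolderConjugate.two_two
  have hmeas : Measurable fun y : Eu n => ENNReal.ofReal ((1 + ‖x - y‖) ^ (-(n : ℝ))) := by
    fun_prop
  refine (ENNReal.lintegral_mul_le_Lp_mul_Lq volume h2 hmeas.aemeasurable
    hf.1.enorm).trans_lt (ENNReal.mul_lt_top ?_ ?_)
  · refine ENNReal.rpow_lt_top_of_nonneg (by norm_num) (ne_of_lt ?_)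
    have hint : Integrable (fun y : Eu n => (1 + ‖y‖) ^ (-(2 * n : ℝ))) volume := by
      refine integrable_one_add_norm ?_
      rw [finrank_euclideanSpace_fin]
      have : (0 : ℝ) < n := by exact_mod_cast hn
      linarith
    have hint' := (hint.comp_sub_left x).lintegral_lt_top
    refine lt_of_le_of_lt (le_of_eq (lintegral_congr fun y => ?_)) hint'
    rw [ENNReal.ofReal_rpow_of_nonneg (by positivity) (by norm_num), ← Real.rpow_mul (by positivity)]
    congr 2
    ring
  · refine ENNReal.rpow_lt_top_of_nonneg (by norm_num) (ne_of_lt ?_)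
    have := hf.2
    rw [eLpNorm_eq_lintegral_rpow_enorm_toReal (by norm_num) (by norm_num)] at this
    simp only [ENNReal.toReal_ofNat] at this
    by_contra hcon
    rw [not_lt, top_le_iff] at hcon
    rw [hcon] at this
    simp at this

lemma IsCZKernel.enorm_le {K : Eu n → Eu n → ℂ} (hK : IsCZKernel K) : ∃ C : ℝ≥0, ∀ x y : Eu n, 1 ≤ ‖x - y‖ →
    ‖K x y‖ₑ ≤ C * ENNReal.ofReal ((1 + ‖x - y‖) ^ (-(n : ℝ))) := by
  obtain ⟨C, hC, hsize⟩ := hK.exists_size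
  refine ⟨(C * 2 ^ n).toNNReal, fun x y hxy => ?_⟩
  rw [← ofReal_norm, ← ENNReal.ofReal, ← ENNReal.ofReal_mul (by positivity)]
  refine ENNReal.ofReal_le_ofReal ?_
  -- At distance at least 1 one has (1 + ‖x − y‖)/2 ≤ ‖x − y‖.
  refine (hsize x y ((1 + ‖x - y‖) / 2) (by positivity) (by linarith)).trans (le_of_eq ?_)
  rw [Real.rpow_neg (by positivity), Real.rpow_natCast, div_pow]
  field_simp

/-- Once x lies in the k-th box, the tail of f is separated from x and the operator is bounded by an
absolute kernel integral, uniformly in α. This integral tends to 0 by dominated convergence. -/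
lemma tendsto_maxMod_sub_trunc (hn : 0 < n) (hT : IsCZOperator T) (hφ : ∀ α, Measurable (φ α))
    {f : Eu n → ℂ} (hf : MemLp f 2 volume) (x : Eu n) :
    Filter.Tendsto (fun k => maxMod T φ (f - trunc f k) x) Filter.atTop (nhds 0) := by
  obtain ⟨K, hK, hrep⟩ := hT.kernel
  obtain ⟨C, hC⟩ := hK.enorm_le
  have hsep : ∀ k, x ∈ cube (boxCorner n k) (boxSide k) → ∀ y, (f - trunc f k) y ≠ 0 →
      boxSide k ≤ ‖x - y‖ := by
    intro k hk y hy
    refine le_norm_sub_of_notMem_tripleCube hk fun hyk => hy ?_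
    simp [trunc, Set.indicator_of_mem hyk]
  have hlim : Filter.Tendsto (fun k => ∫⁻ y, ‖K x y‖ₑ * ‖(f - trunc f k) y‖ₑ) Filter.atTop
      (nhds 0) := by
    have hz : (0 : ℝ≥0∞) = ∫⁻ _y : Eu n, 0 := by simp
    obtain ⟨k₀, hk₀⟩ := Filter.eventually_atTop.1 (eventually_mem_box x)
    -- The sequence starts at k₀ because the domination holds only once x is in the box.
    rw [hz, ← Filter.tendsto_add_atTop_iff_nat k₀]
    refine tendsto_lintegral_of_dominated_convergence'
      (fun y => C * (ENNReal.ofReal ((1 + ‖x - y‖) ^ (-(n : ℝ))) * ‖f y‖ₑ)) (fun j => ?_)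
      (fun j => ae_of_all _ fun y => ?_) ?_ ?_
    · have h0 : (f - trunc f (j + k₀)) x = 0 := by simp [trunc_eq_of_mem (hk₀ (j + k₀) (by omega))]
      have := (hK.aestronglyMeasurable_mul (hf.sub (memLp_trunc hf (j + k₀))).1 h0).enorm
      simpa only [enorm_mul] using this
    · have hk := hk₀ (j + k₀) (by omega)
      set k := j + k₀
      by_cases hy : (f - trunc f k) y = 0
      · simp [hy]
      · have h1 : 1 ≤ ‖x - y‖ := by
          refine le_trans ?_ (hsep k hk y hy)
          have : (0 : ℝ) ≤ k := Nat.cast_nonneg k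
          unfold boxSide; linarith
        beta_reduce
        rw [← mul_assoc]
        refine mul_le_mul' (hC x y h1) ?_
        have h2 : (f - trunc f k) y = f y ∨ (f - trunc f k) y = 0 := by
          by_cases hyk : y ∈ tripleCube (boxCorner n k) (boxSide k)
          · right; simp [trunc, Set.indicator_of_mem hyk]
          · left; simp [trunc, Set.indicator_of_notMem hyk]
        rw [h2.resolve_right hy]
    · rw [lintegral_const_mul' _ _ ENNReal.coe_ne_top]
      exact ENNReal.mul_ne_top ENNReal.coe_ne_top
        (lintegral_one_add_norm_rpow_mul_lt_top hn hf x).ne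
    · refine ae_of_all _ fun y => (Filter.tendsto_add_atTop_iff_nat
        (f := fun k => ‖K x y‖ₑ * ‖(f - trunc f k) y‖ₑ) k₀).2 (tendsto_const_nhds.congr' ?_)
      filter_upwards [eventually_mem_box y] with k hk
      simp [trunc_eq_of_mem hk]
  refine tendsto_of_tendsto_of_tendsto_of_le_of_le' tendsto_const_nhds hlim
    (Filter.Eventually.of_forall fun _ => zero_le) ?_
  filter_upwards [eventually_mem_box x] with k hk
  exact maxMod_le_lintegral hφ hrep (hf.sub (memLp_trunc hf k)) (boxSide_pos k) (hsep k hk)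

/-- A squeeze by sublinearity, valid also where `maxMod T φ f x` is infinite. -/
lemma tendsto_maxMod_trunc (hn : 0 < n) (hT : IsCZOperator T) (hφ : ∀ α, Measurable (φ α))
    {f : Eu n → ℂ} (hf : MemLp f 2 volume) (x : Eu n) :
    Filter.Tendsto (fun k => maxMod T φ (trunc f k) x) Filter.atTop
      (nhds (maxMod T φ f x)) := by
  have h0 := tendsto_maxMod_sub_trunc hn hT hφ hf x
  have hlo : ∀ k, maxMod T φ f x - maxMod T φ (f - trunc f k) x ≤ maxMod T φ (trunc f k) x :=
    fun k => tsub_le_iff_right.2 (maxMod_le_add_sub hT hφ hf (memLp_trunc hf k) x)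
  have hhi : ∀ k, maxMod T φ (trunc f k) x ≤ maxMod T φ f x + maxMod T φ (f - trunc f k) x := by
    intro k
    have h := maxMod_sub_le hT hφ hf (hf.sub (memLp_trunc hf k)) x
    rwa [sub_sub_cancel] at h
  have hl : Filter.Tendsto (fun k => maxMod T φ f x - maxMod T φ (f - trunc f k) x) Filter.atTop
      (nhds (maxMod T φ f x)) := by
    have := ENNReal.Tendsto.sub (tendsto_const_nhds (x := maxMod T φ f x)) h0
      (Or.inr ENNReal.zero_ne_top)
    rwa [tsub_zero] at this
  have hu : Filter.Tendsto (fun k => maxMod T φ f x + maxMod T φ (f - trunc f k) x) Filter.atTop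
      (nhds (maxMod T φ f x)) := by
    have := (tendsto_const_nhds (x := maxMod T φ f x)).add h0
    rwa [add_zero] at this
  exact tendsto_of_tendsto_of_tendsto_of_le_of_le hl hu hlo hhi

variable {p r : ℝ} {A B : ℝ≥0 → ℝ≥0} {u v : Eu n → ℝ}

lemma memLp_trunc_rpow (hp : 0 < p) (hr : 0 < r) (hA : IsYoung A) (hB : IsYoung B)
    (hBp : SatisfiesB (p / r) (complementary B))
    (hu : IsPosWeight u) (hv : IsPosWeight v) (huv : bump p r A B u v < ∞)
    {f : Eu n → ℂ} (hf : MemWeightedLp p v f) (k : ℕ) :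
    MemLp (trunc f k) (ENNReal.ofReal r) volume := by
  have := memLp_loc_rpow (boxSide_pos k) hr hf.1
    (avg_ne_top hp hr hA hB hBp hu hv huv (boxSide_pos k) (a := boxCorner n k) hf (0, 0))
  rwa [loc, dtriple_zero] at this

lemma aemeasurable_maxMod_trunc {r₀ : ℝ} {ψ : ℝ → ℝ≥0} (hwt : WeakTypeBounds T φ r₀ ψ) (hr : 1 < r) (hr₀ : r ≤ r₀)
    (hp : 0 < p) (hA : IsYoung A) (hB : IsYoung B)
    (hBp : SatisfiesB (p / r) (complementary B))
    (hu : IsPosWeight u) (hv : IsPosWeight v) (huv : bump p r A B u v < ∞)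
    {f : Eu n → ℂ} (hf2 : MemLp f 2 volume) (hf : MemWeightedLp p v f) (k : ℕ) :
    AEMeasurable (maxMod T φ (trunc f k)) volume :=
  (hwt r hr hr₀ _ (memLp_trunc hf2 k)
    (memLp_trunc_rpow hp (by linarith) hA hB hBp hu hv huv hf k)).1

/-- The weak-type hypothesis gives measurability only on L² ∩ L^r. The truncations of f belong to
this space because f is locally in L^r, and the operator on f is their pointwise limit. -/
lemma aemeasurable_maxMod (hn : 0 < n) (hT : IsCZOperator T) (hφ : ∀ α, Measurable (φ α))
    {r₀ : ℝ} {ψ : ℝ → ℝ≥0} (hwt : WeakTypeBounds T φ r₀ ψ) (hr : 1 < r) (hr₀ : r ≤ r₀)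
    (hp : 0 < p) (hA : IsYoung A) (hB : IsYoung B)
    (hBp : SatisfiesB (p / r) (complementary B))
    (hu : IsPosWeight u) (hv : IsPosWeight v) (huv : bump p r A B u v < ∞)
    {f : Eu n → ℂ} (hf2 : MemLp f 2 volume) (hf : MemWeightedLp p v f) :
    AEMeasurable (maxMod T φ f) volume :=
  aemeasurable_of_tendsto_metrizable_ae Filter.atTop
    (fun k => aemeasurable_maxMod_trunc hwt hr hr₀ hp hA hB hBp hu hv huv hf2 hf k)
    (ae_of_all _ fun x => tendsto_maxMod_trunc hn hT hφ hf2 x)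

lemma IsPosWeight.aemeasurable_ofReal (hu : IsPosWeight u) :
    AEMeasurable (fun x => ENNReal.ofReal (u x)) volume :=
  hu.locallyIntegrable.aestronglyMeasurable.aemeasurable.ennreal_ofReal

/-- The two-weight inequality on `L²`. -/
theorem exists_lintegral_maxMod_rpow_le (hn : 0 < n) (hT : IsCZOperator T)
    (hφ : ∀ α, Measurable (φ α))
    {r₀ : ℝ} {ψ : ℝ → ℝ≥0} (hwt : WeakTypeBounds T φ r₀ ψ) (hr : 1 < r) (hr₀ : r ≤ r₀)
    (hrp : r < p) (hA : IsYoung A) (hB : IsYoung B)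
    (hAp : SatisfiesB (p / (p - 1)) (complementary A))
    (hBp : SatisfiesB (p / r) (complementary B))
    (hu : IsPosWeight u) (hv : IsPosWeight v) (huv : bump p r A B u v < ∞) :
    ∃ C : ℝ≥0, 0 < C ∧ ∀ f : Eu n → ℂ, MemLp f 2 volume →
      ∫⁻ x, maxMod T φ f x ^ p * ENNReal.ofReal (u x) ≤
        C * ∫⁻ x, ‖f x‖ₑ ^ p * ENNReal.ofReal (v x) := by
  have hp0 : 0 < p := by linarith
  obtain ⟨C, hC⟩ := exists_setLIntegral_maxMod_rpow_le hT hφ hwt hr hr₀ hrp hA hB hAp hBp hu hv huv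
  -- A positive constant makes the bound trivial when the integral on the right is infinite.
  refine ⟨C + 1, by positivity, fun f hf => ?_⟩
  rcases eq_or_ne (∫⁻ x, ‖f x‖ₑ ^ p * ENNReal.ofReal (v x)) ∞ with hI | hI
  · rw [hI, ENNReal.mul_top (by simp)]; exact le_top
  have hfw : MemWeightedLp p v f := ⟨hf.1, hI.lt_top⟩
  set F : ℕ → Eu n → ℝ≥0∞ := fun k => (cube (boxCorner n k) (boxSide k)).indicator
    (fun x => maxMod T φ (trunc f k) x ^ p * ENNReal.ofReal (u x)) with hF
  have hlim : ∀ x, Filter.Tendsto (fun k => F k x) Filter.atTop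
      (nhds (maxMod T φ f x ^ p * ENNReal.ofReal (u x))) := by
    intro x
    have h1 := ENNReal.Tendsto.mul_const (b := ENNReal.ofReal (u x))
      ((ENNReal.continuous_rpow_const (y := p)).continuousAt.tendsto.comp
        (tendsto_maxMod_trunc hn hT hφ hf x)) (Or.inr ENNReal.ofReal_ne_top)
    refine h1.congr' ?_
    filter_upwards [eventually_mem_box x] with k hk
    simp only [hF, Set.indicator_of_mem hk, Function.comp]
  have hmeas : ∀ k, AEMeasurable (F k) volume := fun k =>
    (((aemeasurable_maxMod_trunc hwt hr hr₀ hp0 hA hB hBp hu hv huv hf hfw k).pow_const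
      p).mul hu.aemeasurable_ofReal).indicator (measurableSet_cube _ _)
  -- Fatou's lemma along the exhaustion.
  calc ∫⁻ x, maxMod T φ f x ^ p * ENNReal.ofReal (u x)
      = ∫⁻ x, Filter.liminf (fun k => F k x) Filter.atTop :=
        lintegral_congr fun x => (hlim x).liminf_eq.symm
    _ ≤ Filter.liminf (fun k => ∫⁻ x, F k x) Filter.atTop := lintegral_liminf_le' hmeas
    _ ≤ C * ∫⁻ x, ‖f x‖ₑ ^ p * ENNReal.ofReal (v x) := by
        refine Filter.liminf_le_of_le (by isBoundedDefault) fun b hb => ?_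
        obtain ⟨k, hk⟩ := hb.exists
        refine hk.trans ?_
        rw [hF, lintegral_indicator (measurableSet_cube _ _)]
        exact hC _ _ (boxSide_pos k) f hf hfw
    _ ≤ _ := by gcongr; exact le_self_add

end Truncation

/-! ### Extension to the weighted space -/

section Extension

variable {n : ℕ}

/-- The measure `w dx`. -/
def weightMeasure (w : Eu n → ℝ) : Measure (Eu n) :=
  volume.withDensity fun x => ENNReal.ofReal (w x)

variable {w : Eu n → ℝ} {p : ℝ}

lemma weightMeasure_absolutelyContinuous (w : Eu n → ℝ) : weightMeasure w ≪ volume :=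
  withDensity_absolutelyContinuous _ _

/-- Positivity of the weight is what carries almost everywhere statements back from w dx to Lebesgue
measure. -/
lemma IsPosWeight.absolutelyContinuous (hw : IsPosWeight w) : volume ≪ weightMeasure w :=
  withDensity_absolutelyContinuous' hw.aemeasurable_ofReal
    (hw.pos.mono fun _ hx => (ENNReal.ofReal_pos.2 hx).ne')

lemma IsPosWeight.isLocallyFiniteMeasure (hw : IsPosWeight w) :
    IsLocallyFiniteMeasure (weightMeasure w) := by
  refine ⟨fun x => ?_⟩
  obtain ⟨s, hs, hint⟩ := hw.locallyIntegrable x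
  refine ⟨s, hs, ?_⟩
  rw [weightMeasure, withDensity_apply' _ s]
  exact hint.lintegral_lt_top

lemma eLpNorm_weightMeasure {E : Type*} [NormedAddCommGroup E] (hp : 0 < p)
    (hw : IsPosWeight w) {f : Eu n → E} (hf : AEStronglyMeasurable f volume) :
    eLpNorm f (ENNReal.ofReal p) (weightMeasure w) =
      (∫⁻ x, ‖f x‖ₑ ^ p * ENNReal.ofReal (w x)) ^ (1 / p) := by
  rw [eLpNorm_eq_lintegral_rpow_enorm_toReal (by simpa using hp) ENNReal.ofReal_ne_top,
    ENNReal.toReal_ofReal hp.le, weightMeasure,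
    lintegral_withDensity_eq_lintegral_mul₀ hw.aemeasurable_ofReal (hf.enorm.pow_const p)]
  simp only [Pi.mul_apply, mul_comm]

lemma lintegral_rpow_eq_eLpNorm {E : Type*} [NormedAddCommGroup E] (hp : 0 < p)
    (hw : IsPosWeight w) {f : Eu n → E} (hf : AEStronglyMeasurable f volume) :
    ∫⁻ x, ‖f x‖ₑ ^ p * ENNReal.ofReal (w x) =
      eLpNorm f (ENNReal.ofReal p) (weightMeasure w) ^ p := by
  rw [eLpNorm_weightMeasure hp hw hf, ← ENNReal.rpow_mul, one_div_mul_cancel hp.ne',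
    ENNReal.rpow_one]

lemma MemWeightedLp.memLp (hp : 0 < p) (hw : IsPosWeight w) {f : Eu n → ℂ}
    (hf : MemWeightedLp p w f) : MemLp f (ENNReal.ofReal p) (weightMeasure w) := by
  refine ⟨hf.1.mono_ac (weightMeasure_absolutelyContinuous w), ?_⟩
  rw [eLpNorm_weightMeasure hp hw hf.1]
  exact ENNReal.rpow_lt_top_of_nonneg (by positivity) hf.2.ne

lemma MemLp.memWeightedLp (hp : 0 < p) (hw : IsPosWeight w) {f : Eu n → ℂ}
    (hf : MemLp f (ENNReal.ofReal p) (weightMeasure w)) : MemWeightedLp p w f := by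
  have h1 : AEStronglyMeasurable f volume := hf.1.mono_ac hw.absolutelyContinuous
  refine ⟨h1, ?_⟩
  rw [lintegral_rpow_eq_eLpNorm hp hw h1]
  exact ENNReal.rpow_lt_top_of_nonneg hp.le hf.2.ne

/-- `L² ∩ L^p(v)` is dense in `L^p(v)`. -/
lemma MemWeightedLp.exists_approx (hp : 0 < p) (hw : IsPosWeight w) {f : Eu n → ℂ}
    (hf : MemWeightedLp p w f) {ε : ℝ≥0∞} (hε : ε ≠ 0) :
    ∃ h : Eu n → ℂ, MemLp h 2 volume ∧ MemWeightedLp p w h ∧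
      eLpNorm (h - f) (ENNReal.ofReal p) (weightMeasure w) ≤ ε := by
  have := hw.isLocallyFiniteMeasure
  -- Continuous functions of compact support are dense because w dx is locally finite, and they also
  -- belong to L².
  obtain ⟨h, h1, h2, h3, h4⟩ :=
    (hf.memLp hp hw).exists_hasCompactSupport_eLpNorm_sub_le ENNReal.ofReal_ne_top hε
  refine ⟨h, h3.memLp_of_hasCompactSupport h1, MemLp.memWeightedLp hp hw h4, ?_⟩
  rwa [eLpNorm_sub_comm]

lemma enorm_toReal_sub_toReal_le {x y d : ℝ≥0∞} (hx : x ≠ ∞) (hy : y ≠ ∞) (h1 : x ≤ y + d)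
    (h2 : y ≤ x + d) : ‖x.toReal - y.toReal‖ₑ ≤ d := by
  rcases eq_or_ne d ∞ with hd | hd
  · rw [hd]; exact le_top
  rw [← ofReal_norm, ← ENNReal.ofReal_toReal hd]
  refine ENNReal.ofReal_le_ofReal ?_
  have h1' := ENNReal.toReal_mono (by finiteness) h1
  have h2' := ENNReal.toReal_mono (by finiteness) h2
  rw [ENNReal.toReal_add hy hd] at h1'
  rw [ENNReal.toReal_add hx hd] at h2'
  rw [Real.norm_eq_abs, abs_le]
  constructor <;> linarith

lemma edist_toNNReal_le (x y : ℝ) : edist x.toNNReal y.toNNReal ≤ ‖x - y‖ₑ := by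
  have := (show LipschitzWith 1 Real.toNNReal from lipschitzWith_posPart) x y
  rwa [ENNReal.coe_one, one_mul, edist_eq_enorm_sub x y] at this

/-- A Lipschitz map from `L² ∩ L^p(v)` to `L^p(u)` extends to `L^p(v)`. -/
lemma exists_limit (hp : 1 ≤ p) {v : Eu n → ℝ} (hv : IsPosWeight v) {μ : Measure (Eu n)}
    {t : (Eu n → ℂ) → Eu n → ℝ} {c : ℝ≥0}
    (ht : ∀ f, MemLp f 2 volume → MemWeightedLp p v f → MemLp (t f) (ENNReal.ofReal p) μ)
    (hLip : ∀ f g, MemLp f 2 volume → MemWeightedLp p v f → MemLp g 2 volume →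
      MemWeightedLp p v g → eLpNorm (t f - t g) (ENNReal.ofReal p) μ ≤
        c * eLpNorm (f - g) (ENNReal.ofReal p) (weightMeasure v))
    {f : Eu n → ℂ} (hf : MemWeightedLp p v f) :
    ∃ L : Eu n → ℝ, MemLp L (ENNReal.ofReal p) μ ∧
      ∀ h, MemLp h 2 volume → MemWeightedLp p v h →
        eLpNorm (t h - L) (ENNReal.ofReal p) μ ≤
          c * eLpNorm (h - f) (ENNReal.ofReal p) (weightMeasure v) := by
  have hp0 : 0 < p := by linarith
  have hp1 : 1 ≤ ENNReal.ofReal p := by simpa using hp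
  set N : (Eu n → ℂ) → ℝ≥0∞ := fun f => eLpNorm f (ENNReal.ofReal p) (weightMeasure v) with hN
  have hpow : ∀ k : ℕ, (2⁻¹ : ℝ≥0∞) ^ k ≠ 0 := fun k => by simp
  choose s hs2 hsv hsε using fun k : ℕ => hf.exists_approx hp0 hv (hpow k)
  have haes : ∀ g, MemWeightedLp p v g → AEStronglyMeasurable g (weightMeasure v) :=
    fun g hg => (hg.memLp hp0 hv).1
  have htri : ∀ g₁ g₂ g₃, MemWeightedLp p v g₁ → MemWeightedLp p v g₂ → MemWeightedLp p v g₃ →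
      N (g₁ - g₃) ≤ N (g₁ - g₂) + N (g₂ - g₃) := by
    intro g₁ g₂ g₃ h1 h2 h3
    rw [← sub_add_sub_cancel g₁ g₂ g₃]
    exact eLpNorm_add_le ((haes _ h1).sub (haes _ h2)) ((haes _ h2).sub (haes _ h3)) hp1
  have hdiff : ∀ K i j, K ≤ i → K ≤ j → N (s i - s j) ≤ 2 * (2⁻¹ : ℝ≥0∞) ^ K := by
    intro K i j hi hj
    have hanti : ∀ m, K ≤ m → N (s m - f) ≤ (2⁻¹ : ℝ≥0∞) ^ K := fun m hm =>
      (hsε m).trans (pow_le_pow_right_of_le_one' (by simp) hm)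
    calc N (s i - s j) ≤ N (s i - f) + N (f - s j) := htri _ _ _ (hsv i) hf (hsv j)
      _ ≤ (2⁻¹ : ℝ≥0∞) ^ K + (2⁻¹ : ℝ≥0∞) ^ K := by
          refine add_le_add (hanti i hi) ?_
          rw [hN]; simp only
          rw [eLpNorm_sub_comm]
          exact hanti j hj
      _ = _ := by rw [two_mul]
  -- The completeness statement asks for strict bounds with finite sum; replacing c by c + 1
  -- supplies the strictness.
  obtain ⟨L, hL, hlim⟩ := Lp.cauchy_complete_eLpNorm (μ := μ) hp1 (f := fun k => t (s k))
    (fun k => ht _ (hs2 k) (hsv k)) (B := fun K => (c + 1 : ℝ≥0) * (2 * (2⁻¹ : ℝ≥0∞) ^ K)) (by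
      rw [ENNReal.tsum_mul_left, ENNReal.tsum_mul_left, ENNReal.tsum_geometric]
      refine ENNReal.mul_ne_top ENNReal.coe_ne_top (ENNReal.mul_ne_top (by norm_num) ?_)
      simp) (fun K i j hi hj => by
      refine ((hLip _ _ (hs2 i) (hsv i) (hs2 j) (hsv j)).trans
        (mul_le_mul_right (hdiff K i j hi hj) _)).trans_lt ?_
      refine ENNReal.mul_lt_mul_left (by simp) (by finiteness) ?_
      exact_mod_cast lt_add_one c)
  refine ⟨L, hL, fun h hh2 hhv => ?_⟩
  -- The distance from t h to the limit is estimated through s k; letting k → ∞ gives a bound in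
  -- which the chosen approximants no longer appear.
  have hstep : ∀ k, eLpNorm (t h - L) (ENNReal.ofReal p) μ ≤
      c * (N (h - f) + (2⁻¹ : ℝ≥0∞) ^ k) + eLpNorm (t (s k) - L) (ENNReal.ofReal p) μ := by
    intro k
    rw [← sub_add_sub_cancel (t h) (t (s k)) L]
    have hm1 := (ht h hh2 hhv).1
    have hm2 := (ht (s k) (hs2 k) (hsv k)).1
    refine (eLpNorm_add_le (hm1.sub hm2) (hm2.sub hL.1) hp1).trans (add_le_add ?_ le_rfl)
    refine (hLip _ _ hh2 hhv (hs2 k) (hsv k)).trans (mul_le_mul_right ?_ _)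
    refine (htri h f (s k) hhv hf (hsv k)).trans (add_le_add le_rfl ?_)
    rw [hN]; simp only
    rw [eLpNorm_sub_comm]
    exact hsε k
  have hto : Filter.Tendsto (fun k : ℕ => c * (N (h - f) + (2⁻¹ : ℝ≥0∞) ^ k) +
      eLpNorm (t (s k) - L) (ENNReal.ofReal p) μ) Filter.atTop
      (nhds (c * (N (h - f) + 0) + 0)) := by
    refine Filter.Tendsto.add (ENNReal.Tendsto.const_mul (tendsto_const_nhds.add ?_)
      (Or.inr ENNReal.coe_ne_top)) hlim
    exact ENNReal.tendsto_pow_atTop_nhds_zero_of_lt_one (by simp)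
  rw [add_zero, add_zero] at hto
  exact ge_of_tendsto' hto hstep

end Extension

end MaxModCZ

end

open MaxModCZ in
/-- Two-weight inequality `T^Φ : L^p(v) → L^p(u)`: the inequality for `f ∈ L²`, where `T^Φ f` is
given by its defining supremum, together with the (necessarily unique) continuous extension
of `T^Φ` from `L² ∩ L^p(v)` to all of `L^p(v)`, with the same bound. -/
theorem theorem7p1 {n : ℕ} (hn : 0 < n) {ι : Type*}
    (T : (MaxModCZ.Eu n → ℂ) → MaxModCZ.Eu n → ℂ) (hT : MaxModCZ.IsCZOperator T)
    (φ : ι → MaxModCZ.Eu n → ℝ) (hφ : ∀ α, Measurable (φ α))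
    (r₀ : ℝ) (hr₀ : 1 < r₀) (ψ : ℝ → ℝ≥0) (hwt : MaxModCZ.WeakTypeBounds T φ r₀ ψ)
    (p : ℝ) (hp : 1 < p)
    (A B : ℝ≥0 → ℝ≥0) (hA : MaxModCZ.IsYoung A) (hB : MaxModCZ.IsYoung B)
    (hA2 : MaxModCZ.IsDoubling A) (hB2 : MaxModCZ.IsDoubling B)
    (r : ℝ) (hr : 1 < r) (hr' : r < min r₀ p)
    (hAp : MaxModCZ.SatisfiesB (p / (p - 1)) (MaxModCZ.complementary A))
    (hBp : MaxModCZ.SatisfiesB (p / r) (MaxModCZ.complementary B))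
    (u v : MaxModCZ.Eu n → ℝ) (hu : MaxModCZ.IsPosWeight u) (hv : MaxModCZ.IsPosWeight v)
    (huv : MaxModCZ.bump p r A B u v < ∞) :
    ∃ C : ℝ≥0,
      (∀ f : MaxModCZ.Eu n → ℂ, MemLp f 2 volume →
        ∫⁻ x, MaxModCZ.maxMod T φ f x ^ p * ENNReal.ofReal (u x) ≤
          C * ∫⁻ x, ‖f x‖ₑ ^ p * ENNReal.ofReal (v x)) ∧
      ∃ S : (MaxModCZ.Eu n → ℂ) → MaxModCZ.Eu n → ℝ≥0,
        (∀ f, MemLp f 2 volume → MaxModCZ.MemWeightedLp p v f →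
          ∀ᵐ x, MaxModCZ.maxMod T φ f x = (S f x : ℝ≥0∞)) ∧
        (∀ f, MaxModCZ.MemWeightedLp p v f →
          AEMeasurable (S f) volume ∧
          ∫⁻ x, (S f x : ℝ≥0∞) ^ p * ENNReal.ofReal (u x) ≤
            C * ∫⁻ x, ‖f x‖ₑ ^ p * ENNReal.ofReal (v x)) ∧
        (∀ f g, MaxModCZ.MemWeightedLp p v f → MaxModCZ.MemWeightedLp p v g →
          ∫⁻ x, edist (S f x) (S g x) ^ p * ENNReal.ofReal (u x) ≤
            C * ∫⁻ x, ‖f x - g x‖ₑ ^ p * ENNReal.ofReal (v x)) := by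
  have hp0 : 0 < p := by linarith
  have hr₀' : r ≤ r₀ := (hr'.trans_le (min_le_left _ _)).le
  have hrp : r < p := hr'.trans_le (min_le_right _ _)
  obtain ⟨C, -, hC⟩ := exists_lintegral_maxMod_rpow_le hn hT hφ hwt hr hr₀' hrp hA hB hAp hBp hu
    hv huv
  refine ⟨C, hC, ?_⟩
  set q : ℝ≥0∞ := ENNReal.ofReal p with hq
  set μ := weightMeasure u with hμ
  set t : (Eu n → ℂ) → Eu n → ℝ := fun f x => (maxMod T φ f x).toReal with ht
  set c : ℝ≥0 := C ^ (1 / p) with hc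
  have hcp : (c : ℝ≥0∞) ^ p = C := by
    rw [hc, ENNReal.coe_rpow_of_nonneg _ (by positivity), ← ENNReal.rpow_mul,
      one_div_mul_cancel hp0.ne', ENNReal.rpow_one]
  have hcC : (c : ℝ≥0∞) = (C : ℝ≥0∞) ^ (1 / p) := by
    rw [hc, ENNReal.coe_rpow_of_nonneg _ (by positivity)]
  have hmeas : ∀ f, MemLp f 2 volume → MemWeightedLp p v f →
      AEMeasurable (maxMod T φ f) volume := fun f hf hfv =>
    aemeasurable_maxMod hn hT hφ hwt hr hr₀' hp0 hA hB hBp hu hv huv hf hfv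
  have hfin : ∀ f, MemLp f 2 volume → MemWeightedLp p v f → ∀ᵐ x, maxMod T φ f x ≠ ∞ := by
    intro f hf hfv
    have h1 : ∫⁻ x, maxMod T φ f x ^ p * ENNReal.ofReal (u x) ≠ ∞ :=
      ((hC f hf).trans_lt (ENNReal.mul_lt_top ENNReal.coe_lt_top hfv.2)).ne
    filter_upwards [ae_lt_top' (((hmeas f hf hfv).pow_const p).mul hu.aemeasurable_ofReal) h1,
      hu.pos] with x hx hux htop
    rw [Pi.mul_apply, htop, ENNReal.top_rpow_of_pos hp0, ENNReal.top_mul (ENNReal.ofReal_pos.2 hux).ne'] at hx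
    exact lt_irrefl _ hx
  have htmeas : ∀ f, MemLp f 2 volume → MemWeightedLp p v f →
      AEStronglyMeasurable (t f) volume := fun f hf hfv =>
    (hmeas f hf hfv).ennreal_toReal.aestronglyMeasurable
  have hsub : ∀ f g, MemWeightedLp p v f → MemWeightedLp p v g → MemWeightedLp p v (f - g) :=
    fun f g hf hg => MemLp.memWeightedLp hp0 hv ((hf.memLp hp0 hv).sub (hg.memLp hp0 hv))
  -- Sublinearity in both directions gives |T^Φ f − T^Φ g| ≤ T^Φ(f − g), so the inequality for f − g
  -- is a Lipschitz bound.
  have hLip : ∀ f g, MemLp f 2 volume → MemWeightedLp p v f → MemLp g 2 volume →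
      MemWeightedLp p v g → eLpNorm (t f - t g) q μ ≤
        c * eLpNorm (f - g) q (weightMeasure v) := by
    intro f g hf hfv hg hgv
    rw [hq, hμ, eLpNorm_weightMeasure hp0 hu ((htmeas f hf hfv).sub (htmeas g hg hgv)),
      eLpNorm_weightMeasure hp0 hv (hfv.1.sub hgv.1), hcC,
      ← ENNReal.mul_rpow_of_nonneg _ _ (by positivity)]
    refine ENNReal.rpow_le_rpow (le_trans (lintegral_mono_ae ?_) (hC (f - g) (hf.sub hg)))
      (by positivity)
    filter_upwards [hfin f hf hfv, hfin g hg hgv] with x hx hx'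
    gcongr
    refine enorm_toReal_sub_toReal_le hx hx' (maxMod_le_add_sub hT hφ hf hg x) ?_
    have h1 := maxMod_le_add_sub hT hφ hg hf x
    rwa [← neg_sub f g, maxMod_neg hT hφ (hf.sub hg)] at h1
  have htzero : t 0 = 0 := by
    funext x
    have h0 : T 0 = 0 := by
      have := hT.map_smul 0 0 MemLp.zero
      simpa using this
    have h1 : ∀ α, modulate (φ α) (0 : Eu n → ℂ) = 0 := fun α => by ext y; simp [modulate]
    simp [ht, maxMod, h1, h0]
  have hzero : MemWeightedLp p v (0 : Eu n → ℂ) :=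
    ⟨aestronglyMeasurable_zero, by simp [hp0]⟩
  have htLp : ∀ f, MemLp f 2 volume → MemWeightedLp p v f → MemLp (t f) q μ := by
    intro f hf hfv
    refine ⟨(htmeas f hf hfv).mono_ac (weightMeasure_absolutelyContinuous u), ?_⟩
    have h1 := hLip f 0 hf hfv MemLp.zero hzero
    rw [htzero, sub_zero, sub_zero] at h1
    exact h1.trans_lt (ENNReal.mul_lt_top ENNReal.coe_lt_top (hfv.memLp hp0 hv).2)
  have hex : ∀ f, ∃ L : Eu n → ℝ, MemWeightedLp p v f → MemLp L q μ ∧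
      ∀ h, MemLp h 2 volume → MemWeightedLp p v h →
        eLpNorm (t h - L) q μ ≤ c * eLpNorm (h - f) q (weightMeasure v) := by
    intro f
    by_cases hf : MemWeightedLp p v f
    · obtain ⟨L, hL⟩ := exists_limit hp.le hv htLp hLip hf
      exact ⟨L, fun _ => hL⟩
    · exact ⟨0, fun h => absurd h hf⟩
  choose L hL using hex
  have hLmeas : ∀ f, MemWeightedLp p v f → AEStronglyMeasurable (L f) volume := fun f hf =>
    (hL f hf).1.1.mono_ac hu.absolutelyContinuous
  have hq1 : 1 ≤ q := by simpa [hq] using hp.le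
  have hLL : ∀ f g, MemWeightedLp p v f → MemWeightedLp p v g →
      eLpNorm (L f - L g) q μ ≤ c * eLpNorm (f - g) q (weightMeasure v) := by
    intro f g hf hg
    have hbound : ∀ ε : ℝ≥0∞, ε ≠ 0 → eLpNorm (L f - L g) q μ ≤
        c * (ε + (ε + eLpNorm (f - g) q (weightMeasure v))) := by
      intro ε hε
      obtain ⟨h, h2, hv', hle⟩ := hf.exists_approx hp0 hv hε
      have hfm := (hf.memLp hp0 hv).1
      have hgm := (hg.memLp hp0 hv).1
      have hhm := (hv'.memLp hp0 hv).1
      rw [← sub_add_sub_cancel (L f) (t h) (L g), mul_add]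
      refine (eLpNorm_add_le ((hL f hf).1.1.sub (htLp h h2 hv').1)
        ((htLp h h2 hv').1.sub (hL g hg).1.1) hq1).trans (add_le_add ?_ ?_)
      · rw [eLpNorm_sub_comm]
        exact ((hL f hf).2 h h2 hv').trans (mul_le_mul_right hle _)
      · refine ((hL g hg).2 h h2 hv').trans (mul_le_mul_right ?_ _)
        rw [← sub_add_sub_cancel h f g]
        exact (eLpNorm_add_le (hhm.sub hfm) (hfm.sub hgm) hq1).trans (add_le_add hle le_rfl)
    have hto : Filter.Tendsto (fun k : ℕ => c * ((2⁻¹ : ℝ≥0∞) ^ k + ((2⁻¹ : ℝ≥0∞) ^ k +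
        eLpNorm (f - g) q (weightMeasure v)))) Filter.atTop
        (nhds (c * (0 + (0 + eLpNorm (f - g) q (weightMeasure v))))) := by
      have h0 := ENNReal.tendsto_pow_atTop_nhds_zero_of_lt_one (r := (2⁻¹ : ℝ≥0∞)) (by simp)
      exact ENNReal.Tendsto.const_mul (h0.add (h0.add tendsto_const_nhds))
        (Or.inr ENNReal.coe_ne_top)
    rw [zero_add, zero_add] at hto
    exact ge_of_tendsto' hto fun k => hbound _ (by simp)
  -- The positive part is 1-Lipschitz and fixes the nonnegative functions t f, so it keeps every
  -- estimate and gives nonnegative values.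
  refine ⟨fun f x => (L f x).toNNReal, fun f hf hfv => ?_, fun f hf => ⟨?_, ?_⟩,
    fun f g hf hg => ?_⟩
  -- With h = f the right side of the limit estimate vanishes, so L f agrees with t f almost
  -- everywhere.
  · have h1 := (hL f hfv).2 f hf hfv
    rw [sub_self, eLpNorm_zero, mul_zero, nonpos_iff_eq_zero, eLpNorm_eq_zero_iff
      ((htLp f hf hfv).1.sub (hL f hfv).1.1) (by positivity)] at h1
    filter_upwards [hu.absolutelyContinuous.ae_le h1, hfin f hf hfv] with x hx hx'
    have hx1 : L f x = (maxMod T φ f x).toReal := by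
      have : t f x - L f x = 0 := hx
      linarith
    simp only [hx1]
    exact (ENNReal.ofReal_toReal hx').symm
  · exact (hLmeas f hf).aemeasurable.real_toNNReal
  -- With h = 0 and t 0 = 0 the limit estimate becomes the norm bound for L f.
  · have h1 := (hL f hf).2 0 MemLp.zero hzero
    rw [htzero, zero_sub, zero_sub, eLpNorm_neg, eLpNorm_neg] at h1
    calc ∫⁻ x, (((L f x).toNNReal : ℝ≥0) : ℝ≥0∞) ^ p * ENNReal.ofReal (u x)
        ≤ ∫⁻ x, ‖L f x‖ₑ ^ p * ENNReal.ofReal (u x) := by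
          gcongr with x
          rw [Real.enorm_eq_ofReal_abs]
          exact ENNReal.ofReal_le_ofReal (le_abs_self _)
      _ = eLpNorm (L f) q μ ^ p := lintegral_rpow_eq_eLpNorm hp0 hu (hLmeas f hf)
      _ ≤ (c * eLpNorm f q (weightMeasure v)) ^ p := ENNReal.rpow_le_rpow h1 hp0.le
      _ = _ := by
          rw [ENNReal.mul_rpow_of_nonneg _ _ hp0.le, hcp, lintegral_rpow_eq_eLpNorm hp0 hv hf.1]
  · calc ∫⁻ x, edist (L f x).toNNReal (L g x).toNNReal ^ p * ENNReal.ofReal (u x)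
        ≤ ∫⁻ x, ‖(L f - L g) x‖ₑ ^ p * ENNReal.ofReal (u x) := by
          gcongr with x
          exact edist_toNNReal_le _ _
      _ = eLpNorm (L f - L g) q μ ^ p :=
          lintegral_rpow_eq_eLpNorm hp0 hu ((hLmeas f hf).sub (hLmeas g hg))
      _ ≤ (c * eLpNorm (f - g) q (weightMeasure v)) ^ p :=
          ENNReal.rpow_le_rpow (hLL f g hf hg) hp0.le
      _ = _ := by
          rw [ENNReal.mul_rpow_of_nonneg _ _ hp0.le, hcp,
            ← lintegral_rpow_eq_eLpNorm hp0 hv (hf.1.sub hg.1)]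
          rfl
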